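/- **Main theorem.** Let $p,q$ be integers with $(p-1)(q-1)>1$ and put $N=(p-1)(q-1)-1$. For complex numbers $\lambda_2,\dots,\lambda_q$ and $\tilde\lambda_2,\dots,\tilde\lambda_p$ set $g_1=\tilde g_1=0$ and $$g_k=g^{\frac{k-2}2}\lambda_k\ (2\le k\le q),\qquad \tilde g_k=g^{\frac{k-2}2}\tilde\lambda_k\ (2\le k\le p),$$ regarded as formal power series in $\sqrt g$. Then for generic $(\lambda,\tilde\lambda)$, i.e. outside the zero set of some nonzero polynomial in the $\lambda_k,\tilde\lambda_k$ which depends only on $p,q$, the following holds. 1. There are unique $\alpha_0,\dots,\alpha_{q-1},\beta_0,\dots,\beta_{p-1},R\in\mathbb C[[\sqrt g]]$ such that $X(z)=z+\sum_{j=0}^{q-1}\alpha_jz^{-j}$ and $Y(z)=\frac Rz+\sum_{j=0}^{p-1}\beta_jz^j$ satisfy $$\alpha_j=\sum_{k=j+1}^{q}g_k\,[z^{-j}]Y(z)^{k-1},\qquad \beta_j=\sum_{k=j+1}^{p}\tilde g_k\,[z^{j}]X(z)^{k-1},\qquad \sum_{j=1}^{\min(p,q)-1}j\alpha_j\beta_j=R-1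 .$$ 2. Over the field $K=\mathbb C((\sqrt g))$ this curve has exactly $N$ double points: pairs $(w_a,\bar w_a)$, $1\le a\le N$, of nonzero elements with $w_a\ne\bar w_a$, $X(w_a)=X(\bar w_a)$, $Y(w_a)=Y(\bar w_a)$. The $2N$ elements are pairwise distinct, and in each pair we may call $w_a$ the smaller one for small $g$ (the one with the larger order in $\sqrt g$). 3. For $n\in\mathbb Z$ put $\xi_n=(\bar w_a^{\,n}-w_a^{\,n})_{1\le a\le N}$, $$h_n=\det(\xi_{n+1},\dots,\xi_{n+N})=\det_{1\le a,b\le N}\left(\bar w_a^{\,n+b}-w_a^{\,n+b}\right),$$ $$\psi_n(z)=\frac{z^{n+1}}{h_n}\det\left(z\xi_{n+1}-\xi_{n+2},\dots,z\xi_{n+N}-\xi_{n+N+1}\right),\qquad \phi_n=\psi_{-2-n-N},$$ $$\langle f,g\rangle=-\operatorname*{Res}_{z\to\infty}\frac{f(z)g(z)z^{N-1}\,dz}{\prod_{a=1}^N(z-w_a)(z-\bar w_a)} .$$ For all $n\ge0$ one has $h_n\ne0$ and $h_{-2-n-N}\neq 0$, so that $\psi_n$ and $\phi_n$ are well defined.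 4. For $n,m\ge0$ let $Q_{n,m}=\langle\phi_m,X\psi_n\rangle$ and $P_{n,m}=\langle\phi_m,Y\psi_n\rangle$, and for $n\geq 1$ let $R_n=P_{n,n-1}$. All these quantities are formal power series in $\sqrt g$. One has $Q_{n,m}=0$ unless $n-q+1\le m\le n+1$ and $P_{n,m}=0$ unless $n-1\le m\le n+p-1$, all $R_n$ are nonzero, and the semi-infinite matrices $Q,P$ solve the mobile system $$Q_{n,n+1}=1,\qquad \Big(P-\sum_{k=0}^{p-1}\tilde g_{k+1}Q^k\Big)_{n,m}=0\ (n\le m),\qquad \Big(Q-\sum_{k=0}^{q-1}g_{k+1}P^k\Big)_{n,m}=0\ (m\le n),$$ $$\Big(P-\sum_{k=0}^{p-1}\tilde g_{k+1}Q^k\Big)_{n,n-1}=1\ (n\ge1),\qquad \Big(Q-\sum_{k=0}^{q-1}g_{k+1}P^k\Big)_{n,n+1}=\frac1{R_{n+1}}\ (n\ge0).$$ They form its only solution, with these bands and nonzero $R_n$, whose entries are formal power series in $\sqrt g$. 5. Suppose $|\lambda_2\tilde\lambda_2|<1$. Then $R_n$ ($n\ge1$), $Q_{i,j}$ ($0\le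 j\le i$) and $P_{i,j}$ ($0\le i\le j$) are the generating functions, with weight $g_k$ per white vertex and $\tilde g_k$ per black vertex of degree $k$, of respectively: mobiles with a marked corner at a labeled vertex with label $n$ (the isolated vertex with label $n$ included, with weight $1$), white half-mobiles with flag labels $i,j$, and black half-mobiles with flag labels $i,j$. Each coefficient of a power of $\sqrt g$ is an absolutely convergent sum. Here a mobile is a plane tree with black vertices, white vertices and labeled vertices (labels $\ge1$), not reduced to a single vertex. Its edges join either a white and a labeled vertex, or a black and a white vertex; the latter are called flagged and carry a label $\ge0$ on each side. Clockwise around a white vertex, labels do not decrease across a flagged edge, are constant from a flag to the next flag or labeled vertex, and drop by $1$ from a labeled vertex to the next flag or labeled vertex. Clockwise around a black vertex, labels do not increase across a flagged edge and do not decrease from one flagged edge to the next, where the increase is the number of buds placed between the two edges. Buds count in the degree of a black vertex. A white (black) half-mobile with flag labels $i,j$ is the part on the side of the white (black) end, when a mobile is cut at a flagged edge with label $i$ on the left and $j$ on the right of the edge oriented towards that end. 6. For all $n\ge1$, $$R_n=R\,\frac{h_{n-1}h_{n+1}}{h_n^2}.$$ -/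

import Mathlib

noncomputable section

namespace Mobile

/-! ### Mobiles

A mobile is a plane tree, so once it is rooted it is described by the ordered (clockwise) sequence
of what hangs from each vertex. The indices of the three types below are the labels, and the
constructors are exactly the label rules:

* clockwise around a white vertex the label is unchanged between a flag and the next flag or
  labeled vertex, drops by one after a labeled vertex, and does not decrease across a flagged edge;
* clockwise around a black vertex the label does not increase across a flagged edge, and does not
  decrease between two flagged edges, the increase being the number of buds placed there.

Flag labels are `≥ 0`, labels of labeled vertices are `≥ 1`. -/

mutual
/-- A mobile with a marked corner at a labeled vertex with label `i`, given by the clockwise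
sequence of the white vertices adjacent to that vertex; `vertex` is the isolated vertex. -/
inductive CornerMobile : ℕ → Type
  | vertex (i : ℕ) : CornerMobile i
  | cons {n : ℕ} (w : WhiteSeq n (n + 1)) (c : CornerMobile (n + 1)) : CornerMobile (n + 1)

/-- The part of a mobile beyond an edge ending at a white vertex `v`: the clockwise sequence of the
other neighbours of `v`, with the subtrees they carry, along which the label goes from the first
index to the second one. -/
inductive WhiteSeq : ℕ → ℕ → Type
  | nil (i : ℕ) : WhiteSeq i i
  | labeled {n j : ℕ} (c : CornerMobile (n + 1)) (s : WhiteSeq n j) : WhiteSeq (n + 1) j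
  | flag {m m' j : ℕ} (h : m ≤ m') (b : BlackSeq m m') (s : WhiteSeq m' j) : WhiteSeq m j

/-- The part of a mobile beyond a flagged edge ending at a black vertex `v`: the clockwise sequence
of the buds and of the other flagged edges at `v`, with the subtrees they carry. -/
inductive BlackSeq : ℕ → ℕ → Type
  | nil (i : ℕ) : BlackSeq i i
  | bud {n j : ℕ} (s : BlackSeq (n + 1) j) : BlackSeq n j
  | flag {m m' j : ℕ} (h : m' ≤ m) (w : WhiteSeq m m') (s : BlackSeq m' j) : BlackSeq m j
end

/-- Number of neighbours listed, i.e. the degree of the white vertex minus one. -/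
def WhiteSeq.length {i j : ℕ} : WhiteSeq i j → ℕ
  | .nil _ => 0
  | .labeled _ s => s.length + 1
  | .flag _ _ s => s.length + 1

/-- Number of buds and flagged edges listed, i.e. the degree of the black vertex minus one. -/
def BlackSeq.length {i j : ℕ} : BlackSeq i j → ℕ
  | .nil _ => 0
  | .bud s => s.length + 1
  | .flag _ _ s => s.length + 1

section Weights

variable {A : Type} [CommSemiring A] (g gt : ℕ → A)

mutual
/-- The weight of a mobile: `g k` per white vertex and `gt k` per black vertex of degree `k`. -/
def CornerMobile.weight : {i : ℕ} → CornerMobile i → A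
  | _, .vertex _ => 1
  | _, .cons w c => g (w.length + 1) * w.innerWeight * c.weight

/-- The weight of everything except the white root vertex itself. -/
def WhiteSeq.innerWeight : {i j : ℕ} → WhiteSeq i j → A
  | _, _, .nil _ => 1
  | _, _, .labeled c s => c.weight * s.innerWeight
  | _, _, .flag _ b s => gt (b.length + 1) * b.innerWeight * s.innerWeight

/-- The weight of everything except the black root vertex itself. -/
def BlackSeq.innerWeight : {i j : ℕ} → BlackSeq i j → A
  | _, _, .nil _ => 1
  | _, _, .bud s => s.innerWeight
  | _, _, .flag _ w s => g (w.length + 1) * w.innerWeight * s.innerWeight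
end

/-- Weight of a white half-mobile, its white root vertex included. -/
def WhiteSeq.weight {i j : ℕ} (w : WhiteSeq i j) : A :=
  g (w.length + 1) * w.innerWeight g gt

/-- Weight of a black half-mobile, its black root vertex included. -/
def BlackSeq.weight {i j : ℕ} (b : BlackSeq i j) : A :=
  gt (b.length + 1) * b.innerWeight g gt

end Weights

/-- `F` is the sum of the weights of all objects of type `ι`, coefficient by coefficient
(each coefficient is an absolutely convergent series of complex numbers). -/
def IsGeneratingFunction {ι : Type} (weight : ι → PowerSeries ℂ) (F : PowerSeries ℂ) : Prop :=
  ∀ d : ℕ, HasSum (fun m : ι => PowerSeries.coeff d (weight m)) (PowerSeries.coeff d F)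

/-! ### The mobile system for semi-infinite band matrices -/

/-- Product of semi-infinite matrices (meaningful when the rows of `A` have finite support). -/
def infMul {K : Type} [Semiring K] (A B : ℕ → ℕ → K) : ℕ → ℕ → K :=
  fun i j => ∑ᶠ k : ℕ, A i k * B k j

/-- Powers of a semi-infinite matrix. -/
def infPow {K : Type} [Semiring K] (A : ℕ → ℕ → K) : ℕ → ℕ → ℕ → K
  | 0 => fun i j => if i = j then 1 else 0
  | k + 1 => infMul (infPow A k) A

/-- The mobile system for the band matrices `Q`, `P`; the number `R_n`, `n ≥ 1`, is the entry
`P n (n - 1)`. -/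
structure IsMobileSystem {K : Type} [Field K] (p q : ℕ) (g gt : ℕ → K) (Q P : ℕ → ℕ → K) :
    Prop where
  Q_band : ∀ n m, n + 1 < m ∨ m + q < n + 1 → Q n m = 0
  P_band : ∀ n m, m + 1 < n ∨ n + p < m + 1 → P n m = 0
  Q_super : ∀ n, Q n (n + 1) = 1
  R_ne_zero : ∀ n, P (n + 1) n ≠ 0
  upper : ∀ n m, n ≤ m → P n m - ∑ k ∈ Finset.range p, gt (k + 1) * infPow Q k n m = 0
  lower : ∀ n m, m ≤ n → Q n m - ∑ k ∈ Finset.range q, g (k + 1) * infPow P k n m = 0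
  subdiag : ∀ n, P (n + 1) n - ∑ k ∈ Finset.range p, gt (k + 1) * infPow Q k (n + 1) n = 1
  superdiag : ∀ n, Q n (n + 1) - ∑ k ∈ Finset.range q, g (k + 1) * infPow P k n (n + 1)
    = 1 / P (n + 1) n

/-! ### The spectral curve -/


/-- The coefficients of a rational curve `z ↦ (X(z), Y(z))`. -/
structure Curve (A : Type) where
  α : ℕ → A
  β : ℕ → A
  R : A

namespace Curve

/-- Change of coefficients. -/
def map {A B : Type} [CommRing A] [CommRing B] (f : A →+* B) (c : Curve A) : Curve B :=
  ⟨fun j => f (c.α j), fun j => f (c.β j), f c.R⟩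

variable {A : Type} [CommRing A]

/-- `X(z) = z + ∑_{j<q} α_j z^{-j}`. -/
def X (q : ℕ) (c : Curve A) : LaurentPolynomial A :=
  LaurentPolynomial.T 1 +
    ∑ j ∈ Finset.range q, LaurentPolynomial.C (c.α j) * LaurentPolynomial.T (-(j : ℤ))

/-- `Y(z) = R/z + ∑_{j<p} β_j z^j`. -/
def Y (p : ℕ) (c : Curve A) : LaurentPolynomial A :=
  LaurentPolynomial.C c.R * LaurentPolynomial.T (-1) +
    ∑ j ∈ Finset.range p, LaurentPolynomial.C (c.β j) * LaurentPolynomial.T (j : ℤ)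

/-- The algebraic equations that define the spectral curve. -/
structure IsSpectral (p q : ℕ) (g gt : ℕ → A) (c : Curve A) : Prop where
  α_eq_zero : ∀ j, q ≤ j → c.α j = 0
  β_eq_zero : ∀ j, p ≤ j → c.β j = 0
  α_eq : ∀ j, j < q →
    c.α j = ∑ k ∈ Finset.Icc (j + 1) q, g k * ((c.Y p) ^ (k - 1)).coeff (-(j : ℤ))
  β_eq : ∀ j, j < p →
    c.β j = ∑ k ∈ Finset.Icc (j + 1) p, gt k * ((c.X q) ^ (k - 1)).coeff (j : ℤ)
  R_eq : ∑ j ∈ Finset.Icc 1 (min p q - 1), (j : A) * c.α j * c.β j = c.R - 1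

/-- `z ≠ z'` are the two parameters of a double point of the curve. -/
def IsDoublePoint {K : Type} [Field K] (p q : ℕ) (c : Curve K) (z z' : Kˣ) : Prop :=
  z ≠ z' ∧
  LaurentPolynomial.eval₂ (RingHom.id K) z (c.X q) =
    LaurentPolynomial.eval₂ (RingHom.id K) z' (c.X q) ∧
  LaurentPolynomial.eval₂ (RingHom.id K) z (c.Y p) =
    LaurentPolynomial.eval₂ (RingHom.id K) z' (c.Y p)

/-- `(w a, wb a)`, `a = 1, …, N`, is the list of all the double points, the `2N` parameters being
pairwise distinct. The convention `|w a| < |wb a|` (for a small value of the variable of the series)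
reads: the order of vanishing of `w a` exceeds that of `wb a`. -/
structure IsDoublePointList (p q : ℕ) (c : Curve (LaurentSeries ℂ)) {N : ℕ}
    (w wb : Fin N → (LaurentSeries ℂ)ˣ) : Prop where
  isDoublePoint : ∀ a, c.IsDoublePoint p q (w a) (wb a)
  order_lt : ∀ a, (wb a : LaurentSeries ℂ).order < (w a : LaurentSeries ℂ).order
  distinct : Function.Injective (Sum.elim w wb)
  complete : ∀ z z', c.IsDoublePoint p q z z' →
    ∃ a, (z = w a ∧ z' = wb a) ∨ (z = wb a ∧ z' = w a)

end Curve

/-! ### Baker-Akhiezer functions and the scalar product -/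

section BakerAkhiezer

variable {K : Type} [Field K] {N : ℕ} (w wb : Fin N → Kˣ)

/-- The `a`-th entry of the vector `ξ_n`. -/
def xi (n : ℤ) (a : Fin N) : K := (wb a : K) ^ n - (w a : K) ^ n

/-- `h_n = det (ξ_{n+1}, …, ξ_{n+N})`; the index `b` below runs from `0` to `N - 1`. -/
def h (n : ℤ) : K :=
  Matrix.det (Matrix.of fun a b : Fin N => xi w wb (n + 1 + ((b : ℕ) : ℤ)) a)

/-- `ψ_n(z) = z^{n+1} / h_n · det (z ξ_{n+1} - ξ_{n+2}, …, z ξ_{n+N} - ξ_{n+N+1})`. -/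
def psi (n : ℤ) : LaurentPolynomial K :=
  LaurentPolynomial.C (h w wb n)⁻¹ * LaurentPolynomial.T (n + 1) *
    Matrix.det (Matrix.of fun a b : Fin N =>
      LaurentPolynomial.T 1 * LaurentPolynomial.C (xi w wb (n + 1 + ((b : ℕ) : ℤ)) a) -
        LaurentPolynomial.C (xi w wb (n + 2 + ((b : ℕ) : ℤ)) a))

/-- `φ_n = ψ_{-2-n-N}`. -/
def phi (n : ℤ) : LaurentPolynomial K := psi w wb (-2 - n - (N : ℤ))

/-- Expansion of a Laurent polynomial in `z` as a Laurent series in the variable `u = 1/z`. -/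
def expandAtInfinity (f : LaurentPolynomial K) : LaurentSeries K :=
  f.coeff.sum fun n a => HahnSeries.single (-n) a

/-- `Δ(z) Δ̄(z) = ∏_a (z - w_a) (z - wb_a)`. -/
def delta : LaurentPolynomial K :=
  ∏ a, ((LaurentPolynomial.T 1 - LaurentPolynomial.C (w a : K)) *
    (LaurentPolynomial.T 1 - LaurentPolynomial.C (wb a : K)))

/-- `⟨f, g⟩ = - Res_{z → ∞} f(z) g(z) z^{N-1} dz / (Δ(z) Δ̄(z))`. Minus the residue at infinity of
`F(z) dz` is the coefficient of `z^{-1} = u` in the expansion of `F` at infinity. -/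
def scalarProduct (f g : LaurentPolynomial K) : K :=
  (expandAtInfinity (f * g * LaurentPolynomial.T ((N : ℤ) - 1)) /
    expandAtInfinity (delta w wb)).coeff 1

end BakerAkhiezer

/-! ### Coupling constants -/

/-- The family `lam_2, …, lam_r`, extended by zero. -/
def extend {r : ℕ} (lam : Finset.Icc 2 r → ℂ) (k : ℕ) : ℂ :=
  if hk : k ∈ Finset.Icc 2 r then lam ⟨k, hk⟩ else 0

/-- `g_k = g^{(k-2)/2} lam_k` for `2 ≤ k ≤ r` and `g_k = 0` otherwise, as a power series in the
variable `√g`. -/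
def coupling {r : ℕ} (lam : Finset.Icc 2 r → ℂ) (k : ℕ) : PowerSeries ℂ :=
  PowerSeries.C (extend lam k) * PowerSeries.X ^ (k - 2)

/-- Power series in `√g` as elements of the field of Laurent series in `√g`. -/
abbrev toLaurent : PowerSeries ℂ →+* LaurentSeries ℂ := HahnSeries.ofPowerSeries ℤ ℂ

end Mobile

end

-- Write t for √g. The pair (X, Y) parametrises a rational curve with N = (p-1)(q-1) - 1 nodes, and
-- the Baker-Akhiezer functions ψ_n, φ_n respect the nodes: they take equal values at w_a and wb_a.
-- The functional F ↦ -Res_∞ F z^{N-1} dz / ∏(z - w_a)(z - wb_a) can be evaluated at infinity, where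
-- it returns the coefficient of z^N if deg F ≤ N. By the residue theorem it can also be evaluated
-- at 0, at the price of residues at the nodes. For F in the nodal ring these cancel in pairs
-- (`IsNodalPair.residue_eq`), because the monomials X^i Y^j of degrees 0, ..., N-1 force them to.
-- If moreover F has no term below z^{-N}, what remains is its coefficient of z^{-N} divided by ∏
-- w_a wb_a.
--
-- Evaluating ⟨φ_m, Z ψ_n⟩ at both ends gives biorthogonality, the bands of Q and P, and their
-- extreme entries. In particular R_n arises from the term R/z of Y and from the lowest coefficients
-- of ψ_n and φ_{n-1}, which are quotients of consecutive determinants h. The ψ_n, n ≥ 0, reproduce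
-- Z ψ_n only up to a remainder of degree at most N, which the φ_m do not see;
-- `IsNodalPair.residue_phi_pow` shows that the remainder stays invisible for the powers X^k, k < p,
-- and Y^k, k < q. The mobile system then expresses that Y - ∑ gt_{k+1} X^k = 1/z + ... at infinity
-- and X - ∑ g_{k+1} Y^k = z/R + ... at 0. The vanishing coefficients are the equations for β and α.
-- The leading ones follow from Res Y dX = 1, which is the equation for R, since X^k dX and Y^k dY
-- are exact.
--
-- The curve is the fixed point of a t-adic contraction. Comparison of orders shows that a node has
-- one parameter of the form x/t and one of the form t/v, and that the leading coefficient of x is a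
-- nonzero root of W(V(x)) = x, with W(u) = ∑ lam_k u^{k-1} and V(u) = ∑ lamT_k u^{k-1}. For lam_q,
-- lamT_p nonzero and simple roots, which is the genericity assumption, there are exactly N such
-- roots and each lifts uniquely (`exists_unique_lift`). The leading terms of the h_n are
-- determinants of Vandermonde type, hence nonzero, and counting orders jointly in t and 1/z shows
-- that the scalar products are power series (`IsSeparated.ordGE_residue`).
--
-- The mobile system has at most one solution in power series, by induction on powers of t; the
-- induction inverts 1 - lam_2 lamT_2, which is nonzero because 0 is a simple root of W(V(x)) - x.
-- The generating functions of mobiles solve the same system: the neighbours of a vertex form a walk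
-- on labels, and walks of length k are counted by k-th powers of matrices. They converge because,
-- for small t, a translation invariant system of majorants has a finite supersolution when |lam_2
-- lamT_2| < 1.

noncomputable section

namespace Mobile

/-! ### Lower bounds for the order of a series -/

section OrderBounds

variable {R : Type} [CommRing R]

/-- The order of vanishing of `f` is at least `n`. -/
def OrdGE (n : ℤ) (f : HahnSeries ℤ R) : Prop := ∀ k < n, f.coeff k = 0

theorem OrdGE.mono {n m : ℤ} {f : HahnSeries ℤ R} (hf : OrdGE n f) (h : m ≤ n) : OrdGE m f :=
  fun k hk => hf k (by omega)

theorem ordGE_zero (n : ℤ) : OrdGE n (0 : HahnSeries ℤ R) := fun _ _ => by simp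

theorem OrdGE.add {n : ℤ} {f g : HahnSeries ℤ R} (hf : OrdGE n f) (hg : OrdGE n g) :
    OrdGE n (f + g) := fun k hk => by simp [hf k hk, hg k hk]

theorem OrdGE.sub {n : ℤ} {f g : HahnSeries ℤ R} (hf : OrdGE n f) (hg : OrdGE n g) :
    OrdGE n (f - g) := fun k hk => by simp [hf k hk, hg k hk]

theorem OrdGE.sum {ι : Type*} {n : ℤ} {s : Finset ι} {f : ι → HahnSeries ℤ R}
    (hf : ∀ i ∈ s, OrdGE n (f i)) : OrdGE n (∑ i ∈ s, f i) := fun k hk => by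
  rw [HahnSeries.coeff_sum]
  exact Finset.sum_eq_zero fun i hi => hf i hi k hk

/-- Of the pairs with sum n + m only (n, m) survives both bounds. The bounds need not be the exact
orders, so a vanishing leading coefficient requires no separate case. -/
theorem coeff_mul_of_ordGE {n m : ℤ} {f g : HahnSeries ℤ R} (hf : OrdGE n f) (hg : OrdGE m g) :
    (f * g).coeff (n + m) = f.coeff n * g.coeff m := by
  rw [HahnSeries.coeff_mul]
  rw [Finset.sum_eq_single (n, m)]
  · rintro ⟨a, b⟩ hab hne
    rw [Finset.mem_antidiagonal] at hab
    obtain ⟨_, _, h3⟩ := hab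
    simp only at h3
    by_cases ha : a < n
    · simp [hf a ha]
    · by_cases hb : b < m
      · simp [hg b hb]
      · exact absurd (Prod.ext (by simp; omega) (by simp; omega)) hne
  · intro h
    rw [Finset.mem_antidiagonal] at h
    by_cases hf0 : f.coeff n = 0
    · simp [hf0]
    · by_cases hg0 : g.coeff m = 0
      · simp [hg0]
      · exact absurd ⟨hf0, hg0, rfl⟩ h

theorem OrdGE.mul {n m : ℤ} {f g : HahnSeries ℤ R} (hf : OrdGE n f) (hg : OrdGE m g) :
    OrdGE (n + m) (f * g) := fun k hk => by
  rw [HahnSeries.coeff_mul]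
  refine Finset.sum_eq_zero ?_
  rintro ⟨a, b⟩ hab
  rw [Finset.mem_antidiagonal] at hab
  obtain ⟨_, _, h3⟩ := hab
  simp only at h3
  by_cases ha : a < n
  · simp [hf a ha]
  · simp [hg b (by omega)]

theorem ordGE_single (n : ℤ) (r : R) : OrdGE n (HahnSeries.single n r) := fun k hk => by
  rw [HahnSeries.coeff_single_of_ne (by omega)]

theorem ordGE_one : OrdGE 0 (1 : HahnSeries ℤ R) := ordGE_single 0 1

theorem coeff_one_zero : (1 : HahnSeries ℤ R).coeff 0 = 1 := by
  simp

theorem OrdGE.pow {n : ℤ} {f : HahnSeries ℤ R} (hf : OrdGE n f) (k : ℕ) :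
    OrdGE (k * n) (f ^ k) := by
  induction k with
  | zero => simpa using ordGE_one
  | succ k ih =>
    rw [pow_succ]
    exact (ih.mul hf).mono (by push_cast; linarith)

theorem coeff_pow_of_ordGE {n : ℤ} {f : HahnSeries ℤ R} (hf : OrdGE n f) (k : ℕ) :
    (f ^ k).coeff (k * n) = f.coeff n ^ k := by
  induction k with
  | zero => simp
  | succ k ih =>
    rw [pow_succ, pow_succ, ← ih, ← coeff_mul_of_ordGE (hf.pow k) hf]
    congr 1
    push_cast; ring

theorem OrdGE.prod {ι : Type*} {s : Finset ι} {n : ι → ℤ} {f : ι → HahnSeries ℤ R}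
    (hf : ∀ i ∈ s, OrdGE (n i) (f i)) : OrdGE (∑ i ∈ s, n i) (∏ i ∈ s, f i) := by
  classical
  induction s using Finset.induction_on with
  | empty => simpa using ordGE_one
  | insert a s ha ih =>
    rw [Finset.sum_insert ha, Finset.prod_insert ha]
    exact (hf a (Finset.mem_insert_self a s)).mul
      (ih fun i hi => hf i (Finset.mem_insert_of_mem hi))

theorem coeff_prod_of_ordGE {ι : Type*} {s : Finset ι} {n : ι → ℤ} {f : ι → HahnSeries ℤ R}
    (hf : ∀ i ∈ s, OrdGE (n i) (f i)) :
    (∏ i ∈ s, f i).coeff (∑ i ∈ s, n i) = ∏ i ∈ s, (f i).coeff (n i) := by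
  classical
  induction s using Finset.induction_on with
  | empty => simp
  | insert a s ha ih =>
    rw [Finset.sum_insert ha, Finset.prod_insert ha, Finset.prod_insert ha,
      coeff_mul_of_ordGE (hf a (Finset.mem_insert_self a s))
        (OrdGE.prod fun i hi => hf i (Finset.mem_insert_of_mem hi)),
      ih fun i hi => hf i (Finset.mem_insert_of_mem hi)]

end OrderBounds

section OrderField

variable {F : Type} [Field F]

/-- If the order m of f⁻¹ were below -n, the product of the leading coefficients would be a nonzero
coefficient of f f⁻¹ = 1 in the negative degree n + m. -/
theorem OrdGE.inv {n : ℤ} {f : HahnSeries ℤ F} (hf : OrdGE n f) (h0 : f.coeff n ≠ 0) :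
    OrdGE (-n) f⁻¹ ∧ (f⁻¹).coeff (-n) = (f.coeff n)⁻¹ := by
  have hfne : f ≠ 0 := by rintro rfl; simp at h0
  have key : OrdGE (-n) f⁻¹ := by
    by_contra hcon
    have hg : f⁻¹ ≠ 0 := inv_ne_zero hfne
    set m := (f⁻¹).order with hm
    have hm1 : OrdGE m f⁻¹ := fun k hk => HahnSeries.coeff_eq_zero_of_lt_order hk
    have hm2 : (f⁻¹).coeff m ≠ 0 := HahnSeries.coeff_order_eq_zero.not.2 hg
    have hlt : m < -n := by
      by_contra hh
      exact hcon (hm1.mono (by omega))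
    have h1 := coeff_mul_of_ordGE hf hm1
    rw [mul_inv_cancel₀ hfne, HahnSeries.coeff_one, if_neg (by omega)] at h1
    exact mul_ne_zero h0 hm2 h1.symm
  refine ⟨key, ?_⟩
  have h1 := coeff_mul_of_ordGE hf key
  rw [mul_inv_cancel₀ hfne, HahnSeries.coeff_one, if_pos (by omega)] at h1
  exact eq_inv_of_mul_eq_one_right h1.symm

theorem OrdGE.zpow {n : ℤ} {f : HahnSeries ℤ F} (hf : OrdGE n f) (h0 : f.coeff n ≠ 0) (k : ℤ) :
    OrdGE (k * n) (f ^ k) ∧ (f ^ k).coeff (k * n) = f.coeff n ^ k := by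
  obtain ⟨m, rfl | rfl⟩ := k.eq_nat_or_neg
  · simp only [zpow_natCast]
    exact ⟨hf.pow m, coeff_pow_of_ordGE hf m⟩
  · simp only [zpow_neg, zpow_natCast]
    have := (hf.pow m).inv (by rw [coeff_pow_of_ordGE hf]; exact pow_ne_zero _ h0)
    rw [coeff_pow_of_ordGE hf] at this
    rwa [neg_mul]

theorem exists_ordGE_coeff_ne_zero {f : HahnSeries ℤ F} (hf : f ≠ 0) :
    OrdGE f.order f ∧ f.coeff f.order ≠ 0 :=
  ⟨fun _ hk => HahnSeries.coeff_eq_zero_of_lt_order hk, HahnSeries.coeff_order_eq_zero.not.2 hf⟩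

theorem order_eq_of_ordGE {n : ℤ} {f : HahnSeries ℤ F} (hf : OrdGE n f) (h0 : f.coeff n ≠ 0) :
    f.order = n := by
  have hfne : f ≠ 0 := by rintro rfl; simp at h0
  obtain ⟨h1, h2⟩ := exists_ordGE_coeff_ne_zero hfne
  refine le_antisymm (HahnSeries.order_le_of_coeff_ne_zero h0) ?_
  by_contra hh
  exact h2 (hf _ (by omega))

end OrderField

/-! ### Laurent polynomials: expansions, degree bounds, Euler operator -/

section LaurentPolynomials

open LaurentPolynomial

variable {K : Type} [Field K]

theorem coeff_expandAtInfinity (f : LaurentPolynomial K) (k : ℤ) :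
    (expandAtInfinity f).coeff k = f.coeff (-k) := by
  classical
  unfold expandAtInfinity
  rw [Finsupp.sum, HahnSeries.coeff_sum]
  by_cases h : f.coeff (-k) = 0
  · rw [h]
    refine Finset.sum_eq_zero fun n hn => ?_
    rw [HahnSeries.coeff_single_of_ne]
    rintro rfl
    simp at h hn
    exact hn h
  · rw [Finset.sum_eq_single (-k)]
    · simp
    · intro b _ hb
      rw [HahnSeries.coeff_single_of_ne]
      omega
    · intro hh; simp at hh; exact absurd hh h

theorem expandAtInfinity_add (f g : LaurentPolynomial K) :
    expandAtInfinity (f + g) = expandAtInfinity f + expandAtInfinity g := by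
  ext k
  simp [coeff_expandAtInfinity]

theorem expandAtInfinity_C_mul_T (a : K) (n : ℤ) :
    expandAtInfinity (C a * T n) = HahnSeries.single (-n) a := by
  ext k
  rw [coeff_expandAtInfinity, ← single_eq_C_mul_T]
  by_cases h : k = -n
  · subst h
    simp only [HahnSeries.coeff_single_same, neg_neg, AddMonoidAlgebra.coeff_single,
      Finsupp.single_eq_same]
  · rw [HahnSeries.coeff_single_of_ne h, AddMonoidAlgebra.coeff_single,
      Finsupp.single_eq_of_ne (by omega)]

theorem expandAtInfinity_mul (f g : LaurentPolynomial K) :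
    expandAtInfinity (f * g) = expandAtInfinity f * expandAtInfinity g := by
  induction f using LaurentPolynomial.induction_on' with
  | add p q hp hq => rw [add_mul, expandAtInfinity_add, hp, hq, expandAtInfinity_add, add_mul]
  | C_mul_T n a =>
    induction g using LaurentPolynomial.induction_on' with
    | add p q hp hq => rw [mul_add, expandAtInfinity_add, hp, hq, expandAtInfinity_add, mul_add]
    | C_mul_T m b =>
      have : (C a * T n * (C b * T m) : LaurentPolynomial K) = C (a * b) * T (n + m) := by
        rw [T_add, map_mul]; ring
      rw [this, expandAtInfinity_C_mul_T, expandAtInfinity_C_mul_T, expandAtInfinity_C_mul_T,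
        HahnSeries.single_mul_single, neg_add]

theorem expandAtInfinity_one : expandAtInfinity (1 : LaurentPolynomial K) = 1 := by
  have := expandAtInfinity_C_mul_T (1 : K) 0
  simpa using this

/-- Expansion at infinity as a ring homomorphism. -/
def expandHom : LaurentPolynomial K →+* LaurentSeries K where
  toFun := expandAtInfinity
  map_one' := expandAtInfinity_one
  map_mul' := expandAtInfinity_mul
  map_zero' := by ext k; simp [coeff_expandAtInfinity]
  map_add' := expandAtInfinity_add

@[simp] theorem expandHom_apply (f : LaurentPolynomial K) : expandHom f = expandAtInfinity f := rfl

/-- The degree of `f` is at most `n`. -/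
def DegLE (n : ℤ) (f : LaurentPolynomial K) : Prop := ∀ k, n < k → f.coeff k = 0

/-- The lowest degree in `f` is at least `n`. -/
def LowGE (n : ℤ) (f : LaurentPolynomial K) : Prop := ∀ k < n, f.coeff k = 0

/-- In the variable u = 1/z a bound on the degree is a bound on the order, so the rules for products
are inherited from `OrdGE`. -/
theorem degLE_iff_ordGE {n : ℤ} {f : LaurentPolynomial K} :
    DegLE n f ↔ OrdGE (-n) (expandAtInfinity f) := by
  constructor
  · intro h k hk
    rw [coeff_expandAtInfinity]
    exact h _ (by omega)
  · intro h k hk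
    have := h (-k) (by omega)
    rwa [coeff_expandAtInfinity, neg_neg] at this

/-- The inversion z ↦ 1/z reduces lowest degrees to highest degrees. -/
theorem lowGE_iff_degLE_invert {n : ℤ} {f : LaurentPolynomial K} :
    LowGE n f ↔ DegLE (-n) (invert f) := by
  constructor
  · intro h k hk
    rw [invert_apply]; exact h _ (by omega)
  · intro h k hk
    have := h (-k) (by omega)
    rwa [invert_apply, neg_neg] at this

theorem DegLE.mono {n m : ℤ} {f : LaurentPolynomial K} (hf : DegLE n f) (h : n ≤ m) : DegLE m f :=
  fun k hk => hf k (by omega)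

theorem DegLE.add {n : ℤ} {f g : LaurentPolynomial K} (hf : DegLE n f) (hg : DegLE n g) :
    DegLE n (f + g) := fun k hk => by simp [hf k hk, hg k hk]

theorem DegLE.sub {n : ℤ} {f g : LaurentPolynomial K} (hf : DegLE n f) (hg : DegLE n g) :
    DegLE n (f - g) := fun k hk => by simp [hf k hk, hg k hk]

theorem DegLE.sum {ι : Type*} {n : ℤ} {s : Finset ι} {f : ι → LaurentPolynomial K}
    (hf : ∀ i ∈ s, DegLE n (f i)) : DegLE n (∑ i ∈ s, f i) := fun k hk => by
  rw [AddMonoidAlgebra.coeff_sum, Finsupp.finsetSum_apply]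
  exact Finset.sum_eq_zero fun i hi => hf i hi k hk

theorem DegLE.mul {n m : ℤ} {f g : LaurentPolynomial K} (hf : DegLE n f) (hg : DegLE m g) :
    DegLE (n + m) (f * g) := by
  rw [degLE_iff_ordGE, expandAtInfinity_mul, neg_add]
  exact (degLE_iff_ordGE.1 hf).mul (degLE_iff_ordGE.1 hg)

theorem coeff_mul_of_degLE {n m : ℤ} {f g : LaurentPolynomial K} (hf : DegLE n f)
    (hg : DegLE m g) : (f * g).coeff (n + m) = f.coeff n * g.coeff m := by
  have := coeff_mul_of_ordGE (degLE_iff_ordGE.1 hf) (degLE_iff_ordGE.1 hg)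
  rw [← expandAtInfinity_mul] at this
  simpa [coeff_expandAtInfinity, add_comm] using this

theorem degLE_C (a : K) : DegLE 0 (C a) := fun k hk => by
  rw [C_apply, if_neg (by omega)]

theorem degLE_T (n : ℤ) : DegLE n (T n : LaurentPolynomial K) := fun k hk => by
  rw [T_apply, if_neg (by omega)]

theorem degLE_C_mul {n : ℤ} {f : LaurentPolynomial K} (a : K) (hf : DegLE n f) :
    DegLE n (C a * f) := by simpa using (degLE_C a).mul hf

theorem DegLE.pow {n : ℤ} {f : LaurentPolynomial K} (hf : DegLE n f) (k : ℕ) :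
    DegLE (k * n) (f ^ k) := by
  induction k with
  | zero => simpa using degLE_C (1 : K)
  | succ k ih => rw [pow_succ]; exact (ih.mul hf).mono (by push_cast; linarith)

theorem coeff_pow_of_degLE {n : ℤ} {f : LaurentPolynomial K} (hf : DegLE n f) (k : ℕ) :
    (f ^ k).coeff (k * n) = f.coeff n ^ k := by
  induction k with
  | zero => simp
  | succ k ih =>
    rw [pow_succ, pow_succ, ← ih, ← coeff_mul_of_degLE (hf.pow k) hf]
    congr 1
    push_cast; ring

theorem LowGE.mono {n m : ℤ} {f : LaurentPolynomial K} (hf : LowGE n f) (h : m ≤ n) : LowGE m f :=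
  fun k hk => hf k (by omega)

theorem LowGE.add {n : ℤ} {f g : LaurentPolynomial K} (hf : LowGE n f) (hg : LowGE n g) :
    LowGE n (f + g) := fun k hk => by simp [hf k hk, hg k hk]

theorem LowGE.sub {n : ℤ} {f g : LaurentPolynomial K} (hf : LowGE n f) (hg : LowGE n g) :
    LowGE n (f - g) := fun k hk => by simp [hf k hk, hg k hk]

theorem LowGE.sum {ι : Type*} {n : ℤ} {s : Finset ι} {f : ι → LaurentPolynomial K}
    (hf : ∀ i ∈ s, LowGE n (f i)) : LowGE n (∑ i ∈ s, f i) := fun k hk => by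
  rw [AddMonoidAlgebra.coeff_sum, Finsupp.finsetSum_apply]
  exact Finset.sum_eq_zero fun i hi => hf i hi k hk

theorem LowGE.mul {n m : ℤ} {f g : LaurentPolynomial K} (hf : LowGE n f) (hg : LowGE m g) :
    LowGE (n + m) (f * g) := by
  rw [lowGE_iff_degLE_invert, map_mul, neg_add]
  exact (lowGE_iff_degLE_invert.1 hf).mul (lowGE_iff_degLE_invert.1 hg)

theorem coeff_mul_of_lowGE {n m : ℤ} {f g : LaurentPolynomial K} (hf : LowGE n f)
    (hg : LowGE m g) : (f * g).coeff (n + m) = f.coeff n * g.coeff m := by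
  have := coeff_mul_of_degLE (lowGE_iff_degLE_invert.1 hf) (lowGE_iff_degLE_invert.1 hg)
  rw [← map_mul, invert_apply, invert_apply, invert_apply, neg_add, neg_neg, neg_neg] at this
  exact this

theorem lowGE_C (a : K) : LowGE 0 (C a) := fun k hk => by
  rw [C_apply, if_neg (by omega)]

theorem lowGE_T (n : ℤ) : LowGE n (T n : LaurentPolynomial K) := fun k hk => by
  rw [T_apply, if_neg (by omega)]

theorem lowGE_C_mul {n : ℤ} {f : LaurentPolynomial K} (a : K) (hf : LowGE n f) :
    LowGE n (C a * f) := by simpa using (lowGE_C a).mul hf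

theorem LowGE.pow {n : ℤ} {f : LaurentPolynomial K} (hf : LowGE n f) (k : ℕ) :
    LowGE (k * n) (f ^ k) := by
  induction k with
  | zero => simpa using lowGE_C (1 : K)
  | succ k ih => rw [pow_succ]; exact (ih.mul hf).mono (by push_cast; linarith)

theorem coeff_C_mul (a : K) (f : LaurentPolynomial K) (k : ℤ) :
    (C a * f).coeff k = a * f.coeff k := by
  rw [← smul_eq_C_mul]; simp

theorem coeff_mul_T (f : LaurentPolynomial K) (n k : ℤ) :
    (f * T n).coeff k = f.coeff (k - n) := by
  induction f using LaurentPolynomial.induction_on' with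
  | add p q hp hq => simp [add_mul, hp, hq]
  | C_mul_T m a =>
    rw [mul_assoc, ← T_add, coeff_C_mul, coeff_C_mul, T_apply, T_apply]
    congr 1
    by_cases h : m + n = k
    · rw [if_pos h, if_pos (by omega)]
    · rw [if_neg h, if_neg (by omega)]

theorem eq_zero_of_degLE_of_lowGE {n m : ℤ} {f : LaurentPolynomial K} (hf : DegLE n f)
    (hg : LowGE m f) (h : n < m) : f = 0 := by
  ext k
  by_cases hk : k < m
  · simp [hg k hk]
  · simp [hf k (by omega)]

/-- The Euler operator `z d/dz`. -/
def euler (f : LaurentPolynomial K) : LaurentPolynomial K :=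
  f.coeff.sum fun n a => C ((n : K) * a) * T n

theorem coeff_euler (f : LaurentPolynomial K) (k : ℤ) :
    (euler f).coeff k = k * f.coeff k := by
  classical
  unfold euler
  rw [Finsupp.sum, AddMonoidAlgebra.coeff_sum, Finsupp.finsetSum_apply]
  simp only [coeff_C_mul, T_apply]
  by_cases h : f.coeff k = 0
  · rw [h]
    refine (Finset.sum_eq_zero fun n hn => ?_).trans (by simp)
    rw [if_neg, mul_zero]
    rintro rfl
    simp at hn; exact hn h
  · rw [Finset.sum_eq_single k]
    · simp
    · intro b _ hb
      rw [if_neg hb, mul_zero]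
    · intro hh; simp at hh; exact absurd hh h

theorem euler_add (f g : LaurentPolynomial K) : euler (f + g) = euler f + euler g := by
  ext k; simp [coeff_euler, mul_add]

theorem euler_C_mul_T (a : K) (n : ℤ) : euler (C a * T n) = C ((n : K) * a) * T n := by
  ext k
  rw [coeff_euler, coeff_C_mul, coeff_C_mul, T_apply]
  split_ifs with h
  · subst h; ring
  · ring

theorem euler_mul (f g : LaurentPolynomial K) : euler (f * g) = euler f * g + f * euler g := by
  induction f using LaurentPolynomial.induction_on' with
  | add p q hp hq => rw [add_mul, euler_add, hp, hq, euler_add]; ring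
  | C_mul_T n a =>
    induction g using LaurentPolynomial.induction_on' with
    | add p q hp hq => rw [mul_add, euler_add, hp, hq, euler_add]; ring
    | C_mul_T m b =>
      have : (C a * T n * (C b * T m) : LaurentPolynomial K) = C (a * b) * T (n + m) := by
        rw [T_add, map_mul]; ring
      rw [this, euler_C_mul_T, euler_C_mul_T, euler_C_mul_T, T_add]
      push_cast
      simp only [map_mul, map_add]
      ring

theorem euler_pow_succ (f : LaurentPolynomial K) (k : ℕ) :
    euler (f ^ (k + 1)) = C ((k : K) + 1) * (f ^ k * euler f) := by
  induction k with
  | zero => simp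
  | succ k ih =>
    rw [pow_succ, euler_mul, ih]
    simp only [map_add, Nat.cast_succ, map_one]
    ring

/-- Up to the nonzero factor k + 1 this is z d/dz of f^(k+1): an exact differential has no residue.
-/
theorem coeff_pow_mul_euler [CharZero K] (f : LaurentPolynomial K) (k : ℕ) :
    (f ^ k * euler f).coeff 0 = 0 := by
  have h := coeff_euler (f ^ (k + 1)) 0
  rw [euler_pow_succ, coeff_C_mul] at h
  simp only [Int.cast_zero, zero_mul, mul_eq_zero] at h
  rcases h with h | h
  · exact absurd h (by exact_mod_cast Nat.succ_ne_zero k)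
  · exact h

/-- Integration by parts: z d/dz of f g has no constant term. -/
theorem coeff_mul_euler_comm (f g : LaurentPolynomial K) :
    (f * euler g).coeff 0 = -(g * euler f).coeff 0 := by
  have h := coeff_euler (f * g) 0
  rw [euler_mul] at h
  simp only [AddMonoidAlgebra.coeff_add, Finsupp.coe_add, Pi.add_apply, Int.cast_zero,
    zero_mul] at h
  rw [mul_comm g, eq_neg_iff_add_eq_zero, add_comm]
  exact h

end LaurentPolynomials

end Mobile

end

noncomputable section

namespace Mobile

/-! ### The residue functional -/

section Residues

open LaurentPolynomial

variable {K : Type} [Field K]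

/-- The expansion at infinity of `1 / (z - r)`. -/
def pole (r : K) : LaurentSeries K :=
  HahnSeries.single 1 1 * HahnSeries.ofPowerSeries ℤ K (PowerSeries.mk fun i => r ^ i)

theorem coeff_pole_succ (r : K) (i : ℕ) : (pole r).coeff (i + 1) = r ^ i := by
  unfold pole
  rw [HahnSeries.coeff_single_mul_add, one_mul]
  exact (HahnSeries.ofPowerSeries_apply_coeff _ i).trans (PowerSeries.coeff_mk _ _)

theorem ordGE_ofPowerSeries (f : PowerSeries K) : OrdGE 0 (HahnSeries.ofPowerSeries ℤ K f) := by
  intro k hk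
  rw [HahnSeries.ofPowerSeries_apply]
  apply HahnSeries.embDomain_of_notMem_range
  rintro ⟨n, hn⟩
  have h2 : (n : ℤ) = k := hn
  omega

theorem ordGE_pole (r : K) : OrdGE 1 (pole r) := by
  have := (ordGE_single (1 : ℤ) (1 : K)).mul (ordGE_ofPowerSeries (PowerSeries.mk fun i => r ^ i))
  rwa [add_zero] at this

theorem coeff_pole_one (r : K) : (pole r).coeff 1 = 1 := by
  simpa using coeff_pole_succ r 0

theorem expandAtInfinity_T (n : ℤ) :
    expandAtInfinity (T n : LaurentPolynomial K) = HahnSeries.single (-n) 1 := by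
  simpa using expandAtInfinity_C_mul_T (1 : K) n

theorem expandAtInfinity_C (a : K) : expandAtInfinity (C a) = HahnSeries.C a := by
  have := expandAtInfinity_C_mul_T a 0
  simpa using this

theorem pole_mul_expand (r : K) : pole r * expandHom (T 1 - C r) = 1 := by
  have hps : (PowerSeries.mk fun i => r ^ i) * (1 - PowerSeries.C r * PowerSeries.X) = 1 := by
    ext n
    rw [mul_sub, mul_one, mul_comm (PowerSeries.C r), ← mul_assoc, map_sub,
      PowerSeries.coeff_mul_C, PowerSeries.coeff_mk, PowerSeries.coeff_one]
    cases n with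
    | zero => simp
    | succ n => rw [PowerSeries.coeff_succ_mul_X, PowerSeries.coeff_mk]; simp [pow_succ]
  rw [map_sub, expandHom_apply, expandHom_apply, expandAtInfinity_T, expandAtInfinity_C]
  have h2 : (HahnSeries.single (-1) 1 - HahnSeries.C r : LaurentSeries K) =
      HahnSeries.single (-1) 1 *
        HahnSeries.ofPowerSeries ℤ K (1 - PowerSeries.C r * PowerSeries.X) := by
    rw [map_sub, map_mul, (HahnSeries.ofPowerSeries ℤ K).map_one, HahnSeries.ofPowerSeries_C,
      HahnSeries.ofPowerSeries_X, mul_sub, mul_one, mul_left_comm, HahnSeries.single_mul_single]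
    simp
  rw [h2]
  unfold pole
  rw [mul_mul_mul_comm, ← map_mul, hps, HahnSeries.single_mul_single]
  simp

theorem coeff_one_toLaurent_mul_pole (G : Polynomial K) (r : K) :
    (expandHom (Polynomial.toLaurent G) * pole r).coeff 1 = G.eval r := by
  induction G using Polynomial.induction_on' with
  | add p q hp hq => simp only [map_add, add_mul, HahnSeries.coeff_add, hp, hq, Polynomial.eval_add]
  | monomial n a =>
    rw [← Polynomial.C_mul_X_pow_eq_monomial, Polynomial.toLaurent_C_mul_X_pow, expandHom_apply,
      expandAtInfinity_C_mul_T]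
    have : (1 : ℤ) = (n + 1) + (-n) := by ring
    rw [this, HahnSeries.coeff_single_mul_add, coeff_pole_succ]
    simp

/-- Partial fractions: write 1 as the sum of the Lagrange basis polynomials; each of them cancels
all the poles but one. -/
theorem prod_pole_eq_sum {ι : Type*} [Fintype ι] [Nonempty ι] [DecidableEq ι] {v : ι → K}
    (hv : Function.Injective v) :
    ∏ i, pole (v i) =
      ∑ i, HahnSeries.C (∏ j ∈ Finset.univ.erase i, (v i - v j)⁻¹) * pole (v i) := by
  have h1 := congrArg (fun G => expandHom (Polynomial.toLaurent G))
    (Lagrange.sum_basis (s := Finset.univ) (v := v) hv.injOn Finset.univ_nonempty)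
  simp only [map_sum, map_one] at h1
  rw [← mul_one (∏ i, pole (v i)), ← h1, Finset.mul_sum]
  refine Finset.sum_congr rfl fun i _ => ?_
  rw [← Finset.mul_prod_erase Finset.univ _ (Finset.mem_univ i), Lagrange.basis, map_prod, map_prod,
    mul_assoc, ← Finset.prod_mul_distrib, mul_comm, map_prod]
  congr 1
  refine Finset.prod_congr rfl fun j _ => ?_
  rw [Lagrange.basisDivisor, map_mul, map_mul, Polynomial.toLaurent_C, map_sub,
    Polynomial.toLaurent_X, Polynomial.toLaurent_C, mul_left_comm, pole_mul_expand, mul_one,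
    expandHom_apply, expandAtInfinity_C]

theorem coeff_one_toLaurent_mul_prod_pole {ι : Type*} [Fintype ι] [Nonempty ι] [DecidableEq ι]
    {v : ι → K} (hv : Function.Injective v) (G : Polynomial K) :
    (expandHom (Polynomial.toLaurent G) * ∏ i, pole (v i)).coeff 1 =
      ∑ i, (∏ j ∈ Finset.univ.erase i, (v i - v j)⁻¹) * G.eval (v i) := by
  rw [prod_pole_eq_sum hv, Finset.mul_sum, HahnSeries.coeff_sum]
  refine Finset.sum_congr rfl fun i _ => ?_
  rw [mul_left_comm, HahnSeries.C_mul_eq_smul, HahnSeries.coeff_smul, coeff_one_toLaurent_mul_pole,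
    smul_eq_mul]

theorem exists_toLaurent_eq {f : LaurentPolynomial K} (hf : LowGE 0 f) :
    ∃ G : Polynomial K, Polynomial.toLaurent G = f ∧ ∀ n : ℕ, G.coeff n = f.coeff n := by
  obtain ⟨n, f', h⟩ := f.exists_T_pow
  have hc : ∀ k : ℕ, f'.coeff k = f.coeff ((k : ℤ) - n) := by
    intro k
    rw [← coeff_mul_T, ← h]
    exact (Finsupp.mapDomain_apply Nat.cast_injective _ _).symm
  have hd : Polynomial.X ^ n ∣ f' := by
    rw [Polynomial.X_pow_dvd_iff]
    intro d hd
    rw [hc]; exact hf _ (by omega)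
  obtain ⟨G, rfl⟩ := hd
  refine ⟨G, ?_, fun k => ?_⟩
  · rw [map_mul, Polynomial.toLaurent_X_pow] at h
    have := congrArg (fun x => x * T (-n : ℤ)) h
    simp only [mul_T_assoc] at this
    rw [mul_comm (T (n : ℤ)), mul_T_assoc] at this
    simpa using this
  · have := hc (k + n)
    rw [Polynomial.coeff_X_pow_mul] at this
    simpa using this

/-- Evaluation of a Laurent polynomial. -/
abbrev evalAt (z : Kˣ) : LaurentPolynomial K →+* K := LaurentPolynomial.eval₂ (RingHom.id K) z

variable {N : ℕ} (w wb : Fin N → Kˣ)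

/-- The linear functional of which `scalarProduct` is the associated bilinear form. -/
def residue : LaurentPolynomial K →ₗ[K] K where
  toFun F := (expandAtInfinity (F * T ((N : ℤ) - 1)) / expandAtInfinity (delta w wb)).coeff 1
  map_add' F G := by
    rw [add_mul, expandAtInfinity_add, add_div, HahnSeries.coeff_add]
  map_smul' a F := by
    rw [smul_eq_C_mul, mul_assoc, expandAtInfinity_mul, expandAtInfinity_C, mul_div_assoc,
      HahnSeries.C_mul_eq_smul, HahnSeries.coeff_smul]
    rfl

theorem inv_expand_delta : (expandAtInfinity (delta w wb))⁻¹ =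
    ∏ a, (pole (w a : K) * pole (wb a : K)) := by
  refine inv_eq_of_mul_eq_one_left ?_
  rw [← expandHom_apply, delta, map_prod, ← Finset.prod_mul_distrib]
  refine Finset.prod_eq_one fun a _ => ?_
  rw [map_mul, mul_mul_mul_comm, pole_mul_expand, pole_mul_expand, one_mul]

/-- The expansion of 1 / (Δ Δ̄) starts with u^(2N), so only the top coefficient of F z^(N-1)
contributes to the coefficient of u. -/
theorem residue_of_degLE {F : LaurentPolynomial K} (hF : DegLE N F) :
    residue w wb F = F.coeff N := by
  have h1 : ∀ a ∈ Finset.univ, OrdGE (2 : ℤ) (pole (w a : K) * pole (wb a : K)) :=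
    fun a _ => (ordGE_pole _).mul (ordGE_pole _)
  have h2 := OrdGE.prod h1
  have h3 := coeff_prod_of_ordGE h1
  have h4 : ∀ a, (pole (w a : K) * pole (wb a : K)).coeff 2 = 1 := fun a => by
    have := coeff_mul_of_ordGE (ordGE_pole (w a : K)) (ordGE_pole (wb a : K))
    simpa [coeff_pole_one] using this
  simp only [h4, Finset.prod_const_one, Finset.sum_const, Finset.card_univ, Fintype.card_fin,
    nsmul_eq_mul] at h2 h3
  have h5 := hF.mul (degLE_T (K := K) ((N : ℤ) - 1))
  have h6 := coeff_mul_of_ordGE (degLE_iff_ordGE.1 h5) h2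
  have e : (-((N : ℤ) + (N - 1)) + N * 2) = 1 := by ring
  rw [h3, mul_one, e] at h6
  change (expandAtInfinity (F * T ((N : ℤ) - 1)) / expandAtInfinity (delta w wb)).coeff 1 = _
  rw [div_eq_mul_inv, inv_expand_delta, h6, coeff_expandAtInfinity, neg_neg, coeff_mul_T]
  congr 1; ring

/-- The residue theorem for F z^(N-1) dz / (Δ Δ̄). The bound on F leaves at most a simple pole at 0,
whose contribution is the first term; the κ are the weights of the simple poles at the 2N
parameters. -/
theorem exists_residue_eq (hinj : Function.Injective (Sum.elim w wb)) :
    ∃ κ : Fin N ⊕ Fin N → K, ∀ F : LaurentPolynomial K, LowGE (-(N : ℤ)) F →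
      residue w wb F = F.coeff (-(N : ℤ)) / ∏ a, ((w a : K) * (wb a : K)) +
        ∑ i, κ i * evalAt (Sum.elim w wb i) F := by
  classical
  set r : Fin N ⊕ Fin N → Kˣ := Sum.elim w wb with hr
  -- The origin joins the 2N parameters as an additional node: the polynomial F z^N is divided by 2N
  -- + 1 distinct linear factors.
  set v : Option (Fin N ⊕ Fin N) → K := fun o => o.elim 0 fun i => (r i : K) with hv
  have hvinj : Function.Injective v := by
    rintro (_ | i) (_ | j) hij
    · rfl
    · exact absurd hij.symm (r j).ne_zero
    · exact absurd hij (r i).ne_zero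
    · exact congrArg some (hinj (Units.ext hij))
  refine ⟨fun i => (∏ j ∈ Finset.univ.erase (some i), (v (some i) - v j)⁻¹) * (r i : K) ^ N,
    fun F hF => ?_⟩
  have hlow : LowGE 0 (F * T (N : ℤ)) := by
    simpa using hF.mul (lowGE_T (K := K) (N : ℤ))
  obtain ⟨G, hG, hGc⟩ := exists_toLaurent_eq hlow
  have e1 : expandAtInfinity (F * T ((N : ℤ) - 1)) = expandHom (Polynomial.toLaurent G) * pole 0 := by
    have hp : pole (0 : K) = expandHom (T (-1)) := by
      have h := pole_mul_expand (0 : K)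
      simp only [map_zero, sub_zero] at h
      have h' : expandHom (T (-1)) * expandHom (T 1 : LaurentPolynomial K) = 1 := by
        rw [← map_mul, ← T_add]; simp [expandAtInfinity_one]
      have hne : expandHom (T 1 : LaurentPolynomial K) ≠ 0 := fun h0 => by
        rw [h0, mul_zero] at h; exact zero_ne_one h
      exact mul_right_cancel₀ hne (h.trans h'.symm)
    rw [hG, hp, ← map_mul, mul_T_assoc, expandHom_apply]
    rfl
  have e2 : ∏ o, pole (v o) = pole 0 * ∏ a, (pole (w a : K) * pole (wb a : K)) := by
    rw [Fintype.prod_option, Fintype.prod_sum_type, Finset.prod_mul_distrib]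
    simp [hv, hr]
  have e3 : residue w wb F = (expandHom (Polynomial.toLaurent G) * ∏ o, pole (v o)).coeff 1 := by
    change (expandAtInfinity (F * T ((N : ℤ) - 1)) / expandAtInfinity (delta w wb)).coeff 1 = _
    rw [e2, div_eq_mul_inv, inv_expand_delta, e1, mul_assoc]
  rw [e3, coeff_one_toLaurent_mul_prod_pole hvinj, Fintype.sum_option]
  congr 1
  · have h0 : G.eval (v none) = F.coeff (-(N : ℤ)) := by
      have : v none = 0 := rfl
      rw [this, ← Polynomial.coeff_zero_eq_eval_zero, hGc, coeff_mul_T]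
      simp
    have h1 : ∏ j ∈ Finset.univ.erase none, (v none - v j)⁻¹ =
        (∏ a, ((w a : K) * (wb a : K)))⁻¹ := by
      rw [← Finset.prod_inv_distrib]
      have : (Finset.univ.erase (none : Option (Fin N ⊕ Fin N))) =
          Finset.univ.map Function.Embedding.some := by
        ext o; cases o <;> simp
      rw [this, Finset.prod_map, Fintype.prod_sum_type, ← Finset.prod_mul_distrib]
      refine Finset.prod_congr rfl fun a _ => ?_
      simp only [hv, hr, Function.Embedding.some_apply, Option.elim, Sum.elim_inl, Sum.elim_inr,
        zero_sub]
      rw [← mul_inv, neg_mul_neg]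
    rw [h0, h1, mul_comm, div_eq_mul_inv]
  · refine Finset.sum_congr rfl fun i _ => ?_
    have : G.eval (v (some i)) = evalAt (r i) F * (r i : K) ^ N := by
      have h := congrArg (evalAt (r i)) hG
      rw [map_mul, eval₂_toLaurent, eval₂_T_n] at h
      exact h
    rw [this]; ring

/-- The ring of functions which take the same value at both parameters of every double point. -/
def nodalRing : Subring (LaurentPolynomial K) where
  carrier := {F | ∀ a, evalAt (w a) F = evalAt (wb a) F}
  mul_mem' hf hg a := by rw [map_mul, map_mul, hf a, hg a]
  one_mem' a := by rw [map_one, map_one]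
  add_mem' hf hg a := by rw [map_add, map_add, hf a, hg a]
  zero_mem' a := by rw [map_zero, map_zero]
  neg_mem' hf a := by rw [map_neg, map_neg, hf a]

theorem C_mem_nodalRing (k : K) : C k ∈ nodalRing w wb := fun a => by
  simp [evalAt]

/-- Multiplication by z^(N-1) turns F into a polynomial of degree at most 2N - 2 with 2N distinct
zeros. -/
theorem eq_zero_of_evalAt_eq_zero (hinj : Function.Injective (Sum.elim w wb))
    {F : LaurentPolynomial K} (hlow : LowGE (1 - (N : ℤ)) F) (hdeg : DegLE ((N : ℤ) - 1) F)
    (hw : ∀ a, evalAt (w a) F = 0) (hwb : ∀ a, evalAt (wb a) F = 0) : F = 0 := by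
  classical
  rcases Nat.eq_zero_or_pos N with rfl | hN
  · exact eq_zero_of_degLE_of_lowGE hdeg hlow (by norm_num)
  have hlow' : LowGE 0 (F * T ((N : ℤ) - 1)) := by
    simpa using hlow.mul (lowGE_T (K := K) ((N : ℤ) - 1))
  obtain ⟨G, hG, hGc⟩ := exists_toLaurent_eq hlow'
  have hG0 : G = 0 := by
    refine Polynomial.eq_zero_of_natDegree_lt_card_of_eval_eq_zero G
      (f := fun i => ((Sum.elim w wb i : Kˣ) : K)) (fun i j h => hinj (Units.ext h)) ?_ ?_
    · intro i
      have h := congrArg (evalAt (Sum.elim w wb i)) hG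
      rw [map_mul, eval₂_toLaurent] at h
      refine h.trans ?_
      rcases i with a | a
      · simp only [Sum.elim_inl, hw, zero_mul]
      · simp only [Sum.elim_inr, hwb, zero_mul]
    · have hd : G.natDegree ≤ 2 * N - 2 := by
        rw [Polynomial.natDegree_le_iff_coeff_eq_zero]
        intro k hk
        rw [hGc]
        exact (hdeg.mul (degLE_T (K := K) ((N : ℤ) - 1))) _ (by omega)
      simp only [Fintype.card_sum, Fintype.card_fin]
      omega
  rw [hG0, map_zero] at hG
  have := congrArg (fun x => x * T (-((N : ℤ) - 1))) hG
  simp only [mul_T_assoc, zero_mul] at this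
  simpa using this.symm

end Residues

end Mobile

end

noncomputable section

namespace Mobile

-- Functions and differentials on the nodal curve

section BakerAkhiezerTheory

open LaurentPolynomial

variable {K : Type} [Field K] {N : ℕ} {w wb : Fin N → Kˣ}

/-- Bounds on a pair of functions `X`, `Y` in the nodal ring. -/
structure IsNodalPair (w wb : Fin N → Kˣ) (P Q : ℕ) (X Y : LaurentPolynomial K) : Prop where
  inj : Function.Injective (Sum.elim w wb)
  card : N + 1 = P * Q
  X_mem : X ∈ nodalRing w wb
  Y_mem : Y ∈ nodalRing w wb
  X_deg : DegLE 1 X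
  X_low : LowGE (-(Q : ℤ)) X
  X_lead : X.coeff 1 = 1
  Y_deg : DegLE P Y
  Y_low : LowGE (-1) Y
  Y_lead : Y.coeff P ≠ 0

namespace IsNodalPair

variable {P Q : ℕ} {X Y : LaurentPolynomial K} (H : IsNodalPair w wb P Q X Y)

include H

/-- The monomial `X^i Y^j` of degree exactly `s = i + P j`. -/
theorem monomial_bounds (s : ℕ) (hs : s < N) :
    X ^ (s % P) * Y ^ (s / P) ∈ nodalRing w wb ∧ DegLE s (X ^ (s % P) * Y ^ (s / P)) ∧
      (X ^ (s % P) * Y ^ (s / P)).coeff s ≠ 0 ∧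
      LowGE (1 - (N : ℤ)) (X ^ (s % P) * Y ^ (s / P)) := by
  have hc := H.card
  have hP : 0 < P := Nat.pos_of_ne_zero fun h => by simp [h] at hc
  have hdm := Nat.mod_add_div s P
  have hi := Nat.mod_lt s hP
  generalize s % P = i at hdm hi ⊢
  generalize s / P = j at hdm ⊢
  have e : (i : ℤ) * 1 + j * P = s := by rw [← hdm]; push_cast; ring
  have hx := H.X_deg.pow i
  have hy := H.Y_deg.pow j
  refine ⟨mul_mem (pow_mem H.X_mem _) (pow_mem H.Y_mem _), ?_, ?_, ?_⟩
  · rw [← e]; exact hx.mul hy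
  · rw [← e, coeff_mul_of_degLE hx hy, coeff_pow_of_degLE H.X_deg, coeff_pow_of_degLE H.Y_deg,
      H.X_lead, one_pow, one_mul]
    exact pow_ne_zero _ H.Y_lead
  · refine ((H.X_low.pow i).mul (H.Y_low.pow j)).mono ?_
    have hj : j < Q := by
      by_contra hh
      have : P * Q ≤ P * j := Nat.mul_le_mul_left _ (by omega)
      omega
    -- Among i < P, j < Q the only violation would be X^(P-1) Y^(Q-1), whose degree is N; it is
    -- excluded by s < N.
    have key : i * Q + j + 1 ≤ N := by
      rcases Nat.lt_or_ge (i + 1) P with h | h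
      · have : (i + 2) * Q ≤ P * Q := Nat.mul_le_mul_right _ (by omega)
        have e2 : (i + 2) * Q = i * Q + 2 * Q := by ring
        omega
      · have hiP : P = i + 1 := by omega
        have hj2 : j + 1 < Q := by
          by_contra hh
          have hQ : Q = j + 1 := by omega
          have h3 : P * Q = P * j + P := by rw [hQ]; ring
          omega
        have e2 : P * Q = i * Q + Q := by rw [hiP]; ring
        omega
    zify at key
    linarith

/-- The differential z^(N-1) dz / (Δ Δ̄) is regular on the nodal curve: its residues at w_a and wb_a
are opposite. Their sums d_a satisfy one linear equation for each of the N monomials X^i Y^j, and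
this homogeneous system is nondegenerate. -/
theorem residue_eq {F : LaurentPolynomial K} (hF : F ∈ nodalRing w wb)
    (hlow : LowGE (-(N : ℤ)) F) :
    residue w wb F = F.coeff (-(N : ℤ)) / ∏ a, ((w a : K) * (wb a : K)) := by
  classical
  obtain ⟨κ, hκ⟩ := exists_residue_eq w wb H.inj
  set d : Fin N → K := fun a => κ (Sum.inl a) + κ (Sum.inr a) with hd
  have hsum : ∀ F ∈ nodalRing w wb, ∑ i, κ i * evalAt (Sum.elim w wb i) F =
      ∑ a, evalAt (w a) F * d a := by
    intro F hF
    rw [Fintype.sum_sum_type, ← Finset.sum_add_distrib]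
    refine Finset.sum_congr rfl fun a _ => ?_
    simp only [Sum.elim_inl, Sum.elim_inr, ← hF a, hd]
    ring
  suffices hd0 : d = 0 by
    rw [hκ F hlow, hsum F hF, hd0]; simp
  by_contra hne
  set M : Matrix (Fin N) (Fin N) K := Matrix.of fun s a =>
    evalAt (w a) (X ^ ((s : ℕ) % P) * Y ^ ((s : ℕ) / P)) with hM
  -- A monomial of degree s < N and lowest degree above -N contributes neither at infinity nor at 0,
  -- which leaves a relation between the d_a.
  have hMd : M.mulVec d = 0 := by
    funext s
    obtain ⟨h1, h2, -, h4⟩ := H.monomial_bounds s s.2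
    have h5 := hκ _ (h4.mono (by omega))
    have hs := s.2
    rw [hsum _ h1, residue_of_degLE w wb (h2.mono (by omega)), h4 (-(N : ℤ)) (by omega),
      h2 (N : ℤ) (by omega), zero_div, zero_add] at h5
    simpa [Matrix.mulVec, dotProduct, hM] using h5.symm
  -- A singular matrix also has a left kernel vector, that is, a combination G of the monomials
  -- vanishing at all w_a and hence, by the nodal condition, at all 2N parameters.
  have hdet := Matrix.exists_mulVec_eq_zero_iff.1 ⟨d, hne, hMd⟩
  obtain ⟨m, hm0, hm⟩ := Matrix.exists_vecMul_eq_zero_iff.2 hdet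
  set G : LaurentPolynomial K :=
    ∑ s : Fin N, C (m s) * (X ^ ((s : ℕ) % P) * Y ^ ((s : ℕ) / P)) with hG
  have hGmem : G ∈ nodalRing w wb :=
    sum_mem fun s _ => mul_mem (C_mem_nodalRing w wb _) (H.monomial_bounds s s.2).1
  have hGw : ∀ a, evalAt (w a) G = 0 := by
    intro a
    have := congrFun hm a
    rw [hG, map_sum]
    simpa [Matrix.vecMul, dotProduct, hM] using this
  have hG0 : G = 0 := by
    refine eq_zero_of_evalAt_eq_zero w wb H.inj (LowGE.sum fun s _ => ?_) (DegLE.sum fun s _ => ?_)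
      hGw fun a => (hGmem a).symm.trans (hGw a)
    · exact lowGE_C_mul _ (H.monomial_bounds s s.2).2.2.2
    · exact degLE_C_mul _ ((H.monomial_bounds s s.2).2.1.mono (by have := s.2; omega))
  apply hm0
  by_contra hmne
  obtain ⟨s0, hs0⟩ := Function.ne_iff.1 hmne
  -- The monomials have pairwise distinct exact degrees, so the top one that occurs in G cannot be
  -- cancelled.
  obtain ⟨s, hs, hmax⟩ := Finset.exists_max_image (Finset.univ.filter fun s => m s ≠ 0)
    (fun s => (s : ℕ)) ⟨s0, by simpa using hs0⟩
  simp only [Finset.mem_filter, Finset.mem_univ, true_and] at hs hmax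
  have h1 : G.coeff (s : ℕ) = m s * (X ^ ((s : ℕ) % P) * Y ^ ((s : ℕ) / P)).coeff (s : ℕ) := by
    rw [hG, AddMonoidAlgebra.coeff_sum, Finsupp.finsetSum_apply, Finset.sum_eq_single s]
    · rw [coeff_C_mul]
    · intro b _ hb
      rw [coeff_C_mul]
      by_cases hmb : m b = 0
      · rw [hmb, zero_mul]
      · have h2 := hmax b hmb
        have h3 : (b : ℕ) ≠ s := fun h => hb (Fin.ext h)
        rw [(H.monomial_bounds b b.2).2.1 _ (by omega), mul_zero]
    · intro h; exact absurd (Finset.mem_univ s) h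
  rw [hG0] at h1
  exact mul_ne_zero hs (H.monomial_bounds s s.2).2.2.1 (by simpa using h1.symm)

end IsNodalPair

/-! ### Baker-Akhiezer functions -/

variable (w wb)

/-- The matrix with columns `ξ_{n+1}, …, ξ_{n+N}`. -/
def xiMatrix (n : ℤ) : Matrix (Fin N) (Fin N) K :=
  Matrix.of fun a b => xi w wb (n + 1 + ((b : ℕ) : ℤ)) a

theorem h_eq_det (n : ℤ) : h w wb n = (xiMatrix w wb n).det := rfl

/-- The monic polynomial `z^{-n-1} ψ_n(z)`. -/
def psiPoly (n : ℤ) : Polynomial K :=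
  ((xiMatrix w wb n)⁻¹ * xiMatrix w wb (n + 1)).charpoly

variable {w wb} {n : ℤ}

/-- With M_n the matrix of columns ξ_{n+1}, ..., ξ_{n+N}, the matrix in the definition of ψ_n is M_n
(z - M_n⁻¹ M_{n+1}); division by h_n = det M_n leaves a characteristic polynomial. -/
theorem psi_eq (hn : h w wb n ≠ 0) :
    psi w wb n = Polynomial.toLaurent (psiPoly w wb n) * T (n + 1) := by
  have hunit : IsUnit (xiMatrix w wb n).det := Ne.isUnit hn
  have h1 : (Matrix.of fun a b : Fin N =>
      (T 1 * C (xi w wb (n + 1 + ((b : ℕ) : ℤ)) a) -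
        C (xi w wb (n + 2 + ((b : ℕ) : ℤ)) a) : LaurentPolynomial K)) =
      (C (R := K)).mapMatrix (xiMatrix w wb n) * (Polynomial.toLaurent (R := K)).mapMatrix
        (((xiMatrix w wb n)⁻¹ * xiMatrix w wb (n + 1)).charmatrix) := by
    have e1 : (C (R := K)).mapMatrix (xiMatrix w wb n) =
        (Polynomial.toLaurent (R := K)).mapMatrix (Polynomial.C.mapMatrix (xiMatrix w wb n)) := by
      ext a b; simp
    rw [e1, ← map_mul, Matrix.charmatrix, mul_sub, ← map_mul, ← mul_assoc,
      Matrix.mul_nonsing_inv _ hunit, one_mul]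
    ext1 a b
    rw [RingHom.mapMatrix_apply, Matrix.map_apply, Matrix.sub_apply, Matrix.scalar_apply,
      Matrix.mul_diagonal]
    simp only [RingHom.mapMatrix_apply, Matrix.map_apply, Matrix.of_apply, map_sub, map_mul,
      Polynomial.toLaurent_C, Polynomial.toLaurent_X, xiMatrix]
    rw [mul_comm]
    congr 3
    ring
  rw [psi, h1, Matrix.det_mul, ← RingHom.map_det, ← RingHom.map_det, ← h_eq_det]
  change _ = Polynomial.toLaurent (Matrix.det _) * _
  rw [mul_mul_mul_comm, ← map_mul, inv_mul_cancel₀ hn, map_one, one_mul, mul_comm]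

theorem psiPoly_monic : (psiPoly w wb n).Monic := Matrix.charpoly_monic _

theorem psiPoly_natDegree : (psiPoly w wb n).natDegree = N := by
  rw [psiPoly, Matrix.charpoly_natDegree_eq_dim, Fintype.card_fin]

theorem psiPoly_coeff_zero : (psiPoly w wb n).coeff 0 =
    (-1) ^ N * (h w wb (n + 1) / h w wb n) := by
  have h1 := Matrix.det_eq_sign_charpoly_coeff ((xiMatrix w wb n)⁻¹ * xiMatrix w wb (n + 1))
  rw [Fintype.card_fin, Matrix.det_mul, Matrix.det_nonsing_inv, Ring.inverse_eq_inv',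
    ← h_eq_det, ← h_eq_det] at h1
  rw [psiPoly, div_eq_inv_mul, h1, ← mul_assoc, ← mul_pow]
  simp

theorem h_mul_eval_psiPoly (hn : h w wb n ≠ 0) (r : K) :
    h w wb n * (psiPoly w wb n).eval r =
      (Matrix.of fun a b : Fin N => r * xi w wb (n + 1 + ((b : ℕ) : ℤ)) a -
        xi w wb (n + 2 + ((b : ℕ) : ℤ)) a).det := by
  have hunit : IsUnit (xiMatrix w wb n).det := Ne.isUnit hn
  rw [psiPoly, Matrix.eval_charpoly, h_eq_det, ← Matrix.det_mul, mul_sub, ← mul_assoc,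
    Matrix.mul_nonsing_inv _ hunit, one_mul]
  congr 1
  ext a b
  rw [Matrix.sub_apply, Matrix.scalar_apply, Matrix.mul_diagonal]
  simp only [Matrix.of_apply, xiMatrix]
  rw [mul_comm]
  congr 2
  ring

/-- M_n⁻¹ M_{n+1} is a companion matrix: it shifts the basis vectors, because the columns of M_{n+1}
are those of M_n shifted by one. The last case i = N leaves the basis but still holds after applying
M_n. -/
theorem xiMatrix_mulVec_pow (hn : h w wb n ≠ 0) (hN : 0 < N) (i : ℕ) (hi : i ≤ N) :
    (xiMatrix w wb n).mulVec ((((xiMatrix w wb n)⁻¹ * xiMatrix w wb (n + 1)) ^ i).mulVec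
      (Pi.single ⟨0, hN⟩ 1)) = xi w wb (n + 1 + i) := by
  have hunit : IsUnit (xiMatrix w wb n).det := Ne.isUnit hn
  have hcol : ∀ (m : ℤ) (b : Fin N),
      (xiMatrix w wb m).mulVec (Pi.single b 1) = xi w wb (m + 1 + ((b : ℕ) : ℤ)) := by
    intro m b
    rw [Matrix.mulVec_single_one]
    rfl
  have hpow : ∀ (i : ℕ) (hi : i < N),
      ((((xiMatrix w wb n)⁻¹ * xiMatrix w wb (n + 1)) ^ i).mulVec (Pi.single ⟨0, hN⟩ (1 : K))) =
        Pi.single ⟨i, hi⟩ 1 := by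
    intro i
    induction i with
    | zero => intro hi; rw [pow_zero, Matrix.one_mulVec]
    | succ i ih =>
      intro hi
      rw [pow_succ', ← Matrix.mulVec_mulVec, ih (by omega), ← Matrix.mulVec_mulVec, hcol]
      have h1 := hcol n ⟨i + 1, hi⟩
      have h2 : n + 1 + 1 + ((i : ℕ) : ℤ) = n + 1 + ((i + 1 : ℕ) : ℤ) := by push_cast; ring
      simp only at h1 ⊢
      rw [h2, ← h1, Matrix.mulVec_mulVec, Matrix.nonsing_inv_mul _ hunit, Matrix.one_mulVec]
  rcases Nat.lt_or_ge i N with h | h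
  · rw [hpow i h, hcol]
  · obtain ⟨k, rfl⟩ : ∃ k, i = k + 1 := ⟨i - 1, by omega⟩
    rw [pow_succ', ← Matrix.mulVec_mulVec, hpow k (by omega), Matrix.mulVec_mulVec, ← mul_assoc,
      Matrix.mul_nonsing_inv _ hunit, one_mul, hcol]
    congr 1
    push_cast; ring

/-- Cayley-Hamilton for the companion matrix, applied to the first basis vector, is the recurrence ∑
c_i ξ_{n+1+i} = 0. Its a-th entry is ψ_n(wb_a) - ψ_n(w_a). -/
theorem psi_mem_nodalRing (hn : h w wb n ≠ 0) : psi w wb n ∈ nodalRing w wb := by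
  rcases Nat.eq_zero_or_pos N with hN | hN
  · subst hN; exact fun a => a.elim0
  intro a
  have hsum : ∑ i ∈ Finset.range (N + 1), (psiPoly w wb n).coeff i * xi w wb (n + 1 + i) a = 0 := by
    have hCH := Matrix.aeval_self_charpoly ((xiMatrix w wb n)⁻¹ * xiMatrix w wb (n + 1))
    rw [← psiPoly, Polynomial.aeval_eq_sum_range, psiPoly_natDegree] at hCH
    have h2 := congrArg (fun M => (xiMatrix w wb n).mulVec
      (Matrix.mulVec M (Pi.single ⟨0, hN⟩ 1)) a) hCH
    simp only [Matrix.zero_mulVec, Matrix.mulVec_zero, Pi.zero_apply] at h2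
    rw [← h2, Matrix.sum_mulVec, Matrix.mulVec_sum, Finset.sum_apply]
    refine Finset.sum_congr rfl fun i hi => ?_
    rw [Matrix.smul_mulVec, Matrix.mulVec_smul,
      xiMatrix_mulVec_pow hn hN i (by simpa using Finset.mem_range_succ_iff.1 hi)]
    rfl
  have hev : ∀ z : Kˣ, evalAt z (psi w wb n) =
      ∑ i ∈ Finset.range (N + 1), (psiPoly w wb n).coeff i * (z : K) ^ (n + 1 + i) := by
    intro z
    rw [psi_eq hn, map_mul, eval₂_toLaurent, eval₂_T, Polynomial.eval₂_id,
      Polynomial.eval_eq_sum_range, psiPoly_natDegree, Finset.sum_mul]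
    refine Finset.sum_congr rfl fun i _ => ?_
    rw [Units.val_zpow_eq_zpow_val, zpow_add₀ z.ne_zero (n + 1), zpow_natCast]
    ring
  rw [hev, hev, ← sub_eq_zero, ← Finset.sum_sub_distrib, ← neg_eq_zero, ← hsum,
    ← Finset.sum_neg_distrib]
  refine Finset.sum_congr rfl fun i _ => ?_
  rw [xi]; ring

theorem coeff_toLaurent_natCast (G : Polynomial K) (k : ℕ) :
    (Polynomial.toLaurent G).coeff (k : ℤ) = G.coeff k :=
  Finsupp.mapDomain_apply Nat.cast_injective _ _

theorem lowGE_toLaurent (G : Polynomial K) : LowGE 0 (Polynomial.toLaurent G) := by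
  intro k hk
  refine Finsupp.mapDomain_of_notMem_range _ _ ?_
  rintro ⟨m, hm⟩
  have : (m : ℤ) = k := hm
  omega

theorem degLE_toLaurent {G : Polynomial K} {d : ℕ} (hd : G.natDegree ≤ d) :
    DegLE d (Polynomial.toLaurent G) := by
  intro k hk
  obtain ⟨m, rfl⟩ : ∃ m : ℕ, k = m := ⟨k.toNat, by omega⟩
  rw [coeff_toLaurent_natCast]
  exact Polynomial.coeff_eq_zero_of_natDegree_lt (by omega)

theorem psi_deg (hn : h w wb n ≠ 0) : DegLE (n + 1 + N) (psi w wb n) := by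
  rw [psi_eq hn, add_comm]
  exact (degLE_toLaurent psiPoly_natDegree.le).mul (degLE_T _)

theorem psi_lead (hn : h w wb n ≠ 0) : (psi w wb n).coeff (n + 1 + N) = 1 := by
  rw [psi_eq hn, coeff_mul_T, add_sub_cancel_left, coeff_toLaurent_natCast]
  have := psiPoly_monic (w := w) (wb := wb) (n := n)
  rwa [Polynomial.Monic, Polynomial.leadingCoeff, psiPoly_natDegree] at this

theorem psi_low (hn : h w wb n ≠ 0) : LowGE (n + 1) (psi w wb n) := by
  rw [psi_eq hn]
  simpa using (lowGE_toLaurent _).mul (lowGE_T (K := K) (n + 1))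

theorem psi_coeff_low (hn : h w wb n ≠ 0) :
    (psi w wb n).coeff (n + 1) = (-1) ^ N * (h w wb (n + 1) / h w wb n) := by
  rw [psi_eq hn, coeff_mul_T, sub_self, ← psiPoly_coeff_zero]
  exact coeff_toLaurent_natCast _ 0

end BakerAkhiezerTheory

end Mobile

end

noncomputable section

namespace Mobile

/-! ### Semi-infinite matrices with bounded rows -/

section InfMatrices

variable {S : Type} [Semiring S]

/-- The entries of `A` vanish beyond the `d`-th superdiagonal. -/
def RowBdd (d : ℕ) (A : ℕ → ℕ → S) : Prop := ∀ n m, n + d < m → A n m = 0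

theorem infMul_eq_sum {d : ℕ} {A : ℕ → ℕ → S} (hA : RowBdd d A) (B : ℕ → ℕ → S) {n M : ℕ}
    (hM : n + d < M) (m : ℕ) : infMul A B n m = ∑ l ∈ Finset.range M, A n l * B l m := by
  unfold infMul
  refine finsum_eq_sum_of_support_subset _ fun l hl => ?_
  rw [Function.mem_support] at hl
  rw [Finset.coe_range, Set.mem_Iio]
  by_contra hh
  exact hl (by rw [hA n l (by omega), zero_mul])

theorem RowBdd.infMul {d e : ℕ} {A B : ℕ → ℕ → S} (hA : RowBdd d A) (hB : RowBdd e B) :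
    RowBdd (d + e) (infMul A B) := by
  intro n m hnm
  rw [infMul_eq_sum hA B (Nat.lt_succ_self _)]
  refine Finset.sum_eq_zero fun l hl => ?_
  rw [Finset.mem_range] at hl
  rw [hB l m (by omega), mul_zero]

theorem RowBdd.infPow {d : ℕ} {A : ℕ → ℕ → S} (hA : RowBdd d A) (k : ℕ) :
    RowBdd (k * d) (infPow A k) := by
  induction k with
  | zero => intro n m h; exact if_neg (by omega)
  | succ k ih =>
    have := ih.infMul hA
    rwa [← Nat.succ_mul] at this

end InfMatrices

-- Matrix elements of multiplication operators

section MobileSystem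

open LaurentPolynomial

variable {K : Type} [Field K] {N : ℕ} {w wb : Fin N → Kˣ}

theorem phi_mem_nodalRing {m : ℕ} (hm : h w wb (-2 - (m : ℤ) - N) ≠ 0) :
    phi w wb m ∈ nodalRing w wb := psi_mem_nodalRing hm

theorem phi_deg {m : ℕ} (hm : h w wb (-2 - (m : ℤ) - N) ≠ 0) :
    DegLE (-1 - (m : ℤ)) (phi w wb m) := (psi_deg hm).mono (by omega)

theorem phi_lead {m : ℕ} (hm : h w wb (-2 - (m : ℤ) - N) ≠ 0) :
    (phi w wb m).coeff (-1 - (m : ℤ)) = 1 := by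
  rw [← psi_lead hm, phi]; congr 1; ring

theorem phi_low {m : ℕ} (hm : h w wb (-2 - (m : ℤ) - N) ≠ 0) :
    LowGE (-1 - (m : ℤ) - N) (phi w wb m) := (psi_low hm).mono (by omega)

theorem phi_coeff_low {m : ℕ} (hm : h w wb (-2 - (m : ℤ) - N) ≠ 0) :
    (phi w wb m).coeff (-1 - (m : ℤ) - N) =
      (-1) ^ N * (h w wb (-1 - (m : ℤ) - N) / h w wb (-2 - (m : ℤ) - N)) := by
  have := psi_coeff_low hm
  have e : -2 - (m : ℤ) - N + 1 = -1 - (m : ℤ) - N := by ring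
  rwa [e] at this

namespace IsNodalPair

variable {P Q : ℕ} {X Y : LaurentPolynomial K} (H : IsNodalPair w wb P Q X Y)
  (hpos : ∀ n : ℕ, h w wb n ≠ 0) (hneg : ∀ n : ℕ, h w wb (-2 - (n : ℤ) - N) ≠ 0)

include hpos hneg

-- The functional reads off z^N, so the top coefficient of the product is selected precisely when n
-- + d = m.
omit H in
theorem residue_phi_mul_deg {Z : LaurentPolynomial K} {d : ℤ} (hZ : DegLE d Z) (m n : ℕ) :
    DegLE (n + d - m + N) (phi w wb m * (Z * psi w wb n)) ∧
    (phi w wb m * (Z * psi w wb n)).coeff (n + d - m + N) = Z.coeff d := by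
  have h1 := hZ.mul (psi_deg (hpos n))
  have h2 := (phi_deg (hneg m)).mul h1
  have e : -1 - (m : ℤ) + (d + (n + 1 + N)) = n + d - m + N := by ring
  refine ⟨e ▸ h2, ?_⟩
  rw [← e, coeff_mul_of_degLE (phi_deg (hneg m)) h1, coeff_mul_of_degLE hZ (psi_deg (hpos n)),
    phi_lead (hneg m), psi_lead (hpos n), one_mul, mul_one]

omit H in
theorem residue_phi_mul_eq_zero {Z : LaurentPolynomial K} {d : ℤ} (hZ : DegLE d Z) {m n : ℕ}
    (hmn : n + d < m) : residue w wb (phi w wb m * (Z * psi w wb n)) = 0 := by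
  have h1 := (residue_phi_mul_deg hpos hneg hZ m n).1
  rw [residue_of_degLE w wb (h1.mono (by omega)), h1 _ (by omega)]

omit H in
theorem residue_phi_mul_eq_lead {Z : LaurentPolynomial K} {d : ℤ} (hZ : DegLE d Z) {m n : ℕ}
    (hmn : n + d = m) : residue w wb (phi w wb m * (Z * psi w wb n)) = Z.coeff d := by
  obtain ⟨h1, h2⟩ := residue_phi_mul_deg hpos hneg hZ m n
  have e : (n : ℤ) + d - m + N = N := by omega
  rw [e] at h1 h2
  rw [residue_of_degLE w wb h1, h2]

include H

/-- The evaluation at 0 needs Z in the nodal ring, unlike the evaluation at infinity. -/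
theorem residue_phi_mul_eq_zero' {Z : LaurentPolynomial K} {e : ℤ} (hZ : LowGE e Z)
    (hZm : Z ∈ nodalRing w wb) {m n : ℕ} (hmn : m < n + e) :
    residue w wb (phi w wb m * (Z * psi w wb n)) = 0 := by
  have h1 := (phi_low (hneg m)).mul (hZ.mul (psi_low (hpos n)))
  rw [H.residue_eq (mul_mem (phi_mem_nodalRing (hneg m)) (mul_mem hZm (psi_mem_nodalRing (hpos n))))
    (h1.mono (by omega)), h1 _ (by omega), zero_div]

theorem residue_phi_mul_eq_low {Z : LaurentPolynomial K} {e : ℤ} (hZ : LowGE e Z)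
    (hZm : Z ∈ nodalRing w wb) {m n : ℕ} (hmn : (m : ℤ) = n + e) :
    residue w wb (phi w wb m * (Z * psi w wb n)) =
      Z.coeff e * (h w wb (-1 - (m : ℤ) - N) / h w wb (-2 - (m : ℤ) - N)) *
        (h w wb (n + 1) / h w wb n) / ∏ a, ((w a : K) * (wb a : K)) := by
  have h0 := hZ.mul (psi_low (hpos n))
  have h1 := (phi_low (hneg m)).mul h0
  have h2 := coeff_mul_of_lowGE (phi_low (hneg m)) h0
  rw [coeff_mul_of_lowGE hZ (psi_low (hpos n)), phi_coeff_low (hneg m), psi_coeff_low (hpos n)] at h2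
  have e1 : -1 - (m : ℤ) - N + (e + (n + 1)) = -N := by omega
  rw [e1] at h1 h2
  rw [H.residue_eq (mul_mem (phi_mem_nodalRing (hneg m)) (mul_mem hZm (psi_mem_nodalRing (hpos n))))
    h1, h2]
  congr 1
  have : ((-1 : K) ^ N) * (-1) ^ N = 1 := by rw [← mul_pow]; simp
  linear_combination (Z.coeff e * (h w wb (-1 - (m : ℤ) - N) / h w wb (-2 - (m : ℤ) - N)) *
        (h w wb (n + 1) / h w wb n)) * this

/-- The case m ≥ n is read off at infinity, the case m < n at 0. -/
theorem biorthogonal (m n : ℕ) :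
    residue w wb (phi w wb m * psi w wb n) = if m = n then 1 else 0 := by
  have h1 : DegLE 0 (1 : LaurentPolynomial K) := by simpa using degLE_C (1 : K)
  have h2 : LowGE 0 (1 : LaurentPolynomial K) := by simpa using lowGE_C (1 : K)
  rw [← one_mul (psi w wb n)]
  split_ifs with hmn
  · rw [residue_phi_mul_eq_lead hpos hneg h1 (by omega)]
    simp
  · rcases lt_or_gt_of_ne hmn with hlt | hlt
    · exact H.residue_phi_mul_eq_zero' hpos hneg h2 (one_mem _) (by omega)
    · exact residue_phi_mul_eq_zero hpos hneg h1 (by omega)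

/-- The duality of the determinants `h_n`. -/
theorem h_duality (m : ℕ) :
    h w wb (-1 - (m : ℤ) - N) / h w wb (-2 - (m : ℤ) - N) =
      (∏ a, ((w a : K) * (wb a : K))) * (h w wb m / h w wb (m + 1)) := by
  have h2 : LowGE 0 (1 : LaurentPolynomial K) := by simpa using lowGE_C (1 : K)
  -- The scalar product of φ_m and ψ_m, equal to 1 by evaluation at infinity, is evaluated once more
  -- at 0.
  have h3 := H.residue_phi_mul_eq_low hpos hneg h2 (one_mem _) (m := m) (n := m) (by omega)
  have h4 : (1 : LaurentPolynomial K).coeff 0 = 1 := by simp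
  rw [one_mul, H.biorthogonal hpos hneg, if_pos rfl, h4, one_mul] at h3
  have hD : (∏ a, ((w a : K) * (wb a : K))) ≠ 0 :=
    Finset.prod_ne_zero_iff.2 fun a _ => mul_ne_zero (w a).ne_zero (wb a).ne_zero
  have h5 : h w wb ((m : ℤ) + 1) ≠ 0 := by exact_mod_cast hpos (m + 1)
  rw [eq_div_iff hD, one_mul] at h3
  rw [h3, mul_assoc, div_mul_div_comm, mul_comm (h w wb (m + 1)), div_self, mul_one]
  exact mul_ne_zero (hpos m) h5

/-- The duality eliminates the determinants of negative index together with ∏ w_a wb_a. -/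
theorem residue_phi_mul_eq_low' {Z : LaurentPolynomial K} {e : ℤ} (hZ : LowGE e Z)
    (hZm : Z ∈ nodalRing w wb) {m n : ℕ} (hmn : (m : ℤ) = n + e) :
    residue w wb (phi w wb m * (Z * psi w wb n)) =
      Z.coeff e * (h w wb m / h w wb (m + 1)) * (h w wb (n + 1) / h w wb n) := by
  have hD : (∏ a, ((w a : K) * (wb a : K))) ≠ 0 :=
    Finset.prod_ne_zero_iff.2 fun a _ => mul_ne_zero (w a).ne_zero (wb a).ne_zero
  rw [H.residue_phi_mul_eq_low hpos hneg hZ hZm hmn, H.h_duality hpos hneg]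
  field_simp

-- φ_l has leading term z^(-1-l), so it tests the coefficient of z^(N+l+1). Descending from l = M -
-- 1 removes the coefficients above z^N one at a time.
omit H hpos in
theorem degLE_of_residue_phi_eq_zero {r : LaurentPolynomial K} (M : ℕ) (hr : DegLE (N + M) r)
    (h0 : ∀ l < M, residue w wb (phi w wb l * r) = 0) : DegLE N r := by
  induction M with
  | zero => simpa using hr
  | succ M ih =>
    refine ih (fun k hk => ?_) fun l hl => h0 l (by omega)
    by_cases hk2 : k = N + M + 1
    · have h1 := (phi_deg (hneg M)).mul hr
      have h2 := coeff_mul_of_degLE (phi_deg (hneg M)) hr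
      have e : -1 - (M : ℤ) + (N + ((M + 1 : ℕ) : ℤ)) = N := by push_cast; ring
      rw [e] at h1 h2
      have h3 := h0 M (by omega)
      rw [residue_of_degLE w wb h1, h2, phi_lead (hneg M), one_mul] at h3
      rw [hk2, ← h3]; congr 1
    · exact hr k (by push_cast; omega)

-- If r has degree at most N - j, the residue of X^j r is the coefficient of z^(N-j) in r. Evaluated
-- at 0 it vanishes, because `hs` keeps the lowest degree of X^j r above -N for all j < d.
omit hpos hneg in
theorem degLE_sub_of_lowGE {r : LaurentPolynomial K} (hrm : r ∈ nodalRing w wb) {s : ℤ} {d : ℕ}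
    (hr : DegLE N r) (hlow : LowGE (1 - s) r) (hs : s + Q * ((d : ℤ) - 1) ≤ N) :
    DegLE (N - d) r := by
  suffices ∀ j ≤ d, DegLE (N - j) r from this d le_rfl
  intro j
  induction j with
  | zero => intro _; simpa using hr
  | succ j ih =>
    intro hj
    have h1 := ih (by omega)
    intro k hk
    by_cases hk2 : k = N - j
    · have hx := H.X_deg.pow j
      have h2 := hx.mul h1
      have h3 := coeff_mul_of_degLE hx h1
      have e : (j : ℤ) * 1 + (N - j) = N := by ring
      rw [coeff_pow_of_degLE H.X_deg, H.X_lead, one_pow, one_mul] at h3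
      rw [e] at h2 h3
      have h4 := (H.X_low.pow j).mul hlow
      have h5 : (j : ℤ) * (-Q) + (1 - s) ≥ 1 - N := by
        have : (Q : ℤ) * j ≤ Q * ((d : ℤ) - 1) :=
          mul_le_mul_of_nonneg_left (by omega) (by positivity)
        linarith
      have h6 := H.residue_eq (mul_mem (pow_mem H.X_mem j) hrm) (h4.mono (by omega))
      rw [h4 (-(N : ℤ)) (by omega), zero_div, residue_of_degLE w wb h2, h3] at h6
      rw [hk2, h6]
    · exact h1 k (by push_cast at hk; omega)

/-- Multiplication by `Z^k` is represented by the `k`-th power of the semi-infinite matrix which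
represents multiplication by `Z`, as long as `k` is not too large. -/
theorem residue_phi_pow {Z : LaurentPolynomial K} {d e : ℕ} (hZm : Z ∈ nodalRing w wb)
    (hd : DegLE d Z) (he : LowGE (-(e : ℤ)) Z) (kmax : ℕ)
    (hk : ∀ k < kmax, (e : ℤ) * k + Q * ((d : ℤ) - 1) ≤ N) :
    ∀ k ≤ kmax, ∀ n m : ℕ, residue w wb (phi w wb m * (Z ^ k * psi w wb n)) =
      infPow (fun n m => residue w wb (phi w wb m * (Z * psi w wb n))) k n m := by
  set A : ℕ → ℕ → K := fun n m => residue w wb (phi w wb m * (Z * psi w wb n)) with hA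
  have hAb : RowBdd d A := fun n m hnm => residue_phi_mul_eq_zero hpos hneg hd (by omega)
  have hsum : ∀ (f : ℕ → K) (M m : ℕ), m < M →
      residue w wb (phi w wb m * ∑ l ∈ Finset.range M, C (f l) * psi w wb l) = f m := by
    intro f M m hm
    rw [Finset.mul_sum, map_sum, Finset.sum_eq_single m]
    · rw [mul_left_comm, ← smul_eq_C_mul, map_smul, H.biorthogonal hpos hneg, if_pos rfl]
      simp
    · intro l _ hl
      rw [mul_left_comm, ← smul_eq_C_mul, map_smul, H.biorthogonal hpos hneg, if_neg hl.symm]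
      simp
    · intro hh; exact absurd (Finset.mem_range.2 hm) hh
  have hmem : ∀ (f : ℕ → K) (M : ℕ),
      ∑ l ∈ Finset.range M, C (f l) * psi w wb l ∈ nodalRing w wb := fun f M =>
    sum_mem fun l _ => mul_mem (C_mem_nodalRing w wb _) (psi_mem_nodalRing (hpos l))
  -- The ψ_m with m ≥ 0 have degrees above N, so they reproduce Z ψ_l only up to a remainder of
  -- degree at most N.
  have hone : ∀ l M : ℕ, l + d < M →
      DegLE N (Z * psi w wb l - ∑ m ∈ Finset.range M, C (A l m) * psi w wb m) := by
    intro l M hM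
    refine degLE_of_residue_phi_eq_zero hneg M (DegLE.sub ?_ (DegLE.sum fun m hm => ?_)) ?_
    · exact (hd.mul (psi_deg (hpos l))).mono (by omega)
    · rw [Finset.mem_range] at hm
      exact degLE_C_mul _ ((psi_deg (hpos m)).mono (by omega))
    · intro m hm
      rw [mul_sub, map_sub, hsum _ _ _ hm, sub_self]
  have hpow : ∀ k ≤ kmax, ∀ n M : ℕ, n + k * d < M →
      DegLE N (Z ^ k * psi w wb n - ∑ l ∈ Finset.range M, C (infPow A k n l) * psi w wb l) := by
    intro k
    induction k with
    | zero =>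
      intro _ n M hM
      rw [Finset.sum_eq_single n]
      · intro j _; simp [infPow]
      · intro l _ hl
        simp [infPow, hl.symm]
      · intro hh; exact absurd (Finset.mem_range.2 (by omega)) hh
    | succ k ih =>
      intro hk1 n M hM
      have hM' : n + k * d < M := by rw [Nat.succ_mul] at hM; omega
      set r := Z ^ k * psi w wb n - ∑ l ∈ Finset.range M, C (infPow A k n l) * psi w wb l with hr
      have hrdeg : DegLE N r := ih (by omega) n M hM'
      have hrm : r ∈ nodalRing w wb :=
        sub_mem (mul_mem (pow_mem hZm k) (psi_mem_nodalRing (hpos n))) (hmem _ _)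
      have hrlow : LowGE (1 - (e : ℤ) * k) r := by
        refine LowGE.sub ?_ (LowGE.sum fun l _ => ?_)
        · exact ((he.pow k).mul (psi_low (hpos n))).mono (by linarith)
        · refine lowGE_C_mul _ ((psi_low (hpos l)).mono ?_)
          have : (0 : ℤ) ≤ (e : ℤ) * k := by positivity
          omega
      -- Multiplication by Z costs d degrees. The nodal condition has already pushed the remainder
      -- down to N - d, so Z r is negligible again.
      have hr2 := H.degLE_sub_of_lowGE hrm hrdeg hrlow (hk k (by omega))
      have hZr : DegLE N (Z * r) := by
        have := hd.mul hr2
        rwa [add_sub_cancel] at this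
      have hrec : Z ^ (k + 1) * psi w wb n -
          ∑ m ∈ Finset.range M, C (infPow A (k + 1) n m) * psi w wb m =
          Z * r + ∑ l ∈ Finset.range M, C (infPow A k n l) *
            (Z * psi w wb l - ∑ m ∈ Finset.range M, C (A l m) * psi w wb m) := by
        have h1 : ∀ m, infPow A (k + 1) n m = ∑ l ∈ Finset.range M, infPow A k n l * A l m :=
          fun m => infMul_eq_sum (hAb.infPow k) A hM' m
        have h2 : ∑ m ∈ Finset.range M, C (infPow A (k + 1) n m) * psi w wb m =
            ∑ l ∈ Finset.range M, C (infPow A k n l) *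
              ∑ m ∈ Finset.range M, C (A l m) * psi w wb m := by
          simp only [h1, map_sum, Finset.sum_mul, Finset.mul_sum, map_mul, mul_assoc]
          rw [Finset.sum_comm]
        rw [h2, hr, mul_sub, Finset.mul_sum]
        simp only [mul_sub, Finset.sum_sub_distrib, pow_succ', mul_assoc, mul_left_comm Z]
        ring
      rw [hrec]
      refine hZr.add (DegLE.sum fun l _ => ?_)
      by_cases hl : n + k * d < l
      · rw [hAb.infPow k n l hl]
        intro j _; simp
      · exact degLE_C_mul _ (hone l M (by rw [Nat.succ_mul] at hM; omega))
  intro k hk1 n m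
  set M := n + k * d + m + 1 with hM
  -- φ_m has negative degree, hence it annihilates a remainder of degree at most N.
  have h1 := (phi_deg (hneg m)).mul (hpow k hk1 n M (by omega))
  have h2 : residue w wb (phi w wb m * (Z ^ k * psi w wb n -
      ∑ l ∈ Finset.range M, C (infPow A k n l) * psi w wb l)) = 0 := by
    rw [residue_of_degLE w wb (h1.mono (by omega)), h1 _ (by omega)]
  rw [mul_sub, map_sub, hsum _ _ _ (by omega), sub_eq_zero] at h2
  exact h2

end IsNodalPair

end MobileSystem

end Mobile

end

noncomputable section

namespace Mobile

-- From the spectral curve to the mobile system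

section CurveCoefficients

open LaurentPolynomial

namespace Curve

variable {A : Type} [CommRing A] (c : Curve A) (p q : ℕ)

theorem coeff_X_one : (c.X q).coeff 1 = 1 := by
  rw [X, AddMonoidAlgebra.coeff_add, Finsupp.add_apply, AddMonoidAlgebra.coeff_sum,
    Finsupp.finsetSum_apply, Finset.sum_eq_zero, T_apply, if_pos rfl, add_zero]
  intro j _
  rw [← single_eq_C_mul_T, AddMonoidAlgebra.coeff_single, Finsupp.single_eq_of_ne (by omega)]

theorem coeff_X_neg (j : ℕ) :
    (c.X q).coeff (-(j : ℤ)) = if j < q then c.α j else 0 := by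
  rw [X, AddMonoidAlgebra.coeff_add, Finsupp.add_apply, AddMonoidAlgebra.coeff_sum,
    Finsupp.finsetSum_apply, T_apply, if_neg (by omega), zero_add]
  split_ifs with hj
  · rw [Finset.sum_eq_single j]
    · rw [← single_eq_C_mul_T, AddMonoidAlgebra.coeff_single, Finsupp.single_eq_same]
    · intro i _ hi
      rw [← single_eq_C_mul_T, AddMonoidAlgebra.coeff_single, Finsupp.single_eq_of_ne (by omega)]
    · intro hh; exact absurd (Finset.mem_range.2 hj) hh
  · refine Finset.sum_eq_zero fun i hi => ?_
    rw [Finset.mem_range] at hi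
    rw [← single_eq_C_mul_T, AddMonoidAlgebra.coeff_single, Finsupp.single_eq_of_ne (by omega)]

theorem coeff_Y_neg_one : (c.Y p).coeff (-1) = c.R := by
  rw [Y, AddMonoidAlgebra.coeff_add, Finsupp.add_apply, AddMonoidAlgebra.coeff_sum,
    Finsupp.finsetSum_apply, Finset.sum_eq_zero, ← single_eq_C_mul_T, AddMonoidAlgebra.coeff_single,
    Finsupp.single_eq_same, add_zero]
  intro j _
  rw [← single_eq_C_mul_T, AddMonoidAlgebra.coeff_single, Finsupp.single_eq_of_ne (by omega)]

theorem coeff_Y_natCast (j : ℕ) :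
    (c.Y p).coeff (j : ℤ) = if j < p then c.β j else 0 := by
  rw [Y, AddMonoidAlgebra.coeff_add, Finsupp.add_apply, AddMonoidAlgebra.coeff_sum,
    Finsupp.finsetSum_apply, ← single_eq_C_mul_T, AddMonoidAlgebra.coeff_single,
    Finsupp.single_eq_of_ne (by omega), zero_add]
  split_ifs with hj
  · rw [Finset.sum_eq_single j]
    · rw [← single_eq_C_mul_T, AddMonoidAlgebra.coeff_single, Finsupp.single_eq_same]
    · intro i _ hi
      rw [← single_eq_C_mul_T, AddMonoidAlgebra.coeff_single, Finsupp.single_eq_of_ne (by omega)]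
    · intro hh; exact absurd (Finset.mem_range.2 hj) hh
  · refine Finset.sum_eq_zero fun i hi => ?_
    rw [Finset.mem_range] at hi
    rw [← single_eq_C_mul_T, AddMonoidAlgebra.coeff_single, Finsupp.single_eq_of_ne (by omega)]

section FieldBounds

variable {K : Type} [Field K] (c : Curve K) {p q : ℕ}

theorem degLE_X : DegLE 1 (c.X q) := by
  refine (degLE_T 1).add (DegLE.sum fun j _ => degLE_C_mul _ ((degLE_T _).mono (by omega)))

theorem lowGE_X (hq : 1 ≤ q) : LowGE (-((q - 1 : ℕ) : ℤ)) (c.X q) := by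
  refine ((lowGE_T 1).mono (by omega)).add
    (LowGE.sum fun j hj => lowGE_C_mul _ ((lowGE_T _).mono ?_))
  rw [Finset.mem_range] at hj; omega

theorem degLE_Y (hp : 1 ≤ p) : DegLE ((p - 1 : ℕ) : ℤ) (c.Y p) := by
  refine (degLE_C_mul _ ((degLE_T (-1)).mono (by omega))).add
    (DegLE.sum fun j hj => degLE_C_mul _ ((degLE_T _).mono ?_))
  rw [Finset.mem_range] at hj; omega

theorem lowGE_Y : LowGE (-1) (c.Y p) := by
  refine (lowGE_C_mul _ (lowGE_T (-1))).add
    (LowGE.sum fun j hj => lowGE_C_mul _ ((lowGE_T _).mono (by omega)))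

end FieldBounds

section Residual

variable {K : Type} [Field K] {c : Curve K} {p q : ℕ} {g gt : ℕ → K}

/-- `Y - ∑ gt_{k+1} X^k`, which is `1/z + O(1/z²)`. -/
def residualY (p q : ℕ) (gt : ℕ → K) (c : Curve K) : LaurentPolynomial K :=
  c.Y p - ∑ k ∈ Finset.range p, C (gt (k + 1)) * c.X q ^ k

/-- `X - ∑ g_{k+1} Y^k`, which is `z/R + O(z²)`. -/
def residualX (p q : ℕ) (g : ℕ → K) (c : Curve K) : LaurentPolynomial K :=
  c.X q - ∑ k ∈ Finset.range q, C (g (k + 1)) * c.Y p ^ k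

/-- The coefficient of z^j, j ≥ 0, is the equation for β_j; the powers X^k with k < j do not reach
z^j. -/
theorem IsSpectral.residualY_deg (hc : c.IsSpectral p q g gt) :
    DegLE (-1) (residualY p q gt c) := by
  intro k hk
  obtain ⟨j, rfl⟩ : ∃ j : ℕ, k = j := ⟨k.toNat, by omega⟩
  rw [residualY, AddMonoidAlgebra.coeff_sub, Finsupp.sub_apply, coeff_Y_natCast,
    AddMonoidAlgebra.coeff_sum, Finsupp.finsetSum_apply, sub_eq_zero]
  have hX : ∀ k < j, (c.X q ^ k).coeff (j : ℤ) = 0 := fun k hk =>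
    (c.degLE_X.pow k) _ (by omega)
  split_ifs with hj
  · rw [hc.β_eq j hj]
    refine Eq.trans ?_ (Finset.sum_subset (s₁ := Finset.Ico j p) ?_ ?_)
    · refine Finset.sum_nbij' (fun k => k - 1) (fun k => k + 1) ?_ ?_ ?_ ?_ ?_
      · intro k hk; simp only [Finset.mem_Icc, Finset.mem_Ico] at *; omega
      · intro k hk; simp only [Finset.mem_Icc, Finset.mem_Ico] at *; omega
      · intro k hk; simp only [Finset.mem_Icc] at *; omega
      · intro k hk; simp
      · intro k hk
        simp only [Finset.mem_Icc] at hk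
        rw [coeff_C_mul, Nat.sub_add_cancel (by omega)]
    · intro k hk; simp only [Finset.mem_range, Finset.mem_Ico] at *; omega
    · intro k hk hk2
      simp only [Finset.mem_range, Finset.mem_Ico] at *
      rw [coeff_C_mul, hX k (by omega), mul_zero]
  · refine (Finset.sum_eq_zero fun k hk => ?_).symm
    rw [Finset.mem_range] at hk
    rw [coeff_C_mul, hX k (by omega), mul_zero]

theorem IsSpectral.residualX_low (hc : c.IsSpectral p q g gt) :
    LowGE 1 (residualX p q g c) := by
  intro k hk
  obtain ⟨j, rfl⟩ : ∃ j : ℕ, k = -j := ⟨(-k).toNat, by omega⟩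
  rw [residualX, AddMonoidAlgebra.coeff_sub, Finsupp.sub_apply, coeff_X_neg,
    AddMonoidAlgebra.coeff_sum, Finsupp.finsetSum_apply, sub_eq_zero]
  have hY : ∀ k < j, (c.Y p ^ k).coeff (-(j : ℤ)) = 0 := fun k hk =>
    (c.lowGE_Y.pow k) _ (by omega)
  split_ifs with hj
  · rw [hc.α_eq j hj]
    refine Eq.trans ?_ (Finset.sum_subset (s₁ := Finset.Ico j q) ?_ ?_)
    · refine Finset.sum_nbij' (fun k => k - 1) (fun k => k + 1) ?_ ?_ ?_ ?_ ?_
      · intro k hk; simp only [Finset.mem_Icc, Finset.mem_Ico] at *; omega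
      · intro k hk; simp only [Finset.mem_Icc, Finset.mem_Ico] at *; omega
      · intro k hk; simp only [Finset.mem_Icc] at *; omega
      · intro k hk; simp
      · intro k hk
        simp only [Finset.mem_Icc] at hk
        rw [coeff_C_mul, Nat.sub_add_cancel (by omega)]
    · intro k hk; simp only [Finset.mem_range, Finset.mem_Ico] at *; omega
    · intro k hk hk2
      simp only [Finset.mem_range, Finset.mem_Ico] at *
      rw [coeff_C_mul, hY k (by omega), mul_zero]
  · refine (Finset.sum_eq_zero fun k hk => ?_).symm
    rw [Finset.mem_range] at hk
    rw [coeff_C_mul, hY k (by omega), mul_zero]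

/-- This residue of Y dX equals R - ∑ j α_j β_j, so the equation for R is a normalisation. -/
theorem IsSpectral.coeff_Y_mul_euler_X (hc : c.IsSpectral p q g gt) :
    (c.Y p * euler (c.X q)).coeff 0 = 1 := by
  have hcoef : ∀ (a : K) (n : ℤ), (C a * T n * euler (c.X q)).coeff 0 =
      a * (-(n : K) * (c.X q).coeff (-n)) := by
    intro a n
    rw [mul_assoc, coeff_C_mul, T_mul, coeff_mul_T, coeff_euler, zero_sub]
    push_cast; ring
  rw [Y, add_mul, Finset.sum_mul, AddMonoidAlgebra.coeff_add, Finsupp.add_apply,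
    AddMonoidAlgebra.coeff_sum, Finsupp.finsetSum_apply, hcoef]
  simp only [hcoef, coeff_X_neg, neg_neg, coeff_X_one]
  have h1 : ∑ j ∈ Finset.range p, c.β j * (-((j : ℤ) : K) * if j < q then c.α j else 0) =
      -∑ j ∈ Finset.Icc 1 (min p q - 1), (j : K) * c.α j * c.β j := by
    rw [← Finset.sum_neg_distrib]
    symm
    refine (Finset.sum_subset ?_ ?_).trans (Finset.sum_congr rfl ?_)
    · intro j hj; simp only [Finset.mem_range, Finset.mem_Icc] at *; omega
    · intro j hj hj2
      simp only [Finset.mem_range, Finset.mem_Icc] at *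
      rcases Nat.eq_zero_or_pos j with rfl | hj0
      · simp
      · rw [hc.α_eq_zero j (by omega)]; simp
    · intro j hj
      split_ifs with hjq
      · push_cast; ring
      · rw [hc.α_eq_zero j (by omega)]; simp
  rw [h1, hc.R_eq]
  simp

variable [CharZero K]

theorem coeff_sum_mul_euler (f : LaurentPolynomial K) (a : ℕ → K) (s : Finset ℕ) :
    ((∑ k ∈ s, C (a k) * f ^ k) * euler f).coeff 0 = 0 := by
  rw [Finset.sum_mul, AddMonoidAlgebra.coeff_sum, Finsupp.finsetSum_apply]
  refine Finset.sum_eq_zero fun k _ => ?_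
  rw [mul_assoc, coeff_C_mul, coeff_pow_mul_euler, mul_zero]

/-- As X = z + ..., the coefficient of 1/z is a residue against dX, where the exact differentials
X^k dX drop out and Y dX gives 1. -/
theorem IsSpectral.residualY_lead (hc : c.IsSpectral p q g gt) :
    (residualY p q gt c).coeff (-1) = 1 := by
  have h1 : DegLE 1 (euler (c.X q)) := fun k hk => by
    rw [coeff_euler, c.degLE_X k hk, mul_zero]
  have h2 := coeff_mul_of_degLE hc.residualY_deg h1
  rw [coeff_euler, coeff_X_one] at h2
  simp only [neg_add_cancel, Int.cast_one, mul_one] at h2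
  rw [← h2, residualY, sub_mul, AddMonoidAlgebra.coeff_sub, Finsupp.sub_apply,
    hc.coeff_Y_mul_euler_X, coeff_sum_mul_euler, sub_zero]

/-- The same argument at 0 with dY. Integration by parts turns X dY into -Y dX, and the lowest term
R/z of Y produces the factor 1/R. -/
theorem IsSpectral.residualX_lead (hc : c.IsSpectral p q g gt) (hR : c.R ≠ 0) :
    (residualX p q g c).coeff 1 = 1 / c.R := by
  have h1 : LowGE (-1) (euler (c.Y p)) := fun k hk => by
    rw [coeff_euler, c.lowGE_Y k hk, mul_zero]
  have h2 := coeff_mul_of_lowGE hc.residualX_low h1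
  rw [coeff_euler, coeff_Y_neg_one] at h2
  simp only [add_neg_cancel] at h2
  conv_lhs at h2 => rw [residualX, sub_mul, AddMonoidAlgebra.coeff_sub, Finsupp.sub_apply,
    coeff_mul_euler_comm, hc.coeff_Y_mul_euler_X, coeff_sum_mul_euler, sub_zero]
  rw [eq_div_iff hR]
  push_cast at h2
  linear_combination h2

end Residual

end Curve

variable {K : Type} [Field K] [CharZero K] {c : Curve K} {p q : ℕ} {g gt : ℕ → K}
  {N : ℕ} {w wb : Fin N → Kˣ}

omit [CharZero K] in
theorem residue_mul_C_mul (a : K) (f Z F : LaurentPolynomial K) :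
    residue w wb (f * (C a * Z * F)) = a * residue w wb (f * (Z * F)) := by
  rw [show f * (C a * Z * F) = a • (f * (Z * F)) by rw [smul_eq_C_mul]; ring, map_smul,
    smul_eq_mul]

theorem IsNodalPair.isMobileSystem (hp : 2 ≤ p) (hq : 2 ≤ q)
    (H : IsNodalPair w wb (p - 1) (q - 1) (c.X q) (c.Y p)) (hc : c.IsSpectral p q g gt)
    (hR : c.R ≠ 0) (hpos : ∀ n : ℕ, h w wb n ≠ 0)
    (hneg : ∀ n : ℕ, h w wb (-2 - (n : ℤ) - N) ≠ 0) :
    IsMobileSystem p q g gt (fun n m => scalarProduct w wb (phi w wb m) (c.X q * psi w wb n))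
      (fun n m => scalarProduct w wb (phi w wb m) (c.Y p * psi w wb n)) := by
  have hcard : ((p - 1 : ℕ) : ℤ) * ((q - 1 : ℕ) : ℤ) = N + 1 := by exact_mod_cast H.card.symm
  -- Here d = 1 and e = q - 1: the condition (q - 1) k ≤ N holds for k < p - 1, which covers the
  -- powers up to p - 1.
  have hX : ∀ k < p, ∀ n m : ℕ, infPow (fun n m =>
      residue w wb (phi w wb m * (c.X q * psi w wb n))) k n m =
      residue w wb (phi w wb m * (c.X q ^ k * psi w wb n)) := by
    intro k hk n m
    refine (H.residue_phi_pow hpos hneg (d := 1) H.X_mem (by simpa using H.X_deg) H.X_low (p - 1)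
      ?_ k (by omega) n m).symm
    intro k hk
    have h1 : ((q - 1 : ℕ) : ℤ) * k ≤ ((q - 1 : ℕ) : ℤ) * (((p - 1 : ℕ) : ℤ) - 1) :=
      mul_le_mul_of_nonneg_left (by omega) (by positivity)
    have h2 : (1 : ℤ) ≤ ((q - 1 : ℕ) : ℤ) := by omega
    push_cast
    linarith
  -- Here d = p - 1 and e = 1: the condition k + (q - 1)(p - 2) ≤ N means k ≤ q - 2, which covers
  -- exactly the powers up to q - 1.
  have hY : ∀ k < q, ∀ n m : ℕ, infPow (fun n m =>
      residue w wb (phi w wb m * (c.Y p * psi w wb n))) k n m =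
      residue w wb (phi w wb m * (c.Y p ^ k * psi w wb n)) := by
    intro k hk n m
    refine (H.residue_phi_pow hpos hneg (e := 1) H.Y_mem H.Y_deg H.Y_low (q - 1)
      ?_ k (by omega) n m).symm
    intro k hk
    push_cast
    have h2 : (k : ℤ) + 1 ≤ ((q - 1 : ℕ) : ℤ) := by omega
    linarith
  have hUY : ∀ n m : ℕ, residue w wb (phi w wb m * (c.Y p * psi w wb n)) -
      ∑ k ∈ Finset.range p, gt (k + 1) * infPow (fun n m =>
        residue w wb (phi w wb m * (c.X q * psi w wb n))) k n m =
      residue w wb (phi w wb m * (Curve.residualY p q gt c * psi w wb n)) := by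
    intro n m
    rw [Curve.residualY, sub_mul, mul_sub, map_sub, Finset.sum_mul, Finset.mul_sum, map_sum]
    congr 1
    refine Finset.sum_congr rfl fun k hk => ?_
    rw [hX k (Finset.mem_range.1 hk), residue_mul_C_mul]
  have hUX : ∀ n m : ℕ, residue w wb (phi w wb m * (c.X q * psi w wb n)) -
      ∑ k ∈ Finset.range q, g (k + 1) * infPow (fun n m =>
        residue w wb (phi w wb m * (c.Y p * psi w wb n))) k n m =
      residue w wb (phi w wb m * (Curve.residualX p q g c * psi w wb n)) := by
    intro n m
    rw [Curve.residualX, sub_mul, mul_sub, map_sub, Finset.sum_mul, Finset.mul_sum, map_sum]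
    congr 1
    refine Finset.sum_congr rfl fun k hk => ?_
    rw [hY k (Finset.mem_range.1 hk), residue_mul_C_mul]
  have hC : ∀ k, C k ∈ nodalRing w wb := C_mem_nodalRing w wb
  have hUXm : Curve.residualX p q g c ∈ nodalRing w wb :=
    sub_mem H.X_mem (sum_mem fun k _ => mul_mem (hC _) (pow_mem H.Y_mem k))
  have hYlow : ∀ n : ℕ, residue w wb (phi w wb n * (c.Y p * psi w wb (n + 1 : ℕ))) =
      c.R * (h w wb n / h w wb (n + 1)) * (h w wb ((n + 1 : ℕ) + 1) / h w wb (n + 1 : ℕ)) := by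
    intro n
    rw [H.residue_phi_mul_eq_low' hpos hneg H.Y_low H.Y_mem (by push_cast; ring),
      Curve.coeff_Y_neg_one]
  have hpos' : ∀ n : ℕ, h w wb ((n : ℤ) + 1) ≠ 0 := fun n => by exact_mod_cast hpos (n + 1)
  constructor
  · rintro n m (hnm | hnm)
    · exact residue_phi_mul_eq_zero hpos hneg H.X_deg (by omega)
    · exact H.residue_phi_mul_eq_zero' hpos hneg H.X_low H.X_mem (by omega)
  · rintro n m (hnm | hnm)
    · exact H.residue_phi_mul_eq_zero' hpos hneg H.Y_low H.Y_mem (by omega)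
    · exact residue_phi_mul_eq_zero hpos hneg H.Y_deg (by omega)
  · intro n
    exact (residue_phi_mul_eq_lead hpos hneg H.X_deg (by push_cast; ring)).trans H.X_lead
  · intro n
    refine (hYlow n).trans_ne ?_
    exact mul_ne_zero (mul_ne_zero hR (div_ne_zero (hpos n) (hpos' n)))
      (div_ne_zero (hpos' (n + 1)) (hpos (n + 1)))
  · intro n m hnm
    exact (hUY n m).trans (residue_phi_mul_eq_zero hpos hneg hc.residualY_deg (by omega))
  · intro n m hnm
    exact (hUX n m).trans (H.residue_phi_mul_eq_zero' hpos hneg hc.residualX_low hUXm (by omega))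
  · intro n
    exact (hUY (n + 1) n).trans ((residue_phi_mul_eq_lead hpos hneg hc.residualY_deg
      (by push_cast; ring)).trans hc.residualY_lead)
  · intro n
    refine (hUX n (n + 1)).trans ?_
    -- The quotients of determinants in this entry and in P (n + 1) n are inverse to each other, and
    -- the prefactors are 1/R and R.
    rw [H.residue_phi_mul_eq_low' hpos hneg hc.residualX_low hUXm (by push_cast; ring),
      hc.residualX_lead hR]
    refine Eq.trans ?_ (congrArg (fun x => 1 / x) (hYlow n)).symm
    push_cast
    have h1 := hpos n
    have h2 := hpos' n
    have h3 := hpos' (n + 1)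
    push_cast at h3
    field_simp

-- The factor R is the lowest coefficient of Y. The two quotients of determinants come from the
-- lowest coefficients of ψ_n and, through the duality, of φ_{n-1}.
omit [CharZero K] in
theorem IsNodalPair.scalarProduct_Y_subdiag
    (H : IsNodalPair w wb (p - 1) (q - 1) (c.X q) (c.Y p)) (hpos : ∀ n : ℕ, h w wb n ≠ 0)
    (hneg : ∀ n : ℕ, h w wb (-2 - (n : ℤ) - N) ≠ 0) (n : ℕ) (hn : 1 ≤ n) :
    scalarProduct w wb (phi w wb (n - 1 : ℕ)) (c.Y p * psi w wb n) =
      c.R * (h w wb ((n : ℤ) - 1) * h w wb ((n : ℤ) + 1)) / h w wb n ^ 2 := by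
  obtain ⟨m, rfl⟩ : ∃ m, n = m + 1 := ⟨n - 1, by omega⟩
  refine (H.residue_phi_mul_eq_low' hpos hneg H.Y_low H.Y_mem (by push_cast; simp)).trans ?_
  rw [Curve.coeff_Y_neg_one]
  have h2 := hpos (m + 1)
  push_cast at h2 ⊢
  simp only [add_tsub_cancel_right]
  field_simp

end CurveCoefficients

end Mobile

end

noncomputable section

namespace Mobile

/-! ### Contractions of power series -/

section Contraction

open PowerSeries

theorem powerSeries_eq_zero_of_forall_dvd {f : PowerSeries ℂ}
    (n0 : ℕ) (hf : ∀ n ≥ n0, (X : PowerSeries ℂ) ^ n ∣ f) : f = 0 := by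
  ext d
  rw [map_zero]
  exact X_pow_dvd_iff.1 (hf (d + n0 + 1) (by omega)) d (by omega)

variable {ι : Type*}

/-- Each application of Φ gains one power of the variable, so fixed points in S agree to all orders.
-/
theorem eq_of_fixedPoint {Φ : (ι → PowerSeries ℂ) → ι → PowerSeries ℂ} {S : Set (ι → PowerSeries ℂ)}
    {n0 : ℕ} (hΦ : ∀ n ≥ n0, ∀ f ∈ S, ∀ f' ∈ S, (∀ i, (X : PowerSeries ℂ) ^ n ∣ f i - f' i) →
      ∀ i, (X : PowerSeries ℂ) ^ (n + 1) ∣ Φ f i - Φ f' i)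
    {f f' : ι → PowerSeries ℂ} (hf : f ∈ S) (hf' : f' ∈ S)
    (h0 : ∀ i, (X : PowerSeries ℂ) ^ n0 ∣ f i - f' i) (h1 : Φ f = f) (h2 : Φ f' = f') : f = f' := by
  funext i
  rw [← sub_eq_zero]
  refine powerSeries_eq_zero_of_forall_dvd n0 fun n hn => ?_
  revert i
  induction n, hn using Nat.le_induction with
  | base => exact h0
  | succ n hn ih =>
    have := hΦ n hn f hf f' hf' ih
    rwa [h1, h2] at this

/-- S is an X-adic ball around f0. The iterates of f0 stay in it and form a Cauchy sequence, whose
limit is assembled coefficient by coefficient. -/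
theorem exists_fixedPoint {Φ : (ι → PowerSeries ℂ) → ι → PowerSeries ℂ} {f0 : ι → PowerSeries ℂ}
    {n0 : ℕ} {S : Set (ι → PowerSeries ℂ)}
    (hSdef : ∀ f, f ∈ S ↔ ∀ i, (X : PowerSeries ℂ) ^ n0 ∣ f i - f0 i)
    (hS : ∀ f ∈ S, Φ f ∈ S)
    (hΦ : ∀ n ≥ n0, ∀ f ∈ S, ∀ f' ∈ S, (∀ i, (X : PowerSeries ℂ) ^ n ∣ f i - f' i) →
      ∀ i, (X : PowerSeries ℂ) ^ (n + 1) ∣ Φ f i - Φ f' i) :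
    ∃ f ∈ S, Φ f = f := by
  set x : ℕ → ι → PowerSeries ℂ := fun n => Φ^[n] f0 with hx
  have hxs : ∀ n, x (n + 1) = Φ (x n) := fun n => Function.iterate_succ_apply' Φ n f0
  have hxS : ∀ n, x n ∈ S := by
    intro n
    induction n with
    | zero => rw [hSdef]; intro i; simp [hx]
    | succ n ih => rw [hxs]; exact hS _ ih
  have hstep : ∀ n i, (X : PowerSeries ℂ) ^ (n + n0) ∣ x (n + 1) i - x n i := by
    intro n
    induction n with
    | zero =>
      rw [zero_add]
      exact (hSdef _).1 (hxS 1)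
    | succ n ih =>
      intro i
      rw [hxs (n + 1), show n + 1 + n0 = n + n0 + 1 by ring]
      have := hΦ (n + n0) (by omega) _ (hxS _) _ (hxS _) ih i
      rwa [← hxs n] at this
  have hcauchy : ∀ n k i, (X : PowerSeries ℂ) ^ (n + n0) ∣ x (n + k) i - x n i := by
    intro n k i
    induction k with
    | zero => simp
    | succ k ih =>
      have h1 : (X : PowerSeries ℂ) ^ (n + n0) ∣ x (n + k + 1) i - x (n + k) i :=
        (pow_dvd_pow _ (by omega)).trans (hstep (n + k) i)
      have := dvd_add h1 ih
      rwa [sub_add_sub_cancel] at this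
  -- The coefficient of degree d no longer changes from the iterate d + 1 on.
  set L : ι → PowerSeries ℂ := fun i => mk fun d => coeff d (x (d + 1) i) with hL
  have hLx : ∀ n i, (X : PowerSeries ℂ) ^ n ∣ L i - x n i := by
    intro n i
    rw [X_pow_dvd_iff]
    intro d hd
    have h1 := X_pow_dvd_iff.1 (hcauchy (d + 1) (n - (d + 1)) i) d (by omega)
    rw [show d + 1 + (n - (d + 1)) = n by omega, map_sub, sub_eq_zero] at h1
    rw [map_sub, hL]
    simp only [coeff_mk]
    rw [h1, sub_self]
  have hLS : L ∈ S := by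
    rw [hSdef]
    intro i
    have := dvd_add (hLx n0 i) ((hSdef _).1 (hxS n0) i)
    rwa [sub_add_sub_cancel] at this
  refine ⟨L, hLS, ?_⟩
  funext i
  rw [← sub_eq_zero]
  refine powerSeries_eq_zero_of_forall_dvd n0 fun n hn => ?_
  have h1 := hΦ n hn L hLS (x n) (hxS n) (hLx n) i
  have h2 := hLx (n + 1) i
  rw [hxs] at h2
  have := dvd_sub h1 h2
  rw [sub_sub_sub_cancel_right] at this
  exact (pow_dvd_pow _ (by omega)).trans this

end Contraction

/-! ### Existence and uniqueness of the spectral curve -/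

section SpectralCurve

namespace Curve

variable {A B : Type} [CommRing A] [CommRing B]

theorem X_map (f : A →+* B) (c : Curve A) (q : ℕ) :
    (c.map f).X q = AddMonoidAlgebra.mapRingHom ℤ f (c.X q) := by
  have hT : ∀ n : ℤ, AddMonoidAlgebra.mapRingHom ℤ f (LaurentPolynomial.T n) =
      LaurentPolynomial.T n := fun n => by ext k; simp [apply_ite f]
  have hC : ∀ a : A, AddMonoidAlgebra.mapRingHom ℤ f (LaurentPolynomial.C a) =
      LaurentPolynomial.C (f a) := fun a => by ext k; simp [apply_ite f]
  simp only [X, map_add, map_sum, map_mul, hT, hC, map]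

theorem Y_map (f : A →+* B) (c : Curve A) (p : ℕ) :
    (c.map f).Y p = AddMonoidAlgebra.mapRingHom ℤ f (c.Y p) := by
  have hT : ∀ n : ℤ, AddMonoidAlgebra.mapRingHom ℤ f (LaurentPolynomial.T n) =
      LaurentPolynomial.T n := fun n => by ext k; simp [apply_ite f]
  have hC : ∀ a : A, AddMonoidAlgebra.mapRingHom ℤ f (LaurentPolynomial.C a) =
      LaurentPolynomial.C (f a) := fun a => by ext k; simp [apply_ite f]
  simp only [Y, map_add, map_sum, map_mul, hT, hC, map]

theorem coeff_X_map_pow (f : A →+* B) (c : Curve A) (q k : ℕ) (s : ℤ) :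
    (((c.map f).X q) ^ k).coeff s = f ((c.X q ^ k).coeff s) := by
  rw [X_map, ← map_pow, AddMonoidAlgebra.coeff_mapRingHom]

theorem coeff_Y_map_pow (f : A →+* B) (c : Curve A) (p k : ℕ) (s : ℤ) :
    (((c.map f).Y p) ^ k).coeff s = f ((c.Y p ^ k).coeff s) := by
  rw [Y_map, ← map_pow, AddMonoidAlgebra.coeff_mapRingHom]

theorem IsSpectral.map {p q : ℕ} {g gt : ℕ → A} {c : Curve A} (hc : c.IsSpectral p q g gt)
    (f : A →+* B) :
    (c.map f).IsSpectral p q (fun k => f (g k)) (fun k => f (gt k)) where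
  α_eq_zero j hj := by simp [Curve.map, hc.α_eq_zero j hj]
  β_eq_zero j hj := by simp [Curve.map, hc.β_eq_zero j hj]
  α_eq j hj := by
    simp only [coeff_Y_map_pow]
    simp [Curve.map, hc.α_eq j hj]
  β_eq j hj := by
    simp only [coeff_X_map_pow]
    simp [Curve.map, hc.β_eq j hj]
  R_eq := by
    have := congrArg f hc.R_eq
    simpa [Curve.map] using this

end Curve

open PowerSeries in
theorem X_dvd_coupling_sub {r : ℕ} (lam : Finset.Icc 2 r → ℂ) (k : ℕ) :
    (X : PowerSeries ℂ) ∣ coupling lam k - if k = 2 then C (extend lam 2) else 0 := by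
  unfold coupling
  split_ifs with h
  · subst h; simp
  · rcases Nat.lt_or_ge k 2 with hk | hk
    · have : extend lam k = 0 := dif_neg (by simp; omega)
      simp [this]
    · rw [sub_zero]
      exact Dvd.dvd.mul_left (dvd_pow_self _ (by omega)) _

variable {p q : ℕ} (lam : Finset.Icc 2 q → ℂ) (lamT : Finset.Icc 2 p → ℂ)

/-- The part of the equation for `α_j` which vanishes at `g = 0`. -/
def alphaError (c : Curve (PowerSeries ℂ)) (j : ℕ) : PowerSeries ℂ :=
  ∑ k ∈ Finset.Icc (j + 1) q,
    (coupling lam k - if k = 2 then PowerSeries.C (extend lam 2) else 0) *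
      ((c.Y p) ^ (k - 1)).coeff (-(j : ℤ))

/-- The part of the equation for `β_j` which vanishes at `g = 0`. -/
def betaError (c : Curve (PowerSeries ℂ)) (j : ℕ) : PowerSeries ℂ :=
  ∑ k ∈ Finset.Icc (j + 1) p,
    (coupling lamT k - if k = 2 then PowerSeries.C (extend lamT 2) else 0) *
      ((c.X q) ^ (k - 1)).coeff (j : ℤ)

variable {lam lamT}

theorem sum_coupling_eq {r : ℕ} (hr : 2 ≤ r) (lam : Finset.Icc 2 r → ℂ) (j : ℕ)
    (f : ℕ → PowerSeries ℂ) :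
    ∑ k ∈ Finset.Icc (j + 1) r, coupling lam k * f k =
      (if j ≤ 1 then PowerSeries.C (extend lam 2) * f 2 else 0) +
      ∑ k ∈ Finset.Icc (j + 1) r,
        (coupling lam k - if k = 2 then PowerSeries.C (extend lam 2) else 0) * f k := by
  simp only [sub_mul, ite_mul, zero_mul, Finset.sum_sub_distrib, Finset.sum_ite_eq',
    Finset.mem_Icc]
  have : (j + 1 ≤ 2 ∧ 2 ≤ r) ↔ j ≤ 1 := by omega
  simp only [this]
  ring

/-- Congruence of two curves modulo a power of the variable. -/
def Curve.Congr (n : ℕ) (c c' : Curve (PowerSeries ℂ)) : Prop :=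
  (∀ j, (PowerSeries.X : PowerSeries ℂ) ^ n ∣ c.α j - c'.α j) ∧
  (∀ j, (PowerSeries.X : PowerSeries ℂ) ^ n ∣ c.β j - c'.β j) ∧
  (PowerSeries.X : PowerSeries ℂ) ^ n ∣ c.R - c'.R

/-- Congruence becomes equality over the quotient ring, so the coefficients of all powers of X and Y
are congruent without further computation. -/
theorem Curve.Congr.map_eq {n : ℕ} {c c' : Curve (PowerSeries ℂ)} (h : Curve.Congr n c c') :
    c.map (Ideal.Quotient.mk (Ideal.span {(PowerSeries.X : PowerSeries ℂ) ^ n})) =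
      c'.map (Ideal.Quotient.mk (Ideal.span {(PowerSeries.X : PowerSeries ℂ) ^ n})) := by
  simp only [Curve.map, Curve.mk.injEq]
  refine ⟨funext fun j => ?_, funext fun j => ?_, ?_⟩ <;>
    rw [Ideal.Quotient.eq, Ideal.mem_span_singleton]
  exacts [h.1 j, h.2.1 j, h.2.2]

theorem Curve.Congr.X_pow {n : ℕ} {c c' : Curve (PowerSeries ℂ)} (h : Curve.Congr n c c')
    (q k : ℕ) (s : ℤ) :
    (PowerSeries.X : PowerSeries ℂ) ^ n ∣ (c.X q ^ k).coeff s - (c'.X q ^ k).coeff s := by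
  rw [← Ideal.mem_span_singleton, ← Ideal.Quotient.eq, ← Curve.coeff_X_map_pow,
    ← Curve.coeff_X_map_pow, h.map_eq]

theorem Curve.Congr.Y_pow {n : ℕ} {c c' : Curve (PowerSeries ℂ)} (h : Curve.Congr n c c')
    (p k : ℕ) (s : ℤ) :
    (PowerSeries.X : PowerSeries ℂ) ^ n ∣ (c.Y p ^ k).coeff s - (c'.Y p ^ k).coeff s := by
  rw [← Ideal.mem_span_singleton, ← Ideal.Quotient.eq, ← Curve.coeff_Y_map_pow,
    ← Curve.coeff_Y_map_pow, h.map_eq]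

theorem X_dvd_betaError (c : Curve (PowerSeries ℂ)) (j : ℕ) :
    (PowerSeries.X : PowerSeries ℂ) ∣ betaError (q := q) lamT c j :=
  Finset.dvd_sum fun k _ => Dvd.dvd.mul_right (X_dvd_coupling_sub lamT k) _

theorem Curve.Congr.alphaError {n : ℕ} {c c' : Curve (PowerSeries ℂ)} (h : Curve.Congr n c c')
    (j : ℕ) : (PowerSeries.X : PowerSeries ℂ) ^ (n + 1) ∣
      alphaError (p := p) lam c j - Mobile.alphaError (p := p) lam c' j := by
  unfold Mobile.alphaError
  rw [← Finset.sum_sub_distrib]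
  refine Finset.dvd_sum fun k _ => ?_
  rw [← mul_sub, pow_succ']
  exact mul_dvd_mul (X_dvd_coupling_sub lam k) (h.Y_pow p _ _)

theorem Curve.Congr.betaError {n : ℕ} {c c' : Curve (PowerSeries ℂ)} (h : Curve.Congr n c c')
    (j : ℕ) : (PowerSeries.X : PowerSeries ℂ) ^ (n + 1) ∣
      betaError (q := q) lamT c j - Mobile.betaError (q := q) lamT c' j := by
  unfold Mobile.betaError
  rw [← Finset.sum_sub_distrib]
  refine Finset.dvd_sum fun k _ => ?_
  rw [← mul_sub, pow_succ']
  exact mul_dvd_mul (X_dvd_coupling_sub lamT k) (h.X_pow q _ _)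

/-- A curve from the list of its coefficients. -/
def Curve.ofFun (f : ℕ ⊕ ℕ ⊕ Unit → PowerSeries ℂ) : Curve (PowerSeries ℂ) :=
  ⟨fun j => f (.inl j), fun j => f (.inr (.inl j)), f (.inr (.inr ()))⟩

/-- The list of coefficients of a curve. -/
def Curve.toFun (c : Curve (PowerSeries ℂ)) : ℕ ⊕ ℕ ⊕ Unit → PowerSeries ℂ :=
  Sum.elim c.α (Sum.elim c.β fun _ => c.R)

theorem Curve.ofFun_toFun (c : Curve (PowerSeries ℂ)) : Curve.ofFun c.toFun = c := rfl

variable (lam lamT) in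
/-- The right-hand side of the equation for `R`, solved for `R`. -/
def iterR (c : Curve (PowerSeries ℂ)) : PowerSeries ℂ :=
  PowerSeries.C (1 - extend lam 2 * extend lamT 2)⁻¹ *
    (1 + PowerSeries.C (extend lam 2) * c.R * betaError (q := q) lamT c 1 +
      alphaError (p := p) lam c 1 * (PowerSeries.C (extend lamT 2) + betaError (q := q) lamT c 1) +
      ∑ j ∈ Finset.Icc 2 (min p q - 1),
        (j : PowerSeries ℂ) * alphaError (p := p) lam c j * betaError (q := q) lamT c j)

variable (lam lamT) in
/-- The right-hand side of the equation for `α_0`, solved for `α_0`. -/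
def iterA (c : Curve (PowerSeries ℂ)) : PowerSeries ℂ :=
  PowerSeries.C (1 - extend lam 2 * extend lamT 2)⁻¹ *
    (PowerSeries.C (extend lam 2) * betaError (q := q) lamT c 0 + alphaError (p := p) lam c 0)

variable (lam lamT) in
/-- The contraction whose fixed point is the spectral curve. -/
def curveIter (c : Curve (PowerSeries ℂ)) : Curve (PowerSeries ℂ) where
  α j := (if j = 0 then iterA lam lamT c - alphaError (p := p) lam c 0 else
    if j = 1 then PowerSeries.C (extend lam 2) * iterR lam lamT c else 0) + alphaError (p := p) lam c j
  β j := (if j = 0 then PowerSeries.C (extend lamT 2) * iterA lam lamT c else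
    if j = 1 then PowerSeries.C (extend lamT 2) else 0) + betaError (q := q) lamT c j
  R := iterR lam lamT c

theorem dvd_mul_sub_mul {d a a' b b' : PowerSeries ℂ} (ha : d ∣ a - a') (hb : d ∣ b - b') :
    d ∣ a * b - a' * b' := by
  have : a * b - a' * b' = a * (b - b') + (a - a') * b' := by ring
  rw [this]
  exact dvd_add (Dvd.dvd.mul_left hb _) (Dvd.dvd.mul_right ha _)

theorem dvd_add_sub_add {d a a' b b' : PowerSeries ℂ} (ha : d ∣ a - a') (hb : d ∣ b - b') :
    d ∣ (a + b) - (a' + b') := by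
  rw [add_sub_add_comm]; exact dvd_add ha hb

theorem dvd_self_sub (d a : PowerSeries ℂ) : d ∣ a - a := by simp

theorem Curve.Congr.iter {n : ℕ} {c c' : Curve (PowerSeries ℂ)} (h : Curve.Congr n c c') :
    Curve.Congr (n + 1) (curveIter lam lamT c) (curveIter lam lamT c') := by
  have hα := fun j => Curve.Congr.alphaError (p := p) (lam := lam) h j
  have hβ := fun j => Curve.Congr.betaError (q := q) (lamT := lamT) h j
  have hA : (PowerSeries.X : PowerSeries ℂ) ^ (n + 1) ∣ iterA lam lamT c - iterA lam lamT c' :=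
    dvd_mul_sub_mul (dvd_self_sub _ _)
      (dvd_add_sub_add (dvd_mul_sub_mul (dvd_self_sub _ _) (hβ 0)) (hα 0))
  have hR : (PowerSeries.X : PowerSeries ℂ) ^ (n + 1) ∣ iterR lam lamT c - iterR lam lamT c' := by
    refine dvd_mul_sub_mul (dvd_self_sub _ _) (dvd_add_sub_add (dvd_add_sub_add
      (dvd_add_sub_add (dvd_self_sub _ _) ?_) ?_) ?_)
    -- R is only known modulo X^n at this stage; the missing power is supplied by `betaError`, which
    -- is divisible by the variable.
    · have e : PowerSeries.C (extend lam 2) * c.R * Mobile.betaError (q := q) lamT c 1 -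
          PowerSeries.C (extend lam 2) * c'.R * Mobile.betaError (q := q) lamT c' 1 =
          PowerSeries.C (extend lam 2) * (c.R * (Mobile.betaError (q := q) lamT c 1 -
            Mobile.betaError (q := q) lamT c' 1) +
            (c.R - c'.R) * Mobile.betaError (q := q) lamT c' 1) := by ring
      rw [e]
      refine Dvd.dvd.mul_left (dvd_add (Dvd.dvd.mul_left (hβ 1) _) ?_) _
      rw [pow_succ]
      exact mul_dvd_mul h.2.2 (X_dvd_betaError c' 1)
    · exact dvd_mul_sub_mul (hα 1) (dvd_add_sub_add (dvd_self_sub _ _) (hβ 1))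
    · rw [← Finset.sum_sub_distrib]
      exact Finset.dvd_sum fun j _ => dvd_mul_sub_mul (dvd_mul_sub_mul (dvd_self_sub _ _) (hα j))
        (hβ j)
  refine ⟨fun j => dvd_add_sub_add ?_ (hα j), fun j => dvd_add_sub_add ?_ (hβ j), hR⟩
  · split_ifs
    · have := dvd_sub hA (hα 0)
      rwa [sub_sub_sub_comm] at this
    · exact dvd_mul_sub_mul (dvd_self_sub _ _) hR
    · simp
  · split_ifs
    · exact dvd_mul_sub_mul (dvd_self_sub _ _) hA
    · simp
    · simp

/-- Let l, m be the values of the two couplings of index 2, the only ones that survive at g = 0.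
There the equations reduce to α_0 = l β_0, β_0 = m α_0, α_1 = l R, β_1 = m, R = 1 + α_1 β_1, and are
solved by inverting 1 - l m. The iteration does this with the error terms kept on the right-hand
side. -/
theorem isSpectral_iff (hp : 2 ≤ p) (hq : 2 ≤ q) (hne : extend lam 2 * extend lamT 2 ≠ 1)
    (c : Curve (PowerSeries ℂ)) :
    c.IsSpectral p q (coupling lam) (coupling lamT) ↔ curveIter lam lamT c = c := by
  set l := extend lam 2
  set m := extend lamT 2
  have hs : (PowerSeries.C (1 - l * m)⁻¹ : PowerSeries ℂ) *
      (1 - PowerSeries.C l * PowerSeries.C m) = 1 := by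
    rw [← map_one (PowerSeries.C (R := ℂ)), ← map_mul, ← map_sub, ← map_mul, map_one,
      inv_mul_cancel₀ (sub_ne_zero.2 (Ne.symm hne)), map_one]
  have hu : (1 - PowerSeries.C l * PowerSeries.C m : PowerSeries ℂ) ≠ 0 := fun h0 => by
    rw [h0, mul_zero] at hs; exact zero_ne_one hs
  have hα : ∀ j : ℕ, ∑ k ∈ Finset.Icc (j + 1) q, coupling lam k *
      ((c.Y p) ^ (k - 1)).coeff (-(j : ℤ)) =
      (if j = 0 then PowerSeries.C l * c.β 0 else if j = 1 then PowerSeries.C l * c.R else 0) +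
        alphaError (p := p) lam c j := by
    intro j
    rw [sum_coupling_eq hq, alphaError]
    congr 1
    simp only [Nat.add_one_sub_one, pow_one]
    rcases j with _ | _ | j
    · have := c.coeff_Y_natCast p 0
      rw [if_pos (by omega)] at this
      simp only [Nat.cast_zero, neg_zero, zero_le, if_true] at this ⊢
      rw [← this]
    · have := c.coeff_Y_neg_one p
      simp [l, this]
    · rw [if_neg (by omega), if_neg (by omega), if_neg (by omega)]
  have hβ : ∀ j : ℕ, ∑ k ∈ Finset.Icc (j + 1) p, coupling lamT k *
      ((c.X q) ^ (k - 1)).coeff (j : ℤ) =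
      (if j = 0 then PowerSeries.C m * c.α 0 else if j = 1 then PowerSeries.C m else 0) +
        betaError (q := q) lamT c j := by
    intro j
    rw [sum_coupling_eq hp, betaError]
    congr 1
    simp only [Nat.add_one_sub_one, pow_one]
    rcases j with _ | _ | j
    · have := c.coeff_X_neg q 0
      rw [if_pos (by omega)] at this
      simp only [Nat.cast_zero, neg_zero, zero_le, if_true] at this ⊢
      rw [← this]
    · have := c.coeff_X_one q
      simp [m, this]
    · rw [if_neg (by omega), if_neg (by omega), if_neg (by omega)]
  have hα0 : ∀ j, q ≤ j → ∑ k ∈ Finset.Icc (j + 1) q, coupling lam k *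
      ((c.Y p) ^ (k - 1)).coeff (-(j : ℤ)) = 0 := fun j hj => by
    rw [Finset.Icc_eq_empty (by omega), Finset.sum_empty]
  have hβ0 : ∀ j, p ≤ j → ∑ k ∈ Finset.Icc (j + 1) p, coupling lamT k *
      ((c.X q) ^ (k - 1)).coeff (j : ℤ) = 0 := fun j hj => by
    rw [Finset.Icc_eq_empty (by omega), Finset.sum_empty]
  have h12 : Finset.Icc 1 (min p q - 1) = insert 1 (Finset.Icc 2 (min p q - 1)) := by
    ext j; simp only [Finset.mem_Icc, Finset.mem_insert]; omega
  have hspec : c.IsSpectral p q (coupling lam) (coupling lamT) ↔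
      (∀ j, c.α j = (if j = 0 then PowerSeries.C l * c.β 0 else
        if j = 1 then PowerSeries.C l * c.R else 0) + alphaError (p := p) lam c j) ∧
      (∀ j, c.β j = (if j = 0 then PowerSeries.C m * c.α 0 else
        if j = 1 then PowerSeries.C m else 0) + betaError (q := q) lamT c j) ∧
      c.R = 1 + c.α 1 * c.β 1 +
        ∑ j ∈ Finset.Icc 2 (min p q - 1), (j : PowerSeries ℂ) * c.α j * c.β j := by
    constructor
    · intro hc
      refine ⟨fun j => ?_, fun j => ?_, ?_⟩
      · rcases Nat.lt_or_ge j q with hj | hj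
        · rw [hc.α_eq j hj, hα]
        · rw [hc.α_eq_zero j hj, ← hα, hα0 j hj]
      · rcases Nat.lt_or_ge j p with hj | hj
        · rw [hc.β_eq j hj, hβ]
        · rw [hc.β_eq_zero j hj, ← hβ, hβ0 j hj]
      · have h1 := hc.R_eq
        rw [h12, Finset.sum_insert (by simp)] at h1
        push_cast at h1
        linear_combination -h1
    · rintro ⟨h1, h2, h3⟩
      refine ⟨fun j hj => ?_, fun j hj => ?_, fun j _ => ?_, fun j _ => ?_, ?_⟩
      · rw [h1, ← hα, hα0 j hj]
      · rw [h2, ← hβ, hβ0 j hj]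
      · rw [hα, h1]
      · rw [hβ, h2]
      · rw [h12, Finset.sum_insert (by simp)]
        push_cast
        linear_combination -h3
  rw [hspec]
  have hcurve : curveIter lam lamT c = c ↔ (∀ j, (curveIter lam lamT c).α j = c.α j) ∧
      (∀ j, (curveIter lam lamT c).β j = c.β j) ∧ (curveIter lam lamT c).R = c.R := by
    constructor
    · intro h; rw [h]; exact ⟨fun _ => rfl, fun _ => rfl, rfl⟩
    · rintro ⟨h1, h2, h3⟩
      cases c
      simp only [curveIter, Curve.mk.injEq] at h1 h2 h3 ⊢
      exact ⟨funext h1, funext h2, h3⟩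
  rw [hcurve]
  simp only [curveIter]
  have hsumE : (∀ j ≥ 2, c.α j = alphaError (p := p) lam c j) →
      (∀ j ≥ 2, c.β j = betaError (q := q) lamT c j) →
      ∑ j ∈ Finset.Icc 2 (min p q - 1), (j : PowerSeries ℂ) * c.α j * c.β j =
      ∑ j ∈ Finset.Icc 2 (min p q - 1), (j : PowerSeries ℂ) * alphaError (p := p) lam c j *
        betaError (q := q) lamT c j := fun h1 h2 =>
    Finset.sum_congr rfl fun j hj => by
      rw [Finset.mem_Icc] at hj
      rw [h1 j hj.1, h2 j hj.1]
  constructor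
  · rintro ⟨h1, h2, h3⟩
    have a0 := h1 0
    have a1 := h1 1
    have b0 := h2 0
    have b1 := h2 1
    simp only [if_true, one_ne_zero, if_false] at a0 a1 b0 b1
    have a2 : ∀ j ≥ 2, c.α j = alphaError (p := p) lam c j := fun j hj => by
      rw [h1 j, if_neg (by omega), if_neg (by omega), zero_add]
    have b2 : ∀ j ≥ 2, c.β j = betaError (q := q) lamT c j := fun j hj => by
      rw [h2 j, if_neg (by omega), if_neg (by omega), zero_add]
    rw [hsumE a2 b2] at h3
    have hiA : iterA lam lamT c = c.α 0 := by
      unfold iterA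
      change PowerSeries.C (1 - l * m)⁻¹ * (PowerSeries.C l * _ + _) = _
      linear_combination c.α 0 * hs - PowerSeries.C (1 - l * m)⁻¹ * a0 -
        PowerSeries.C (1 - l * m)⁻¹ * PowerSeries.C l * b0
    have hiR : iterR lam lamT c = c.R := by
      unfold iterR
      change PowerSeries.C (1 - l * m)⁻¹ * (1 + PowerSeries.C l * _ * _ +
        _ * (PowerSeries.C m + _) + _) = _
      rw [a1, b1] at h3
      linear_combination c.R * hs - PowerSeries.C (1 - l * m)⁻¹ * h3
    rw [hiA, hiR]
    refine ⟨fun j => ?_, fun j => ?_, rfl⟩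
    · rcases j with _ | _ | j
      · simp
      · rw [a1]; simp [l]
      · rw [a2 (j + 1 + 1) (by omega)]; simp
    · rcases j with _ | _ | j
      · rw [b0]; simp [m]
      · rw [b1]; simp [m]
      · rw [b2 (j + 1 + 1) (by omega)]; simp
  · rintro ⟨h1, h2, h3⟩
    have a0 := h1 0
    have a1 := h1 1
    have b0 := h2 0
    have b1 := h2 1
    simp only [if_true, one_ne_zero, if_false] at a0 a1 b0 b1
    rw [sub_add_cancel] at a0
    rw [a0] at b0
    rw [h3] at a1
    have a2 : ∀ j ≥ 2, c.α j = alphaError (p := p) lam c j := fun j hj => by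
      rw [← h1 j, if_neg (by omega), if_neg (by omega), zero_add]
    have b2 : ∀ j ≥ 2, c.β j = betaError (q := q) lamT c j := fun j hj => by
      rw [← h2 j, if_neg (by omega), if_neg (by omega), zero_add]
    have hA : c.α 0 * (1 - PowerSeries.C l * PowerSeries.C m) =
        PowerSeries.C l * betaError (q := q) lamT c 0 + alphaError (p := p) lam c 0 := by
      rw [← a0]
      unfold iterA
      change PowerSeries.C (1 - l * m)⁻¹ * (PowerSeries.C l * _ + _) * _ = _
      linear_combination (PowerSeries.C l * betaError (q := q) lamT c 0 +
        alphaError (p := p) lam c 0) * hs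
    have hR : c.R * (1 - PowerSeries.C l * PowerSeries.C m) =
        1 + PowerSeries.C l * c.R * betaError (q := q) lamT c 1 +
      alphaError (p := p) lam c 1 * (PowerSeries.C m + betaError (q := q) lamT c 1) +
      ∑ j ∈ Finset.Icc 2 (min p q - 1),
        (j : PowerSeries ℂ) * alphaError (p := p) lam c j * betaError (q := q) lamT c j := by
      conv_lhs => rw [← h3]
      unfold iterR
      rw [mul_right_comm]
      erw [hs]
      rw [one_mul]
    refine ⟨fun j => ?_, fun j => ?_, ?_⟩
    · rcases j with _ | _ | j
      · simp only [if_true, ← b0]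
        change _ = PowerSeries.C l * (PowerSeries.C m * _ + _) + _
        linear_combination hA
      · simp only [zero_add, one_ne_zero, if_false, if_true]
        exact a1.symm
      · rw [a2 (j + 1 + 1) (by omega)]; simp
    · rcases j with _ | _ | j
      · simp only [if_true]
        exact b0.symm
      · simp only [zero_add, one_ne_zero, if_false, if_true]
        exact b1.symm
      · rw [b2 (j + 1 + 1) (by omega)]; simp
    · rw [hsumE a2 b2, ← a1, ← b1]
      linear_combination hR

theorem curve_congr_iff (n : ℕ) (f f' : ℕ ⊕ ℕ ⊕ Unit → PowerSeries ℂ) :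
    Curve.Congr n (Curve.ofFun f) (Curve.ofFun f') ↔
      ∀ i, (PowerSeries.X : PowerSeries ℂ) ^ n ∣ f i - f' i := by
  constructor
  · rintro ⟨h1, h2, h3⟩ (i | i | ⟨⟩)
    exacts [h1 i, h2 i, h3]
  · intro h
    exact ⟨fun j => h (.inl j), fun j => h (.inr (.inl j)), h (.inr (.inr ()))⟩

theorem exists_unique_spectral (hp : 2 ≤ p) (hq : 2 ≤ q)
    (hne : extend lam 2 * extend lamT 2 ≠ 1) :
    ∃ c : Curve (PowerSeries ℂ), c.IsSpectral p q (coupling lam) (coupling lamT) ∧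
      ∀ c' : Curve (PowerSeries ℂ),
        c'.IsSpectral p q (coupling lam) (coupling lamT) → c' = c := by
  simp only [isSpectral_iff hp hq hne]
  set Φ : (ℕ ⊕ ℕ ⊕ Unit → PowerSeries ℂ) → ℕ ⊕ ℕ ⊕ Unit → PowerSeries ℂ :=
    fun f => (curveIter lam lamT (Curve.ofFun f)).toFun with hΦ
  have hcon : ∀ n ≥ 0, ∀ f ∈ Set.univ, ∀ f' ∈ Set.univ,
      (∀ i, (PowerSeries.X : PowerSeries ℂ) ^ n ∣ f i - f' i) →
      ∀ i, (PowerSeries.X : PowerSeries ℂ) ^ (n + 1) ∣ Φ f i - Φ f' i := by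
    intro n _ f _ f' _ h
    rw [← curve_congr_iff]
    exact Curve.Congr.iter ((curve_congr_iff n f f').2 h)
  obtain ⟨f, -, hf⟩ := exists_fixedPoint (Φ := Φ) (f0 := 0) (n0 := 0) (S := Set.univ)
    (by simp) (by simp) hcon
  refine ⟨Curve.ofFun f, ?_, fun c' hc' => ?_⟩
  · have := congrArg Curve.ofFun hf
    rwa [hΦ, Curve.ofFun_toFun] at this
  · have h1 : Φ c'.toFun = c'.toFun := by
      rw [hΦ]; simp only [Curve.ofFun_toFun, hc']
    have := eq_of_fixedPoint hcon (Set.mem_univ _) (Set.mem_univ _) (by simp) h1 hf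
    rw [← this, Curve.ofFun_toFun]

end SpectralCurve

end Mobile

end

noncomputable section

namespace Mobile

/-! ### Orders of the coefficients of the spectral curve and of its double points -/

section Leading

theorem coeff_toLaurent (f : PowerSeries ℂ) (n : ℕ) :
    (toLaurent f).coeff (n : ℤ) = PowerSeries.coeff n f := HahnSeries.ofPowerSeries_apply_coeff _ n

theorem ordGE_toLaurent (f : PowerSeries ℂ) : OrdGE 0 (toLaurent f) := ordGE_ofPowerSeries f

theorem exists_toLaurent_eq_of_ordGE {f : LaurentSeries ℂ} (hf : OrdGE 0 f) :
    ∃ f' : PowerSeries ℂ, toLaurent f' = f := by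
  refine ⟨PowerSeries.mk fun n => f.coeff n, ?_⟩
  ext k
  rcases lt_or_ge k 0 with hk | hk
  · rw [hf k hk, ordGE_toLaurent _ k hk]
  · obtain ⟨n, rfl⟩ : ∃ n : ℕ, k = n := ⟨k.toNat, by omega⟩
    rw [coeff_toLaurent, PowerSeries.coeff_mk]

theorem toLaurent_injective : Function.Injective toLaurent := HahnSeries.ofPowerSeries_injective

theorem toLaurent_coupling {r : ℕ} (lam : Finset.Icc 2 r → ℂ) (k : ℕ) (hk : 2 ≤ k) :
    toLaurent (coupling lam k) = HahnSeries.single ((k : ℤ) - 2) (extend lam k) := by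
  rw [coupling, map_mul, HahnSeries.ofPowerSeries_C, HahnSeries.ofPowerSeries_X_pow,
    HahnSeries.C_apply, HahnSeries.single_mul_single, Nat.cast_sub hk, zero_add, mul_one]
  rfl

theorem coupling_of_gt {r : ℕ} (lam : Finset.Icc 2 r → ℂ) (k : ℕ) (hk : r < k) :
    coupling lam k = 0 := by
  have : extend lam k = 0 := dif_neg (by simp; omega)
  simp [coupling, this]

theorem extend_of_gt {r : ℕ} (lam : Finset.Icc 2 r → ℂ) (k : ℕ) (hk : r < k) :
    extend lam k = 0 := dif_neg (by simp; omega)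

theorem coeff_pow_of_lowGE {K : Type} [Field K] {n : ℤ} {f : LaurentPolynomial K} (hf : LowGE n f)
    (k : ℕ) : (f ^ k).coeff (k * n) = f.coeff n ^ k := by
  have := coeff_pow_of_degLE (lowGE_iff_degLE_invert.1 hf) k
  rw [← map_pow, LaurentPolynomial.invert_apply, LaurentPolynomial.invert_apply, neg_neg] at this
  rw [← this]; congr 1; ring

/-- The orders and the leading coefficients of the coefficients of a curve. -/
structure Curve.IsLeading (c : Curve (LaurentSeries ℂ)) (lam lamT : ℕ → ℂ) (r0 : ℂ) : Prop where
  α_zero : OrdGE 0 (c.α 0)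
  β_zero : OrdGE 0 (c.β 0)
  α_ord : ∀ j : ℕ, 1 ≤ j → OrdGE ((j : ℤ) - 1) (c.α j)
  β_ord : ∀ j : ℕ, 1 ≤ j → OrdGE ((j : ℤ) - 1) (c.β j)
  α_lead : ∀ j : ℕ, 1 ≤ j → (c.α j).coeff ((j : ℤ) - 1) = lam (j + 1) * r0 ^ j
  β_lead : ∀ j : ℕ, 1 ≤ j → (c.β j).coeff ((j : ℤ) - 1) = lamT (j + 1)
  R_ord : OrdGE 0 c.R
  R_lead : c.R.coeff 0 = r0
  r0_ne : r0 ≠ 0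
  r0_eq : r0 * (1 - lam 2 * lamT 2) = 1

variable {p q : ℕ} {lam : Finset.Icc 2 q → ℂ} {lamT : Finset.Icc 2 p → ℂ}

/-- g_k has order at least k - 2, so among k ≥ j + 1 only k = j + 1 contributes in order j - 1. -/
theorem leading_sum {r : ℕ} (lam : Finset.Icc 2 r → ℂ) (j : ℕ) (hj : 1 ≤ j) (hjr : j < r)
    (f : ℕ → LaurentSeries ℂ) (hf : ∀ k, OrdGE 0 (f k)) :
    OrdGE ((j : ℤ) - 1) (∑ k ∈ Finset.Icc (j + 1) r, toLaurent (coupling lam k) * f k) ∧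
    (∑ k ∈ Finset.Icc (j + 1) r, toLaurent (coupling lam k) * f k).coeff ((j : ℤ) - 1) =
      extend lam (j + 1) * (f (j + 1)).coeff 0 := by
  have hterm : ∀ k : ℕ, 2 ≤ k → OrdGE ((k : ℤ) - 2) (toLaurent (coupling lam k) * f k) := by
    intro k hk
    rw [toLaurent_coupling _ _ hk]
    simpa using (ordGE_single ((k : ℤ) - 2) (extend lam k)).mul (hf k)
  refine ⟨OrdGE.sum fun k hk => ?_, ?_⟩
  · rw [Finset.mem_Icc] at hk
    exact (hterm k (by omega)).mono (by omega)
  · rw [HahnSeries.coeff_sum, Finset.sum_eq_single (j + 1)]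
    · rw [toLaurent_coupling _ _ (by omega)]
      have := coeff_mul_of_ordGE (ordGE_single (((j + 1 : ℕ) : ℤ) - 2) (extend lam (j + 1)))
        (hf (j + 1))
      rw [HahnSeries.coeff_single_same, add_zero] at this
      rw [← this]; congr 1; push_cast; ring
    · intro k hk hne
      rw [Finset.mem_Icc] at hk
      exact hterm k (by omega) _ (by omega)
    · intro h; exact absurd (Finset.mem_Icc.2 ⟨le_rfl, by omega⟩) h

theorem Curve.IsSpectral.isLeading {c : Curve (PowerSeries ℂ)}
    (hc : c.IsSpectral p q (coupling lam) (coupling lamT)) (hp : 2 ≤ p) (hq : 2 ≤ q) :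
    (c.map toLaurent).IsLeading (extend lam) (extend lamT) (PowerSeries.coeff 0 c.R) := by
  have hcK := hc.map toLaurent
  have hα : ∀ j : ℕ, 1 ≤ j → OrdGE ((j : ℤ) - 1) ((c.map toLaurent).α j) ∧
      ((c.map toLaurent).α j).coeff ((j : ℤ) - 1) =
        extend lam (j + 1) * (PowerSeries.coeff 0 c.R) ^ j := by
    intro j hj
    rcases Nat.lt_or_ge j q with h | h
    · rw [hcK.α_eq j h]
      have := leading_sum lam j hj h
        (fun k => (((c.map toLaurent).Y p) ^ (k - 1)).coeff (-(j : ℤ)))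
        (fun k => by rw [Curve.coeff_Y_map_pow]; exact ordGE_toLaurent _)
      refine ⟨this.1, this.2.trans ?_⟩
      simp only [Nat.add_sub_cancel]
      have h2 := coeff_pow_of_lowGE ((c.map toLaurent).lowGE_Y (p := p)) j
      rw [Curve.coeff_Y_neg_one, mul_neg_one] at h2
      rw [h2, Curve.map]
      simp only
      rw [← map_pow]
      have h3 := coeff_toLaurent (c.R ^ j) 0
      rw [Nat.cast_zero] at h3
      rw [h3]
      simp
    · rw [hcK.α_eq_zero j h, extend_of_gt lam _ (by omega)]
      exact ⟨ordGE_zero _, by simp⟩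
  have hβ : ∀ j : ℕ, 1 ≤ j → OrdGE ((j : ℤ) - 1) ((c.map toLaurent).β j) ∧
      ((c.map toLaurent).β j).coeff ((j : ℤ) - 1) = extend lamT (j + 1) := by
    intro j hj
    rcases Nat.lt_or_ge j p with h | h
    · rw [hcK.β_eq j h]
      have := leading_sum lamT j hj h
        (fun k => (((c.map toLaurent).X q) ^ (k - 1)).coeff (j : ℤ))
        (fun k => by rw [Curve.coeff_X_map_pow]; exact ordGE_toLaurent _)
      refine ⟨this.1, this.2.trans ?_⟩
      simp only [Nat.add_sub_cancel]
      have h2 := coeff_pow_of_degLE ((c.map toLaurent).degLE_X (q := q)) j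
      rw [Curve.coeff_X_one, mul_one, one_pow] at h2
      rw [h2]
      simp
    · rw [hcK.β_eq_zero j h, extend_of_gt lamT _ (by omega)]
      exact ⟨ordGE_zero _, by simp⟩
  have hR : (c.map toLaurent).R.coeff 0 = PowerSeries.coeff 0 c.R := coeff_toLaurent c.R 0
  -- In order zero only α_1 β_1 enters the equation for R, with value lam_2 r0 lamT_2.
  have hr0 : PowerSeries.coeff 0 c.R * (1 - extend lam 2 * extend lamT 2) = 1 := by
    have h1 := congrArg (fun f => HahnSeries.coeff f 0) hcK.R_eq
    simp only [HahnSeries.coeff_sub, HahnSeries.coeff_sum, hR, coeff_one_zero] at h1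
    rw [Finset.sum_eq_single 1] at h1
    · have h2 := coeff_mul_of_ordGE (hα 1 le_rfl).1 (hβ 1 le_rfl).1
      rw [(hα 1 le_rfl).2, (hβ 1 le_rfl).2] at h2
      simp only [Nat.cast_one, sub_self, add_zero, one_mul] at h1 h2
      rw [h2] at h1
      linear_combination -h1
    · intro j hj hne
      rw [Finset.mem_Icc] at hj
      have h2 := (hα j (by omega)).1.mul (hβ j (by omega)).1
      have h3 := h2 0 (by omega)
      rw [mul_assoc, ← nsmul_eq_mul, HahnSeries.coeff_smul, h3, smul_zero]
    · intro h; exact absurd (Finset.mem_Icc.2 ⟨le_rfl, by omega⟩) h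
  exact ⟨ordGE_toLaurent _, ordGE_toLaurent _, fun j hj => (hα j hj).1, fun j hj => (hβ j hj).1,
    fun j hj => (hα j hj).2, fun j hj => (hβ j hj).2, ordGE_toLaurent _, hR,
    left_ne_zero_of_mul_eq_one hr0, hr0⟩

/-- The function `s ↦ ρ / s + ∑_{j<n} c_j s^j`. Both `X` and `Y` are of this form. -/
def edge {K : Type} [Field K] (n : ℕ) (ρ : K) (c : ℕ → K) (s : K) : K :=
  ρ * s⁻¹ + ∑ j ∈ Finset.range n, c j * s ^ j

theorem evalAt_X {K : Type} [Field K] (c : Curve K) (q : ℕ) (z : Kˣ) :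
    evalAt z (c.X q) = edge q 1 c.α ((z : K)⁻¹) := by
  rw [Curve.X, edge, map_add, map_sum, LaurentPolynomial.eval₂_T, zpow_one, inv_inv, one_mul]
  congr 1
  refine Finset.sum_congr rfl fun j _ => ?_
  rw [LaurentPolynomial.eval₂_C_mul_T_neg_n, RingHom.id_apply, Units.val_inv_eq_inv_val]

theorem evalAt_Y {K : Type} [Field K] (c : Curve K) (p : ℕ) (z : Kˣ) :
    evalAt z (c.Y p) = edge p c.R c.β (z : K) := by
  rw [Curve.Y, edge, map_add, map_sum, LaurentPolynomial.eval₂_C_mul_T, zpow_neg_one,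
    RingHom.id_apply, Units.val_inv_eq_inv_val]
  congr 1
  refine Finset.sum_congr rfl fun j _ => ?_
  rw [LaurentPolynomial.eval₂_C_mul_T_n, RingHom.id_apply]

theorem isDoublePoint_iff {K : Type} [Field K] {p q : ℕ} {c : Curve K} {z z' : Kˣ} :
    c.IsDoublePoint p q z z' ↔ z ≠ z' ∧
      edge q 1 c.α ((z : K)⁻¹) = edge q 1 c.α ((z' : K)⁻¹) ∧
      edge p c.R c.β (z : K) = edge p c.R c.β (z' : K) := by
  rw [← evalAt_X, ← evalAt_X, ← evalAt_Y, ← evalAt_Y]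
  rfl

variable {n : ℕ} {ρ : LaurentSeries ℂ} {c : ℕ → LaurentSeries ℂ} {s s' : LaurentSeries ℂ}

/-- Division of the difference of the two values by s' - s gives ρ = s s' ∑ c_j (s^(j-1) + ... +
s'^(j-1)). As c_j has order at least j - 1, only j = 1 contributes in order zero. -/
theorem coeff_zero_of_edge_eq (hn : 2 ≤ n) (hc : ∀ j : ℕ, 1 ≤ j → OrdGE ((j : ℤ) - 1) (c j))
    (hs : OrdGE 0 s) (hs' : OrdGE 0 s') (hne : s ≠ s')
    (h0 : s ≠ 0) (h0' : s' ≠ 0) (h : edge n ρ c s = edge n ρ c s') :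
    ρ.coeff 0 = (c 1).coeff 0 * s.coeff 0 * s'.coeff 0 := by
  have key : ρ = ∑ j ∈ Finset.range n,
      c j * ((s * s') * ∑ i ∈ Finset.range j, s' ^ i * s ^ (j - 1 - i)) := by
    have h1 : ρ * (s' - s) = (∑ j ∈ Finset.range n,
      c j * ((s * s') * ∑ i ∈ Finset.range j, s' ^ i * s ^ (j - 1 - i))) * (s' - s) := by
      have h2 : ∀ j, c j * ((s * s') * ∑ i ∈ Finset.range j, s' ^ i * s ^ (j - 1 - i)) * (s' - s) =
          (s * s') * (c j * s' ^ j - c j * s ^ j) := by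
        intro j
        rw [← mul_sub, ← geom_sum₂_mul]; ring
      rw [Finset.sum_mul]
      simp only [h2]
      rw [← Finset.mul_sum, Finset.sum_sub_distrib]
      unfold edge at h
      have h3 : ρ * (s' - s) = (s * s') * (ρ * s⁻¹ - ρ * s'⁻¹) := by field_simp
      rw [h3]
      congr 1
      linear_combination h
    exact mul_right_cancel₀ (sub_ne_zero.2 hne.symm) h1
  have hG : ∀ j : ℕ, OrdGE 0 (∑ i ∈ Finset.range j, s' ^ i * s ^ (j - 1 - i)) := fun j =>
    OrdGE.sum fun i _ => by simpa using (hs'.pow i).mul (hs.pow (j - 1 - i))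
  have hss : OrdGE 0 (s * s') := by simpa using hs.mul hs'
  rw [key, HahnSeries.coeff_sum, Finset.sum_eq_single 1]
  · have h1 := coeff_mul_of_ordGE (hc 1 le_rfl) hss
    have h2 := coeff_mul_of_ordGE hs hs'
    simp only [add_zero] at h2
    simp only [Nat.cast_one, sub_self, add_zero, h2] at h1
    simp only [Finset.range_one, Finset.sum_singleton, pow_zero, mul_one, le_refl,
      tsub_eq_zero_of_le]
    rw [h1]; ring
  · intro j _ hj
    rcases Nat.eq_zero_or_pos j with rfl | hj0
    · simp
    · have := (hc j hj0).mul (hss.mul (hG j))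
      exact this 0 (by omega)
  · intro hh; exact absurd (Finset.mem_range.2 (by omega)) hh

/-- The term ρ / s dominates, all the others having order at least zero. -/
theorem edge_small (hρ : OrdGE 0 ρ) (hc0 : OrdGE 0 (c 0)) (hc : ∀ j : ℕ, 1 ≤ j → OrdGE ((j : ℤ) - 1) (c j))
    {A : ℤ} (hA : 0 ≤ A) (hs : OrdGE (1 + A) s) (hs1 : s.coeff (1 + A) ≠ 0) :
    OrdGE (-(1 + A)) (edge n ρ c s) ∧
      (edge n ρ c s).coeff (-(1 + A)) = ρ.coeff 0 * (s.coeff (1 + A))⁻¹ := by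
  obtain ⟨h1, h2⟩ := hs.inv hs1
  have h3 := hρ.mul h1
  have h4 := coeff_mul_of_ordGE hρ h1
  rw [zero_add] at h3 h4
  have h5 : OrdGE 0 (∑ j ∈ Finset.range n, c j * s ^ j) := by
    refine OrdGE.sum fun j _ => ?_
    rcases Nat.eq_zero_or_pos j with rfl | hj
    · simpa using hc0
    · refine ((hc j hj).mul (hs.pow j)).mono ?_
      have : (0 : ℤ) ≤ (j : ℤ) * (1 + A) := by positivity
      omega
  refine ⟨h3.add (h5.mono (by omega)), ?_⟩
  rw [edge, HahnSeries.coeff_add, h4, h2, h5 _ (by omega), add_zero]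

/-- c_j s^j has order at least -(j B + 1). For B > 0 the top power is alone in lowest order; for B =
0 all powers tie, so nothing is claimed about the leading coefficient. -/
theorem edge_large (hρ : OrdGE 0 ρ) (hc0 : OrdGE 0 (c 0))
    (hc : ∀ j : ℕ, 1 ≤ j → OrdGE ((j : ℤ) - 1) (c j)) (hn : 2 ≤ n)
    {B : ℤ} (hB : 0 ≤ B) (hs : OrdGE (-(1 + B)) s) (hs1 : s.coeff (-(1 + B)) ≠ 0) :
    OrdGE (-((n - 1 : ℕ) * B + 1)) (edge n ρ c s) ∧
      (0 < B → (edge n ρ c s).coeff (-((n - 1 : ℕ) * B + 1)) =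
        (c (n - 1)).coeff (((n - 1 : ℕ) : ℤ) - 1) * s.coeff (-(1 + B)) ^ (n - 1)) := by
  obtain ⟨h1, -⟩ := hs.inv hs1
  have h3 := hρ.mul h1
  have hpos : (0 : ℤ) ≤ (n - 1 : ℕ) * B := by positivity
  have hterm : ∀ j : ℕ, 1 ≤ j → OrdGE (-(j * B + 1)) (c j * s ^ j) := fun j hj =>
    ((hc j hj).mul (hs.pow j)).mono (by linarith)
  constructor
  · refine (h3.mono (by omega)).add (OrdGE.sum fun j hj => ?_)
    rw [Finset.mem_range] at hj
    rcases Nat.eq_zero_or_pos j with rfl | hj0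
    · rw [pow_zero, mul_one]; exact hc0.mono (by omega)
    · refine (hterm j hj0).mono ?_
      have : (j : ℤ) * B ≤ (n - 1 : ℕ) * B := mul_le_mul_of_nonneg_right (by omega) hB
      omega
  · intro hB0
    rw [edge, HahnSeries.coeff_add, h3 _ (by omega), zero_add, HahnSeries.coeff_sum,
      Finset.sum_eq_single (n - 1)]
    · have := coeff_mul_of_ordGE (hc (n - 1) (by omega)) (hs.pow (n - 1))
      rw [coeff_pow_of_ordGE hs] at this
      rw [← this]
      congr 1; ring
    · intro j hj hne
      rw [Finset.mem_range] at hj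
      rcases Nat.eq_zero_or_pos j with rfl | hj0
      · rw [pow_zero, mul_one]; exact hc0 _ (by omega)
      · refine hterm j hj0 _ ?_
        have : (j : ℤ) * B < (n - 1 : ℕ) * B := mul_lt_mul_of_pos_right (by omega) hB0
        omega
    · intro hh; exact absurd (Finset.mem_range.2 (by omega)) hh

/-- The dominant term ρ / s on the small side has to be matched on the large side, by the top power
alone when B > 0. -/
theorem order_relation_of_edge_eq (hρ : OrdGE 0 ρ) (hρ0 : ρ.coeff 0 ≠ 0) (hc0 : OrdGE 0 (c 0))
    (hc : ∀ j : ℕ, 1 ≤ j → OrdGE ((j : ℤ) - 1) (c j)) (hn : 2 ≤ n)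
    (hlead : (c (n - 1)).coeff (((n - 1 : ℕ) : ℤ) - 1) ≠ 0)
    {A B : ℤ} (hA : 0 ≤ A) (hB : 0 ≤ B) (hs : OrdGE (1 + A) s) (hs1 : s.coeff (1 + A) ≠ 0)
    (hs' : OrdGE (-(1 + B)) s') (hs1' : s'.coeff (-(1 + B)) ≠ 0)
    (h : edge n ρ c s = edge n ρ c s') :
    A ≤ (n - 1 : ℕ) * B ∧ (0 < B → A = (n - 1 : ℕ) * B) := by
  obtain ⟨h1, h2⟩ := edge_small (n := n) hρ hc0 hc hA hs hs1
  obtain ⟨h3, h4⟩ := edge_large hρ hc0 hc hn hB hs' hs1'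
  rw [h] at h1 h2
  have h5 : A ≤ (n - 1 : ℕ) * B := by
    by_contra hh
    rw [h3 _ (by omega)] at h2
    exact mul_ne_zero hρ0 (inv_ne_zero hs1) h2.symm
  refine ⟨h5, fun hB0 => le_antisymm h5 ?_⟩
  by_contra hh
  have h6 := h4 hB0
  rw [h1 _ (by omega)] at h6
  exact mul_ne_zero hlead (pow_ne_zero _ hs1') h6.symm

/-- The borderline orders 1 and -1, for which all the powers of s' contribute to the same order. -/
theorem leading_equation_of_edge_eq (hρ : OrdGE 0 ρ) (hc0 : OrdGE 0 (c 0))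
    (hc : ∀ j : ℕ, 1 ≤ j → OrdGE ((j : ℤ) - 1) (c j))
    (hs : OrdGE 1 s) (hs1 : s.coeff 1 ≠ 0) (hs' : OrdGE (-1) s') (hs1' : s'.coeff (-1) ≠ 0)
    (h : edge n ρ c s = edge n ρ c s') :
    ρ.coeff 0 * (s.coeff 1)⁻¹ =
      ∑ j ∈ Finset.Ico 1 n, (c j).coeff ((j : ℤ) - 1) * s'.coeff (-1) ^ j := by
  obtain ⟨-, h2⟩ := edge_small (n := n) hρ hc0 hc le_rfl hs hs1
  rw [add_zero] at h2
  rw [← h2, h, edge, HahnSeries.coeff_add, (hρ.mul (hs'.inv hs1').1) _ (by omega), zero_add,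
    HahnSeries.coeff_sum]
  refine (Finset.sum_subset ?_ ?_).symm.trans (Finset.sum_congr rfl ?_)
  · intro j hj; simp only [Finset.mem_Ico, Finset.mem_range] at *; omega
  · intro j hj hj2
    simp only [Finset.mem_Ico, Finset.mem_range] at *
    have : j = 0 := by omega
    subst this
    rw [pow_zero, mul_one]; exact hc0 _ (by omega)
  · intro j hj
    rw [Finset.mem_Ico] at hj
    have := coeff_mul_of_ordGE (hc j hj.1) (hs'.pow j)
    rw [coeff_pow_of_ordGE hs'] at this
    rw [← this]
    congr 1; ring

end Leading

end Mobile

end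

noncomputable section

namespace Mobile

/-! ### Double points of the spectral curve -/

section DoublePoints

variable {lam lamT : ℕ → ℂ} {r0 : ℂ} {c : Curve (LaurentSeries ℂ)} {p q : ℕ}

/-- Suppose both orders equal a. The divided difference of Y gives r0 = lamT_2 z_0 z'_0 for a ≥ 0,
that of X gives 1 = lam_2 r0 (z⁻¹)_0 (z'⁻¹)_0 for a ≤ 0. One right-hand side vanishes if a ≠ 0; if a
= 0 they imply lam_2 lamT_2 = 1, against r0 (1 - lam_2 lamT_2) = 1. -/
theorem Curve.IsLeading.order_ne_order (hc : c.IsLeading lam lamT r0) (hp : 2 ≤ p)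
    (hq : 2 ≤ q) {z z' : (LaurentSeries ℂ)ˣ} (hd : c.IsDoublePoint p q z z') :
    (z : LaurentSeries ℂ).order ≠ (z' : LaurentSeries ℂ).order := by
  intro hab
  obtain ⟨hne, hX, hY⟩ := isDoublePoint_iff.1 hd
  have hne' : (z : LaurentSeries ℂ) ≠ z' := fun h => hne (Units.ext h)
  obtain ⟨hz, hz0⟩ := exists_ordGE_coeff_ne_zero z.ne_zero
  obtain ⟨hz', hz0'⟩ := exists_ordGE_coeff_ne_zero z'.ne_zero
  rw [← hab] at hz' hz0'
  set a := (z : LaurentSeries ℂ).order with ha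
  obtain ⟨iz, iz0⟩ := hz.inv hz0
  obtain ⟨iz', iz0'⟩ := hz'.inv hz0'
  have e1 : 0 ≤ a → r0 = lamT 2 * (z : LaurentSeries ℂ).coeff 0 *
      (z' : LaurentSeries ℂ).coeff 0 := by
    intro h0
    have := coeff_zero_of_edge_eq hp hc.β_ord (hz.mono h0) (hz'.mono h0) hne' z.ne_zero
      z'.ne_zero hY
    have hb := hc.β_lead 1 le_rfl
    rw [Nat.cast_one, sub_self] at hb
    rwa [hb, hc.R_lead] at this
  have e2 : a ≤ 0 → 1 = lam 2 * r0 * (z : LaurentSeries ℂ)⁻¹.coeff 0 *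
      (z' : LaurentSeries ℂ)⁻¹.coeff 0 := by
    intro h0
    have := coeff_zero_of_edge_eq hq hc.α_ord (iz.mono (show 0 ≤ -a by omega))
      (iz'.mono (show 0 ≤ -a by omega)) (fun h => hne' (inv_injective h))
      (inv_ne_zero z.ne_zero) (inv_ne_zero z'.ne_zero) hX
    have hb := hc.α_lead 1 le_rfl
    rw [Nat.cast_one, sub_self, pow_one] at hb
    rwa [hb, coeff_one_zero] at this
  rcases lt_trichotomy a 0 with h | h | h
  · have := e2 h.le
    rw [iz 0 (by omega), mul_zero, zero_mul] at this
    exact one_ne_zero this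
  · have f1 := e1 h.ge
    have f2 := e2 h.le
    rw [h] at hz0 hz0' iz0 iz0'
    rw [neg_zero] at iz0 iz0'
    rw [iz0, iz0'] at f2
    have hr := hc.r0_eq
    have h5 : lam 2 * lamT 2 = 1 := by
      apply mul_left_cancel₀ hc.r0_ne
      field_simp at f2
      linear_combination -f1 - lamT 2 * f2
    rw [h5] at hr
    simp at hr
  · have := e1 h.le
    rw [hz 0 h, mul_zero, zero_mul] at this
    exact hc.r0_ne this

/-- The divided differences force the orders to have opposite signs. Written as -(1 + A) and 1 + B,
they satisfy A = (q - 1) B if B > 0 by X and B = (p - 1) A if A > 0 by Y. Since (p - 1)(q - 1) > 1,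
both A and B vanish. -/
theorem Curve.IsLeading.double_point_orders (hc : c.IsLeading lam lamT r0) (hp : 2 ≤ p)
    (hq : 2 ≤ q) (hpq : 1 < (p - 1) * (q - 1)) (hlam : lam q ≠ 0) (hlamT : lamT p ≠ 0)
    {z z' : (LaurentSeries ℂ)ˣ} (hd : c.IsDoublePoint p q z z')
    (hlt : (z : LaurentSeries ℂ).order < (z' : LaurentSeries ℂ).order) :
    (z : LaurentSeries ℂ).order = -1 ∧ (z' : LaurentSeries ℂ).order = 1 := by
  obtain ⟨hne, hX, hY⟩ := isDoublePoint_iff.1 hd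
  have hne' : (z : LaurentSeries ℂ) ≠ z' := fun h => hne (Units.ext h)
  obtain ⟨hz, hz0⟩ := exists_ordGE_coeff_ne_zero z.ne_zero
  obtain ⟨hz', hz0'⟩ := exists_ordGE_coeff_ne_zero z'.ne_zero
  set a := (z : LaurentSeries ℂ).order
  set b := (z' : LaurentSeries ℂ).order
  obtain ⟨iz, iz0⟩ := hz.inv hz0
  obtain ⟨iz', iz0'⟩ := hz'.inv hz0'
  have ha : a < 0 := by
    by_contra hh
    have h0 := hz.mono (show 0 ≤ a by omega)
    have h0' := hz'.mono (show 0 ≤ b by omega)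
    have e1 := coeff_zero_of_edge_eq hp hc.β_ord h0 h0' hne' z.ne_zero z'.ne_zero hY
    rw [hc.R_lead] at e1
    have hz1 : (z' : LaurentSeries ℂ).coeff 0 ≠ 0 := fun h => by
      rw [h, mul_zero] at e1; exact hc.r0_ne e1
    have hb0 : b ≤ 0 := by
      by_contra hb
      exact hz1 (hz' 0 (by omega))
    omega
  have hb : 0 < b := by
    by_contra hh
    have h0 := iz.mono (show 0 ≤ -a by omega)
    have h0' := iz'.mono (show 0 ≤ -b by omega)
    have e2 := coeff_zero_of_edge_eq hq hc.α_ord h0 h0' (fun h => hne' (inv_injective h))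
      (inv_ne_zero z.ne_zero) (inv_ne_zero z'.ne_zero) hX
    rw [coeff_one_zero] at e2
    have hz1 : (z : LaurentSeries ℂ)⁻¹.coeff 0 ≠ 0 := fun h => by
      rw [h, mul_zero, zero_mul] at e2; exact one_ne_zero e2
    exact hz1 (iz 0 (by omega))
  have hlα : (c.α (q - 1)).coeff (((q - 1 : ℕ) : ℤ) - 1) ≠ 0 := by
    rw [hc.α_lead _ (by omega), Nat.sub_add_cancel (by omega)]
    exact mul_ne_zero hlam (pow_ne_zero _ hc.r0_ne)
  have hlβ : (c.β (p - 1)).coeff (((p - 1 : ℕ) : ℤ) - 1) ≠ 0 := by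
    rw [hc.β_lead _ (by omega), Nat.sub_add_cancel (by omega)]
    exact hlamT
  obtain ⟨A, hA⟩ : ∃ A : ℤ, a = -(1 + A) := ⟨-1 - a, by omega⟩
  obtain ⟨B, hB⟩ : ∃ B : ℤ, b = 1 + B := ⟨b - 1, by omega⟩
  rw [hA] at hz hz0 iz iz0
  rw [hB] at hz' hz0' iz' iz0'
  rw [neg_neg] at iz iz0
  obtain ⟨k1, k2⟩ := order_relation_of_edge_eq ordGE_one (by rw [coeff_one_zero]; exact one_ne_zero)
    hc.α_zero hc.α_ord hq hlα (A := A) (B := B) (by omega) (by omega) iz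
    (by rw [iz0]; exact inv_ne_zero hz0) iz' (by rw [iz0']; exact inv_ne_zero hz0') hX
  obtain ⟨k3, k4⟩ := order_relation_of_edge_eq hc.R_ord (by rw [hc.R_lead]; exact hc.r0_ne)
    hc.β_zero hc.β_ord hp hlβ (A := B) (B := A) (by omega) (by omega) hz' hz0' hz hz0 hY.symm
  have hpqZ : (1 : ℤ) < ((p - 1 : ℕ) : ℤ) * ((q - 1 : ℕ) : ℤ) := by exact_mod_cast hpq
  have hA0 : A = 0 := by
    by_contra hne0
    have hApos : 0 < A := by omega
    have e1 := k4 hApos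
    have hBpos : 0 < B := by
      rw [e1]
      have : (0 : ℤ) < ((p - 1 : ℕ) : ℤ) := by omega
      positivity
    have e2 := k2 hBpos
    rw [e1] at e2
    nlinarith
  subst hA0
  have hB0 : B = 0 := by
    rw [mul_zero] at k3
    omega
  subst hB0
  exact ⟨by omega, by omega⟩

/-- The polynomial `∑ lam_k u^{k-1}`. -/
def couplingPoly {S : Type} [CommRing S] (n : ℕ) (lam : ℕ → S) : Polynomial S :=
  ∑ j ∈ Finset.Ico 1 n, Polynomial.C (lam (j + 1)) * Polynomial.X ^ j

theorem eval_couplingPoly (n : ℕ) (lam : ℕ → ℂ) (x : ℂ) :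
    (couplingPoly n lam).eval x = ∑ j ∈ Finset.Ico 1 n, lam (j + 1) * x ^ j := by
  simp [couplingPoly, Polynomial.eval_finsetSum]

theorem eval_derivative_couplingPoly (n : ℕ) (lam : ℕ → ℂ) (x : ℂ) :
    (couplingPoly n lam).derivative.eval x =
      ∑ j ∈ Finset.Ico 1 n, lam (j + 1) * (j * x ^ (j - 1)) := by
  simp [couplingPoly, Polynomial.eval_finsetSum, Polynomial.derivative_X_pow]

/-- These are the lowest orders of the two equations of a double point. Eliminating the second
parameter leaves a root of `returnPoly`. -/
theorem Curve.IsLeading.double_point_leading (hc : c.IsLeading lam lamT r0)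
    {z z' : (LaurentSeries ℂ)ˣ} (hd : c.IsDoublePoint p q z z')
    (hz : (z : LaurentSeries ℂ).order = -1) (hz' : (z' : LaurentSeries ℂ).order = 1) :
    (z : LaurentSeries ℂ).coeff (-1) =
        (couplingPoly q lam).eval (r0 * ((z' : LaurentSeries ℂ).coeff 1)⁻¹) ∧
      r0 * ((z' : LaurentSeries ℂ).coeff 1)⁻¹ =
        (couplingPoly p lamT).eval ((z : LaurentSeries ℂ).coeff (-1)) := by
  obtain ⟨-, hX, hY⟩ := isDoublePoint_iff.1 hd
  obtain ⟨oz, oz0⟩ := exists_ordGE_coeff_ne_zero z.ne_zero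
  obtain ⟨oz', oz0'⟩ := exists_ordGE_coeff_ne_zero z'.ne_zero
  rw [hz] at oz oz0
  rw [hz'] at oz' oz0'
  obtain ⟨iz, iz0⟩ := oz.inv oz0
  obtain ⟨iz', iz0'⟩ := oz'.inv oz0'
  rw [neg_neg] at iz iz0
  constructor
  · have h1 := leading_equation_of_edge_eq ordGE_one hc.α_zero hc.α_ord iz
      (by rw [iz0]; exact inv_ne_zero oz0) iz' (by rw [iz0']; exact inv_ne_zero oz0') hX
    rw [coeff_one_zero, one_mul, iz0, iz0', inv_inv] at h1
    rw [h1, eval_couplingPoly]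
    refine Finset.sum_congr rfl fun j hj => ?_
    rw [Finset.mem_Ico] at hj
    rw [hc.α_lead j hj.1, mul_pow]; ring
  · have h1 := leading_equation_of_edge_eq hc.R_ord hc.β_zero hc.β_ord oz' oz0' oz oz0 hY.symm
    rw [hc.R_lead] at h1
    rw [h1, eval_couplingPoly]
    refine Finset.sum_congr rfl fun j hj => ?_
    rw [Finset.mem_Ico] at hj
    rw [hc.β_lead j hj.1]

end DoublePoints

/-! ### Lifting of the double points -/

section Lifting

open PowerSeries

/-- The difference of the values of `edge` at `t / u` and `v / t`, multiplied by `t`. -/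
def edgeDiff (n : ℕ) (ρ : PowerSeries ℂ) (a : ℕ → PowerSeries ℂ) (u v : PowerSeries ℂ) :
    PowerSeries ℂ :=
  ρ * u + ∑ j ∈ Finset.Ico 1 n, X ^ (2 * j) * (a j * (u⁻¹) ^ j) -
    (X ^ 2 * (ρ * v⁻¹) + ∑ j ∈ Finset.Ico 1 n, a j * v ^ j)

theorem dvd_pow_sub_pow {d u u' : PowerSeries ℂ} (h : d ∣ u - u') (j : ℕ) : d ∣ u ^ j - u' ^ j :=
  h.trans (sub_dvd_pow_sub_pow u u' j)

theorem dvd_inv_sub_inv {d u u' : PowerSeries ℂ} (hu : constantCoeff u ≠ 0)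
    (hu' : constantCoeff u' ≠ 0) (h : d ∣ u - u') : d ∣ u⁻¹ - u'⁻¹ := by
  have h1 := PowerSeries.mul_inv_cancel u hu
  have h2 := PowerSeries.mul_inv_cancel u' hu'
  have : u⁻¹ - u'⁻¹ = -(u⁻¹ * u'⁻¹) * (u - u') := by
    linear_combination u'⁻¹ * h1 - u⁻¹ * h2
  rw [this]
  exact Dvd.dvd.mul_left h _

/-- First-order Taylor expansion at the leading coefficients: modulo one further power of X, only ρ
u and the a_j v^j vary, and linearly with constant coefficients. -/
theorem edgeDiff_congr {n m : ℕ} {ρ : PowerSeries ℂ} {a : ℕ → PowerSeries ℂ}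
    {u v u' v' : PowerSeries ℂ} {v0 : ℂ}
    (hu : constantCoeff u ≠ 0) (hu' : constantCoeff u' ≠ 0)
    (hv0 : v0 ≠ 0) (hv : constantCoeff v = v0) (hv' : constantCoeff v' = v0)
    (h1 : X ^ m ∣ u - u') (h2 : X ^ m ∣ v - v') :
    X ^ (m + 1) ∣ (edgeDiff n ρ a u v - edgeDiff n ρ a u' v') -
      (C (constantCoeff ρ) * (u - u') -
        C (∑ j ∈ Finset.Ico 1 n, constantCoeff (a j) * (j * v0 ^ (j - 1))) * (v - v')) := by
  have e : (edgeDiff n ρ a u v - edgeDiff n ρ a u' v') -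
      (C (constantCoeff ρ) * (u - u') -
        C (∑ j ∈ Finset.Ico 1 n, constantCoeff (a j) * (j * v0 ^ (j - 1))) * (v - v')) =
      (ρ - C (constantCoeff ρ)) * (u - u') +
      ∑ j ∈ Finset.Ico 1 n, X ^ (2 * j) * (a j * ((u⁻¹) ^ j - (u'⁻¹) ^ j)) -
      X ^ 2 * (ρ * (v⁻¹ - v'⁻¹)) -
      ∑ j ∈ Finset.Ico 1 n, (a j * ∑ i ∈ Finset.range j, v ^ i * v' ^ (j - 1 - i) -
        C (constantCoeff (a j) * (j * v0 ^ (j - 1)))) * (v - v') := by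
    have e0 : ∀ j, (a j * ∑ i ∈ Finset.range j, v ^ i * v' ^ (j - 1 - i) -
        C (constantCoeff (a j) * (j * v0 ^ (j - 1)))) * (v - v') =
        a j * v ^ j - a j * v' ^ j - C (constantCoeff (a j) * (j * v0 ^ (j - 1))) * (v - v') := by
      intro j
      rw [sub_mul, mul_assoc, geom_sum₂_mul, mul_sub]
    simp only [e0, mul_sub, Finset.sum_sub_distrib, map_sum, edgeDiff]
    simp only [← Finset.sum_mul]
    ring
  rw [e]
  have hX2 : ∀ k : ℕ, 1 ≤ k → ∀ f : PowerSeries ℂ, X ^ m ∣ f → X ^ (m + 1) ∣ X ^ (2 * k) * f := by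
    intro k hk f hf
    rw [add_comm, pow_add]
    exact mul_dvd_mul (pow_dvd_pow _ (by omega)) hf
  refine dvd_sub (dvd_sub (dvd_add ?_ (Finset.dvd_sum fun j hj => ?_)) ?_)
    (Finset.dvd_sum fun j hj => ?_)
  · rw [add_comm, pow_add, pow_one]
    refine mul_dvd_mul ?_ h1
    rw [X_dvd_iff]; simp
  · rw [Finset.mem_Ico] at hj
    exact hX2 j hj.1 _ (Dvd.dvd.mul_left (dvd_pow_sub_pow (dvd_inv_sub_inv hu hu' h1) j) _)
  · exact hX2 1 le_rfl _ (Dvd.dvd.mul_left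
      (dvd_inv_sub_inv (hv ▸ hv0) (hv' ▸ hv0) h2) _)
  · rw [add_comm, pow_add, pow_one]
    refine mul_dvd_mul ?_ h2
    rw [X_dvd_iff]
    simp only [map_sub, map_mul, map_sum, map_pow, hv, hv', constantCoeff_C]
    have : ∀ i ∈ Finset.range j, v0 ^ i * v0 ^ (j - 1 - i) = v0 ^ (j - 1) := by
      intro i hi
      rw [Finset.mem_range] at hi
      rw [← pow_add]; congr 1; omega
    rw [Finset.sum_congr rfl this]
    simp

theorem constantCoeff_edgeDiff (n : ℕ) (ρ : PowerSeries ℂ) (a : ℕ → PowerSeries ℂ)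
    (u v : PowerSeries ℂ) : constantCoeff (edgeDiff n ρ a u v) =
      constantCoeff ρ * constantCoeff u -
        ∑ j ∈ Finset.Ico 1 n, constantCoeff (a j) * constantCoeff v ^ j := by
  simp only [edgeDiff, map_sub, map_add, map_mul, map_sum, map_pow, constantCoeff_X]
  rw [Finset.sum_eq_zero]
  · simp
  · intro j hj
    rw [Finset.mem_Ico] at hj
    rw [zero_pow (by omega), zero_mul]

/-- A simple solution of the leading equations lifts uniquely to a solution in power series. -/
theorem exists_unique_lift {p q : ℕ} {R : PowerSeries ℂ} {a b : ℕ → PowerSeries ℂ} {x0 v0 : ℂ}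
    (hx0 : x0 ≠ 0) (hv0 : v0 ≠ 0)
    (h1 : x0 = ∑ j ∈ Finset.Ico 1 q, constantCoeff (a j) * v0 ^ j)
    (h2 : constantCoeff R * v0 = ∑ j ∈ Finset.Ico 1 p, constantCoeff (b j) * x0 ^ j)
    (hdet : constantCoeff R -
      (∑ j ∈ Finset.Ico 1 q, constantCoeff (a j) * (j * v0 ^ (j - 1))) *
      (∑ j ∈ Finset.Ico 1 p, constantCoeff (b j) * (j * x0 ^ (j - 1))) ≠ 0) :
    ∃ x v : PowerSeries ℂ, (constantCoeff x = x0 ∧ constantCoeff v = v0 ∧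
      edgeDiff q 1 a x v = 0 ∧ edgeDiff p R b v x = 0) ∧
      ∀ x' v' : PowerSeries ℂ, (constantCoeff x' = x0 ∧ constantCoeff v' = v0 ∧
        edgeDiff q 1 a x' v' = 0 ∧ edgeDiff p R b v' x' = 0) → x' = x ∧ v' = v := by
  set W := ∑ j ∈ Finset.Ico 1 q, constantCoeff (a j) * (j * v0 ^ (j - 1)) with hW
  set V := ∑ j ∈ Finset.Ico 1 p, constantCoeff (b j) * (j * x0 ^ (j - 1)) with hV
  set r := constantCoeff R with hr
  set Δ := r - W * V with hΔ
  have hΔ1 : (C Δ⁻¹ : PowerSeries ℂ) * (C r - C W * C V) = 1 := by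
    rw [← map_mul, ← map_sub, ← map_mul, ← hΔ, inv_mul_cancel₀ hdet, map_one]
  set F1 : (Bool → PowerSeries ℂ) → PowerSeries ℂ := fun f => edgeDiff q 1 a (f true) (f false)
  set F2 : (Bool → PowerSeries ℂ) → PowerSeries ℂ := fun f => edgeDiff p R b (f false) (f true)
  -- Newton iteration with frozen Jacobian. At the leading coefficients the Jacobian matrix is (1,
  -- -W; -V, r), of determinant Δ, and Φ subtracts its inverse applied to (F1, F2).
  set Φ : (Bool → PowerSeries ℂ) → Bool → PowerSeries ℂ := fun f i =>
    if i then f true - C Δ⁻¹ * (C r * F1 f + C W * F2 f) else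
      f false - C Δ⁻¹ * (C V * F1 f + F2 f) with hΦ
  set f0 : Bool → PowerSeries ℂ := fun i => if i then C x0 else C v0 with hf0
  set S : Set (Bool → PowerSeries ℂ) := {f | ∀ i, X ^ 1 ∣ f i - f0 i} with hS
  have hmem : ∀ f, f ∈ S ↔ constantCoeff (f true) = x0 ∧ constantCoeff (f false) = v0 := by
    intro f
    rw [hS, Set.mem_ofPred_eq, Bool.forall_bool, pow_one, X_dvd_iff, X_dvd_iff, map_sub, map_sub,
      sub_eq_zero, sub_eq_zero]
    simp [hf0, and_comm]
  have hF1 : ∀ f ∈ S, constantCoeff (F1 f) = 0 := by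
    intro f hf
    obtain ⟨e1, e2⟩ := (hmem f).1 hf
    rw [constantCoeff_edgeDiff, e1, e2, ← h1]; simp
  have hF2 : ∀ f ∈ S, constantCoeff (F2 f) = 0 := by
    intro f hf
    obtain ⟨e1, e2⟩ := (hmem f).1 hf
    rw [constantCoeff_edgeDiff, e1, e2, ← h2]; simp [hr]
  have hSΦ : ∀ f ∈ S, Φ f ∈ S := by
    intro f hf
    obtain ⟨e1, e2⟩ := (hmem f).1 hf
    rw [hmem]
    simp [hΦ, hF1 f hf, hF2 f hf, e1, e2]
  have hcon : ∀ n ≥ 1, ∀ f ∈ S, ∀ f' ∈ S, (∀ i, (X : PowerSeries ℂ) ^ n ∣ f i - f' i) →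
      ∀ i, (X : PowerSeries ℂ) ^ (n + 1) ∣ Φ f i - Φ f' i := by
    intro n hn f hf f' hf' hff i
    obtain ⟨e1, e2⟩ := (hmem f).1 hf
    obtain ⟨e1', e2'⟩ := (hmem f').1 hf'
    have k1 := edgeDiff_congr (n := q) (ρ := 1) (a := a) (u := f true) (u' := f' true)
      (v := f false) (v' := f' false) (by rw [e1]; exact hx0) (by rw [e1']; exact hx0) hv0 e2 e2'
      (hff true) (hff false)
    have k2 := edgeDiff_congr (n := p) (ρ := R) (a := b) (u := f false) (u' := f' false)
      (v := f true) (v' := f' true) (by rw [e2]; exact hv0) (by rw [e2']; exact hv0) hx0 e1 e1'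
      (hff false) (hff true)
    simp only [← hW, ← hV, ← hr, map_one, one_mul] at k1 k2
    cases i
    · have e : Φ f false - Φ f' false = -C Δ⁻¹ * (C V * ((F1 f - F1 f') -
          ((f true - f' true) - C W * (f false - f' false))) +
          ((F2 f - F2 f') - (C r * (f false - f' false) - C V * (f true - f' true)))) := by
        simp only [hΦ, Bool.false_eq_true, if_false]
        linear_combination (-(f false - f' false)) * hΔ1
      rw [e]
      exact Dvd.dvd.mul_left (dvd_add (Dvd.dvd.mul_left k1 _) k2) _
    · have e : Φ f true - Φ f' true = -C Δ⁻¹ * (C r * ((F1 f - F1 f') -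
          ((f true - f' true) - C W * (f false - f' false))) +
          C W * ((F2 f - F2 f') - (C r * (f false - f' false) - C V * (f true - f' true)))) := by
        simp only [hΦ, if_true]
        linear_combination (-(f true - f' true)) * hΔ1
      rw [e]
      exact Dvd.dvd.mul_left (dvd_add (Dvd.dvd.mul_left k1 _) (Dvd.dvd.mul_left k2 _)) _
  have hfix : ∀ f, Φ f = f ↔ F1 f = 0 ∧ F2 f = 0 := by
    intro f
    constructor
    · intro hf
      have g1 := congrFun hf true
      have g2 := congrFun hf false
      simp only [hΦ, if_true, Bool.false_eq_true, if_false] at g1 g2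
      have hC : (C Δ⁻¹ : PowerSeries ℂ) ≠ 0 := left_ne_zero_of_mul_eq_one hΔ1
      have g3 : C r * F1 f + C W * F2 f = 0 :=
        (mul_eq_zero.1 (by linear_combination -g1 : C Δ⁻¹ * (C r * F1 f + C W * F2 f) = 0)).resolve_left hC
      have g4 : C V * F1 f + F2 f = 0 :=
        (mul_eq_zero.1 (by linear_combination -g2 : C Δ⁻¹ * (C V * F1 f + F2 f) = 0)).resolve_left hC
      have g5 : F1 f = 0 := by
        linear_combination (-F1 f) * hΔ1 + C Δ⁻¹ * g3 - C Δ⁻¹ * C W * g4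
      rw [g5, mul_zero, zero_add] at g4
      exact ⟨g5, g4⟩
    · rintro ⟨g1, g2⟩
      funext i
      cases i <;> simp [hΦ, g1, g2]
  obtain ⟨f, hfS, hff⟩ := exists_fixedPoint (n0 := 1) (f0 := f0) (fun f => Iff.rfl) hSΦ hcon
  obtain ⟨e1, e2⟩ := (hmem f).1 hfS
  refine ⟨f true, f false, ⟨e1, e2, ((hfix f).1 hff).1, ((hfix f).1 hff).2⟩, ?_⟩
  rintro x' v' ⟨k1, k2, k3, k4⟩
  set f' : Bool → PowerSeries ℂ := fun i => if i then x' else v' with hf'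
  have hf'S : f' ∈ S := (hmem f').2 ⟨k1, k2⟩
  have := eq_of_fixedPoint hcon hf'S hfS (fun i => by
    have := dvd_sub (hf'S i) (hfS i)
    rwa [sub_sub_sub_cancel_right] at this) ((hfix f').2 ⟨k3, k4⟩) hff
  exact ⟨congrFun this true, congrFun this false⟩

end Lifting

end Mobile

end

noncomputable section

namespace Mobile

/-! ### Genericity -/

section Genericity

open Polynomial

variable {S S' : Type} [CommRing S] [CommRing S']

theorem couplingPoly_map (f : S →+* S') (n : ℕ) (lam : ℕ → S) :
    (couplingPoly n lam).map f = couplingPoly n (fun k => f (lam k)) := by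
  simp [couplingPoly, Polynomial.map_sum]

/-- The polynomial `W(V(x)) - x`, whose nonzero roots govern the double points. -/
def returnPoly (p q : ℕ) (lam lamT : ℕ → S) : S[X] :=
  (couplingPoly q lam).comp (couplingPoly p lamT) - X

theorem returnPoly_map (f : S →+* S') (p q : ℕ) (lam lamT : ℕ → S) :
    (returnPoly p q lam lamT).map f =
      returnPoly p q (fun k => f (lam k)) (fun k => f (lamT k)) := by
  simp [returnPoly, Polynomial.map_comp, couplingPoly_map]

theorem natDegree_couplingPoly {n : ℕ} (hn : 2 ≤ n) {lam : ℕ → S} (h : lam n ≠ 0) :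
    (couplingPoly n lam).natDegree = n - 1 := by
  apply natDegree_eq_of_le_of_coeff_ne_zero
  · refine natDegree_sum_le_of_forall_le _ _ fun j hj => ?_
    rw [Finset.mem_Ico] at hj
    exact (natDegree_C_mul_X_pow_le _ _).trans (by omega)
  · rw [couplingPoly, finsetSum_coeff, Finset.sum_eq_single (n - 1)]
    · rw [coeff_C_mul_X_pow, if_pos rfl, Nat.sub_add_cancel (by omega)]
      exact h
    · intro j _ hj
      rw [coeff_C_mul_X_pow, if_neg hj.symm]
    · intro hh
      exact absurd (Finset.mem_Ico.2 ⟨by omega, by omega⟩) hh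

theorem natDegree_returnPoly {p q : ℕ} (hp : 2 ≤ p) (hq : 2 ≤ q) (hpq : 1 < (p - 1) * (q - 1))
    {lam lamT : ℕ → ℂ} (h : lam q ≠ 0) (hT : lamT p ≠ 0) :
    (returnPoly p q lam lamT).natDegree = (p - 1) * (q - 1) := by
  have h1 : ((couplingPoly q lam).comp (couplingPoly p lamT)).natDegree = (p - 1) * (q - 1) := by
    rw [natDegree_comp, natDegree_couplingPoly hq h, natDegree_couplingPoly hp hT, mul_comm]
  rw [returnPoly, natDegree_sub_eq_left_of_natDegree_lt (by rw [h1, natDegree_X]; exact hpq), h1]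

theorem couplingPoly_single {n : ℕ} (hn : 2 ≤ n) :
    couplingPoly n (fun k => if k = n then (1 : S) else 0) = X ^ (n - 1) := by
  rw [couplingPoly, Finset.sum_eq_single (n - 1)]
  · rw [if_pos (by omega), map_one, one_mul]
  · intro j hj hne
    rw [Finset.mem_Ico] at hj
    rw [if_neg (by omega), map_zero, zero_mul]
  · intro hh
    exact absurd (Finset.mem_Ico.2 ⟨by omega, by omega⟩) hh

theorem separable_X_pow_sub_X {n : ℕ} (hn : 2 ≤ n) : (X ^ n - X : ℂ[X]).Separable := by
  obtain ⟨k, rfl⟩ : ∃ k, n = k + 1 := ⟨n - 1, by omega⟩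
  have hk : ((k : ℕ) : ℂ) ≠ 0 := Nat.cast_ne_zero.2 (by omega)
  -- Bézout coefficients that eliminate X^(2k) and X^k between X^(k+1) - X and (k+1) X^k - 1.
  refine ⟨C (-((k : ℂ) + 1) ^ 2 / k) * X ^ (k - 1), C ((k + 1) / k : ℂ) * X ^ k - 1, ?_⟩
  obtain ⟨m, rfl⟩ : ∃ m, k = m + 1 := ⟨k - 1, by omega⟩
  have e : (C ((m + 1 : ℕ) : ℂ)⁻¹ : ℂ[X]) * C ((m + 1 : ℕ) : ℂ) = 1 := by
    rw [← C_mul, inv_mul_cancel₀ hk, C_1]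
  simp only [div_eq_mul_inv, C_mul, C_neg, C_pow, C_add, C_1, derivative_sub, derivative_X_pow,
    derivative_X, Nat.add_sub_cancel]
  push_cast at *
  simp only [C_add, C_1] at *
  linear_combination ((C (m : ℂ) + 2) * X ^ (m + 1)) * e

/-- D is lam_q lamT_p times the resultant of W(V(x)) - x and its derivative. Using the formal
degrees M and M - 1 makes the resultant commute with specialisation of the couplings. -/
theorem exists_generic_polynomial {p q : ℕ} (hp : 2 ≤ p) (hq : 2 ≤ q)
    (hpq : 1 < (p - 1) * (q - 1)) :
    ∃ D : MvPolynomial (Finset.Icc 2 q ⊕ Finset.Icc 2 p) ℂ, D ≠ 0 ∧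
      ∀ (lam : Finset.Icc 2 q → ℂ) (lamT : Finset.Icc 2 p → ℂ),
        MvPolynomial.eval (Sum.elim lam lamT) D ≠ 0 → extend lam q ≠ 0 ∧ extend lamT p ≠ 0 ∧
          (returnPoly p q (extend lam) (extend lamT)).Separable := by
  set g : ℕ → MvPolynomial (Finset.Icc 2 q ⊕ Finset.Icc 2 p) ℂ := fun k =>
    if hk : k ∈ Finset.Icc 2 q then MvPolynomial.X (Sum.inl ⟨k, hk⟩) else 0 with hg
  set gT : ℕ → MvPolynomial (Finset.Icc 2 q ⊕ Finset.Icc 2 p) ℂ := fun k =>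
    if hk : k ∈ Finset.Icc 2 p then MvPolynomial.X (Sum.inr ⟨k, hk⟩) else 0 with hgT
  set M := (p - 1) * (q - 1) with hM
  set r := returnPoly p q g gT with hr
  have hev : ∀ (lam : Finset.Icc 2 q → ℂ) (lamT : Finset.Icc 2 p → ℂ),
      (fun k => MvPolynomial.eval (Sum.elim lam lamT) (g k)) = extend lam ∧
      (fun k => MvPolynomial.eval (Sum.elim lam lamT) (gT k)) = extend lamT := by
    intro lam lamT
    constructor <;> funext k
    · simp only [hg, extend]; split <;> simp
    · simp only [hgT, extend]; split <;> simp
  have hD : ∀ (lam : Finset.Icc 2 q → ℂ) (lamT : Finset.Icc 2 p → ℂ),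
      MvPolynomial.eval (Sum.elim lam lamT)
        (g q * gT p * resultant r (derivative r) M (M - 1)) = extend lam q * extend lamT p *
        resultant (returnPoly p q (extend lam) (extend lamT))
          (derivative (returnPoly p q (extend lam) (extend lamT))) M (M - 1) := by
    intro lam lamT
    obtain ⟨e1, e2⟩ := hev lam lamT
    rw [map_mul, map_mul, ← resultant_map_map, ← derivative_map, hr, returnPoly_map, e1, e2,
      ← congrFun e1 q, ← congrFun e2 p]
  have hsep : ∀ lam lamT : ℕ → ℂ, lam q ≠ 0 → lamT p ≠ 0 →
      (resultant (returnPoly p q lam lamT) (derivative (returnPoly p q lam lamT)) M (M - 1) ≠ 0 ↔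
        (returnPoly p q lam lamT).Separable) := by
    intro lam lamT h1 h2
    have d1 := natDegree_returnPoly hp hq hpq h1 h2
    have d2 : (derivative (returnPoly p q lam lamT)).natDegree = M - 1 := by
      rw [natDegree_derivative, d1]
    rw [← hM] at d1
    have h3 := resultant_eq_zero_iff (f := returnPoly p q lam lamT)
      (g := derivative (returnPoly p q lam lamT))
    rw [d1, d2] at h3
    rw [Ne, h3, Separable]
    constructor
    · intro h
      by_contra hh
      exact h ⟨Or.inl (fun h0 => by rw [h0, natDegree_zero] at d1; omega), hh⟩
    · rintro h ⟨-, hh⟩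
      exact hh h
  refine ⟨g q * gT p * resultant r (derivative r) M (M - 1), ?_, ?_⟩
  -- When lam_q and lamT_p are 1 and all other couplings 0, the polynomial becomes X^M - X, which is
  -- separable; so D is not zero.
  · intro h0
    have h1 := hD (fun k => if (k : ℕ) = q then 1 else 0) (fun k => if (k : ℕ) = p then 1 else 0)
    have e1 : ∀ n, 2 ≤ n → extend (r := n) (fun k => if (k : ℕ) = n then 1 else 0) =
        fun k => if k = n then 1 else 0 := by
      intro n hn
      funext k
      rw [extend]
      split_ifs with h1 h2 <;> simp_all
    rw [h0, map_zero, e1 q hq, e1 p hp] at h1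
    simp only [if_true, one_mul] at h1
    refine (hsep _ _ ?_ ?_).2 ?_ h1.symm
    · simp
    · simp
    · rw [returnPoly, couplingPoly_single hq, couplingPoly_single hp, X_pow_comp, ← pow_mul]
      exact separable_X_pow_sub_X hpq
  · intro lam lamT h
    rw [hD] at h
    have h1 := left_ne_zero_of_mul (left_ne_zero_of_mul h)
    have h2 := right_ne_zero_of_mul (left_ne_zero_of_mul h)
    exact ⟨h1, h2, (hsep _ _ h1 h2).1 (right_ne_zero_of_mul h)⟩

variable {p q : ℕ} {lam lamT : ℕ → ℂ}

theorem eval_returnPoly (p q : ℕ) (lam lamT : ℕ → ℂ) (x : ℂ) :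
    (returnPoly p q lam lamT).eval x =
      (couplingPoly q lam).eval ((couplingPoly p lamT).eval x) - x := by
  simp [returnPoly, eval_comp]

theorem eval_derivative_returnPoly (p q : ℕ) (lam lamT : ℕ → ℂ) (x : ℂ) :
    (returnPoly p q lam lamT).derivative.eval x =
      (couplingPoly q lam).derivative.eval ((couplingPoly p lamT).eval x) *
        (couplingPoly p lamT).derivative.eval x - 1 := by
  simp [returnPoly, derivative_comp, eval_comp, mul_comm]

theorem eval_couplingPoly_zero (n : ℕ) (lam : ℕ → ℂ) : (couplingPoly n lam).eval 0 = 0 := by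
  rw [eval_couplingPoly]
  refine Finset.sum_eq_zero fun j hj => ?_
  rw [Finset.mem_Ico] at hj
  rw [zero_pow (by omega), mul_zero]

theorem eval_derivative_couplingPoly_zero {n : ℕ} (hn : 2 ≤ n) (lam : ℕ → ℂ) :
    (couplingPoly n lam).derivative.eval 0 = lam 2 := by
  rw [eval_derivative_couplingPoly, Finset.sum_eq_single 1]
  · simp
  · intro j hj h1
    rw [Finset.mem_Ico] at hj
    rw [zero_pow (by omega), mul_zero, mul_zero]
  · intro hh
    exact absurd (Finset.mem_Ico.2 ⟨by omega, by omega⟩) hh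

theorem eval_derivative_ne_zero_of_separable {f : ℂ[X]} (hf : f.Separable) {x : ℂ}
    (hx : f.eval x = 0) : f.derivative.eval x ≠ 0 := by
  obtain ⟨a, b, h⟩ := hf
  intro h0
  have := congrArg (eval x) h
  simp [hx, h0] at this

/-- 0 is always a root of W(V(x)) - x, and the derivative there is lam_2 lamT_2 - 1. -/
theorem mul_ne_one_of_separable (hp : 2 ≤ p) (hq : 2 ≤ q)
    (hs : (returnPoly p q lam lamT).Separable) : lam 2 * lamT 2 ≠ 1 := by
  have h0 : (returnPoly p q lam lamT).eval 0 = 0 := by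
    rw [eval_returnPoly, eval_couplingPoly_zero, eval_couplingPoly_zero, sub_zero]
  have h1 := eval_derivative_ne_zero_of_separable hs h0
  rw [eval_derivative_returnPoly, eval_couplingPoly_zero, eval_derivative_couplingPoly_zero hq,
    eval_derivative_couplingPoly_zero hp] at h1
  exact sub_ne_zero.1 h1

theorem exists_nonzero_roots (hp : 2 ≤ p) (hq : 2 ≤ q) (hpq : 1 < (p - 1) * (q - 1))
    (h : lam q ≠ 0) (hT : lamT p ≠ 0) (hs : (returnPoly p q lam lamT).Separable) :
    ∃ x : Fin ((p - 1) * (q - 1) - 1) → ℂ, Function.Injective x ∧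
      (∀ a, x a ≠ 0 ∧ (returnPoly p q lam lamT).eval (x a) = 0) ∧
      ∀ y, y ≠ 0 → (returnPoly p q lam lamT).eval y = 0 → ∃ a, y = x a := by
  have hd := natDegree_returnPoly hp hq hpq h hT
  set f := returnPoly p q lam lamT with hf
  have hf0 : f ≠ 0 := fun h0 => by rw [h0, natDegree_zero] at hd; omega
  have h0 : f.eval 0 = 0 := by
    rw [eval_returnPoly, eval_couplingPoly_zero, eval_couplingPoly_zero, sub_zero]
  have hcard : (f.roots.toFinset.erase 0).card = (p - 1) * (q - 1) - 1 := by
    rw [Finset.card_erase_of_mem (by simp [hf0, h0]),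
      Multiset.toFinset_card_of_nodup (nodup_roots hs), ← hd,
      ← (IsAlgClosed.splits f).natDegree_eq_card_roots]
  set e := (f.roots.toFinset.erase 0).equivFinOfCardEq hcard
  refine ⟨fun a => e.symm a, fun a b hab => e.symm.injective (Subtype.ext hab), fun a => ?_,
    fun y hy hy0 => ⟨e ⟨y, by simp [hf0, hy, hy0]⟩, by simp⟩⟩
  have := (e.symm a).2
  simp only [Finset.mem_erase, Multiset.mem_toFinset, mem_roots hf0, IsRoot.def] at this
  exact this

end Genericity

end Mobile

end

noncomputable section

namespace Mobile

/-! ### The list of double points -/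

section DoublePointList

open PowerSeries

theorem toLaurent_X_ne_zero : toLaurent (X : PowerSeries ℂ) ≠ 0 := by
  rw [Ne, map_eq_zero_iff _ toLaurent_injective]
  exact X_ne_zero

theorem toLaurent_X_pow (n : ℕ) :
    toLaurent ((X : PowerSeries ℂ) ^ n) = HahnSeries.single (n : ℤ) (1 : ℂ) :=
  HahnSeries.ofPowerSeries_X_pow n

theorem toLaurent_inv {u : PowerSeries ℂ} (hu : constantCoeff u ≠ 0) :
    toLaurent u⁻¹ = (toLaurent u)⁻¹ :=
  eq_inv_of_mul_eq_one_left (by rw [← map_mul, PowerSeries.inv_mul_cancel u hu, map_one])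

theorem toLaurent_coeff_zero (u : PowerSeries ℂ) : (toLaurent u).coeff 0 = constantCoeff u := by
  have := coeff_toLaurent u 0
  rwa [Nat.cast_zero, coeff_zero_eq_constantCoeff] at this

theorem exists_eq_X_pow_mul {f : PowerSeries ℂ} {n : ℕ} (hf : OrdGE n (toLaurent f)) :
    ∃ a : PowerSeries ℂ, f = X ^ n * a ∧ constantCoeff a = (toLaurent f).coeff n := by
  have h1 : (X : PowerSeries ℂ) ^ n ∣ f := by
    rw [X_pow_dvd_iff]
    intro m hm
    rw [← coeff_toLaurent]
    exact hf m (by exact_mod_cast hm)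
  obtain ⟨a, rfl⟩ := h1
  refine ⟨a, rfl, ?_⟩
  rw [coeff_toLaurent, coeff_X_pow_mul', if_pos le_rfl, Nat.sub_self, coeff_zero_eq_constantCoeff]

/-- The factors t^(j-1) of the coefficients compensate the pole of v / t, so that one multiplication
by t makes everything integral; c 0 cancels in the difference. -/
theorem mul_edge_sub_edge {n : ℕ} {ρ : PowerSeries ℂ} {c a : ℕ → PowerSeries ℂ}
    (hn : 1 ≤ n) (hc : ∀ j, 1 ≤ j → c j = X ^ (j - 1) * a j) {u v : PowerSeries ℂ}
    (hu : constantCoeff u ≠ 0) (hv : constantCoeff v ≠ 0) :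
    toLaurent X * (edge n (toLaurent ρ) (fun j => toLaurent (c j))
        (toLaurent X * (toLaurent u)⁻¹) -
      edge n (toLaurent ρ) (fun j => toLaurent (c j)) (toLaurent v * (toLaurent X)⁻¹)) =
    toLaurent (edgeDiff n ρ a u v) := by
  have ht := toLaurent_X_ne_zero
  have hu0 : toLaurent u ≠ 0 := fun h => hu (by rw [← toLaurent_coeff_zero, h]; simp)
  have hv0 : toLaurent v ≠ 0 := fun h => hv (by rw [← toLaurent_coeff_zero, h]; simp)
  simp only [edge, edgeDiff, Finset.range_eq_Ico, Finset.sum_eq_sum_Ico_succ_bot hn, pow_zero,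
    mul_one, map_sub, map_add, map_mul, map_sum, map_pow, toLaurent_inv hu, toLaurent_inv hv]
  set t := toLaurent X
  set U := toLaurent u
  set V := toLaurent v
  have e1 : ∀ j ∈ Finset.Ico (0 + 1) n, toLaurent (c j) * (t * U⁻¹) ^ j =
      t⁻¹ * (t ^ (2 * j) * (toLaurent (a j) * U⁻¹ ^ j)) := by
    intro j hj
    rw [Finset.mem_Ico] at hj
    obtain ⟨k, rfl⟩ : ∃ k, j = k + 1 := ⟨j - 1, by omega⟩
    rw [hc _ (by omega), map_mul, map_pow, Nat.add_sub_cancel]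
    change t ^ k * _ * _ = _
    field_simp
    ring
  have e2 : ∀ j ∈ Finset.Ico (0 + 1) n, toLaurent (c j) * (V * t⁻¹) ^ j =
      t⁻¹ * (toLaurent (a j) * V ^ j) := by
    intro j hj
    rw [Finset.mem_Ico] at hj
    obtain ⟨k, rfl⟩ : ∃ k, j = k + 1 := ⟨j - 1, by omega⟩
    rw [hc _ (by omega), map_mul, map_pow, Nat.add_sub_cancel]
    change t ^ k * _ * _ = _
    rw [mul_pow, inv_pow]
    field_simp
    ring
  rw [Finset.sum_congr rfl e1, Finset.sum_congr rfl e2, ← Finset.mul_sum, ← Finset.mul_sum]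
  field_simp
  ring

variable {p q : ℕ} {lam : Finset.Icc 2 q → ℂ} {lamT : Finset.Icc 2 p → ℂ}
  {c : Curve (PowerSeries ℂ)}

/-- The point with local parameter `x` near infinity. -/
def farPoint (x : PowerSeries ℂ) : LaurentSeries ℂ := toLaurent x * (toLaurent X)⁻¹

/-- The point with local parameter `v` near zero. -/
def nearPoint (v : PowerSeries ℂ) : LaurentSeries ℂ := toLaurent X * (toLaurent v)⁻¹

theorem farPoint_spec {x : PowerSeries ℂ} :
    OrdGE (-1) (farPoint x) ∧ (farPoint x).coeff (-1) = constantCoeff x := by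
  have h1 : (toLaurent X : LaurentSeries ℂ)⁻¹ = HahnSeries.single (-1 : ℤ) (1 : ℂ) := by
    have := toLaurent_X_pow 1
    rw [pow_one, Nat.cast_one] at this
    rw [this, HahnSeries.inv_single, inv_one]
  have h2 := ordGE_single (-1) (1 : ℂ)
  rw [farPoint, h1]
  refine ⟨by simpa using (ordGE_toLaurent x).mul h2, ?_⟩
  have := coeff_mul_of_ordGE (ordGE_toLaurent x) h2
  rw [zero_add, HahnSeries.coeff_single_same, mul_one, toLaurent_coeff_zero] at this
  exact this

theorem nearPoint_spec {v : PowerSeries ℂ} (hv : constantCoeff v ≠ 0) :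
    OrdGE 1 (nearPoint v) ∧ (nearPoint v).coeff 1 = (constantCoeff v)⁻¹ := by
  have h1 : (toLaurent X : LaurentSeries ℂ) = HahnSeries.single (1 : ℤ) (1 : ℂ) := by
    have := toLaurent_X_pow 1
    rwa [pow_one, Nat.cast_one] at this
  have h2 := ordGE_single 1 (1 : ℂ)
  rw [nearPoint, h1, ← toLaurent_inv hv]
  refine ⟨by simpa using h2.mul (ordGE_toLaurent v⁻¹), ?_⟩
  have := coeff_mul_of_ordGE h2 (ordGE_toLaurent v⁻¹)
  rw [add_zero, HahnSeries.coeff_single_same, one_mul, toLaurent_coeff_zero,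
    constantCoeff_inv] at this
  exact this

theorem farPoint_order {x : PowerSeries ℂ} (hx : constantCoeff x ≠ 0) :
    (farPoint x).order = -1 :=
  order_eq_of_ordGE farPoint_spec.1 (by rw [farPoint_spec.2]; exact hx)

theorem nearPoint_order {v : PowerSeries ℂ} (hv : constantCoeff v ≠ 0) :
    (nearPoint v).order = 1 :=
  order_eq_of_ordGE (nearPoint_spec hv).1 (by rw [(nearPoint_spec hv).2]; exact inv_ne_zero hv)

theorem exists_farPoint {z : (LaurentSeries ℂ)ˣ} (hz : (z : LaurentSeries ℂ).order = -1) :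
    ∃ x, farPoint x = z ∧ constantCoeff x ≠ 0 := by
  obtain ⟨oz, oz0⟩ := exists_ordGE_coeff_ne_zero z.ne_zero
  rw [hz] at oz oz0
  have h2 := oz.mul (ordGE_toLaurent X |>.mono le_rfl)
  have h1 : (toLaurent X : LaurentSeries ℂ) = HahnSeries.single (1 : ℤ) (1 : ℂ) := by
    have := toLaurent_X_pow 1
    rwa [pow_one, Nat.cast_one] at this
  have h3 := oz.mul (ordGE_single 1 (1 : ℂ))
  rw [← h1, neg_add_cancel] at h3
  obtain ⟨x, hx⟩ := exists_toLaurent_eq_of_ordGE h3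
  have h4 : farPoint x = z := by
    rw [farPoint, hx, mul_assoc, mul_inv_cancel₀ toLaurent_X_ne_zero, mul_one]
  exact ⟨x, h4, by rwa [← farPoint_spec.2, h4]⟩

theorem exists_nearPoint {z : (LaurentSeries ℂ)ˣ} (hz : (z : LaurentSeries ℂ).order = 1) :
    ∃ v, nearPoint v = z ∧ constantCoeff v ≠ 0 := by
  have h1 : ((z⁻¹ : (LaurentSeries ℂ)ˣ) : LaurentSeries ℂ).order = -1 := by
    obtain ⟨oz, oz0⟩ := exists_ordGE_coeff_ne_zero z.ne_zero
    rw [hz] at oz oz0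
    obtain ⟨iz, iz0⟩ := oz.inv oz0
    rw [Units.val_inv_eq_inv_val]
    exact order_eq_of_ordGE iz (by rw [iz0]; exact inv_ne_zero oz0)
  obtain ⟨v, hv, hv0⟩ := exists_farPoint h1
  refine ⟨v, ?_, hv0⟩
  rw [Units.val_inv_eq_inv_val] at hv
  rw [← inv_inv (z : LaurentSeries ℂ), ← hv, nearPoint, farPoint, mul_inv, inv_inv, mul_comm]

/-- Reduced coefficients of the curve, in which all powers of the series variable are removed. -/
structure IsReduced (c : Curve (PowerSeries ℂ)) (lam lamT : ℕ → ℂ) (r0 : ℂ)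
    (a b : ℕ → PowerSeries ℂ) : Prop where
  α_eq : ∀ j, 1 ≤ j → c.α j = X ^ (j - 1) * a j
  β_eq : ∀ j, 1 ≤ j → c.β j = X ^ (j - 1) * b j
  α_lead : ∀ j, 1 ≤ j → constantCoeff (a j) = lam (j + 1) * r0 ^ j
  β_lead : ∀ j, 1 ≤ j → constantCoeff (b j) = lamT (j + 1)
  R_lead : constantCoeff c.R = r0
  r0_ne : r0 ≠ 0

theorem Curve.IsLeading.exists_isReduced {lam lamT : ℕ → ℂ} {r0 : ℂ}
    (hc : (c.map toLaurent).IsLeading lam lamT r0) : ∃ a b, IsReduced c lam lamT r0 a b := by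
  have hα : ∀ j : ℕ, ∃ a : PowerSeries ℂ, 1 ≤ j → c.α j = PowerSeries.X ^ (j - 1) * a ∧
      constantCoeff a = lam (j + 1) * r0 ^ j := by
    intro j
    by_cases hj : 1 ≤ j
    · have h1 := hc.α_ord j hj
      have h2 := hc.α_lead j hj
      rw [show (j : ℤ) - 1 = ((j - 1 : ℕ) : ℤ) by omega] at h1 h2
      obtain ⟨a, ha, ha'⟩ := exists_eq_X_pow_mul h1
      exact ⟨a, fun _ => ⟨ha, ha'.trans h2⟩⟩
    · exact ⟨0, fun h => absurd h hj⟩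
  have hβ : ∀ j : ℕ, ∃ b : PowerSeries ℂ, 1 ≤ j → c.β j = PowerSeries.X ^ (j - 1) * b ∧
      constantCoeff b = lamT (j + 1) := by
    intro j
    by_cases hj : 1 ≤ j
    · have h1 := hc.β_ord j hj
      have h2 := hc.β_lead j hj
      rw [show (j : ℤ) - 1 = ((j - 1 : ℕ) : ℤ) by omega] at h1 h2
      obtain ⟨a, ha, ha'⟩ := exists_eq_X_pow_mul h1
      exact ⟨a, fun _ => ⟨ha, ha'.trans h2⟩⟩
    · exact ⟨0, fun h => absurd h hj⟩
  choose a ha using hα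
  choose b hb using hβ
  refine ⟨a, b, fun j hj => (ha j hj).1, fun j hj => (hb j hj).1, fun j hj => (ha j hj).2,
    fun j hj => (hb j hj).2, ?_, hc.r0_ne⟩
  rw [← toLaurent_coeff_zero]
  exact hc.R_lead

section Reduced

variable {lam lamT : ℕ → ℂ} {r0 : ℂ} {a b : ℕ → PowerSeries ℂ}

theorem IsReduced.isDoublePoint_iff (hr : IsReduced c lam lamT r0 a b) (hp : 2 ≤ p) (hq : 2 ≤ q)
    {x v : PowerSeries ℂ} (hx : constantCoeff x ≠ 0) (hv : constantCoeff v ≠ 0)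
    {z z' : (LaurentSeries ℂ)ˣ} (hz : farPoint x = z) (hz' : nearPoint v = z') :
    (c.map toLaurent).IsDoublePoint p q z z' ↔
      edgeDiff q 1 a x v = 0 ∧ edgeDiff p c.R b v x = 0 := by
  have hne : z ≠ z' := by
    rintro rfl
    have h1 := farPoint_order hx
    rw [hz, ← hz', nearPoint_order hv] at h1
    omega
  have ht := toLaurent_X_ne_zero
  have k1 := mul_edge_sub_edge (n := q) (ρ := 1) (by omega) hr.α_eq hx hv
  have k2 := mul_edge_sub_edge (n := p) (ρ := c.R) (by omega) hr.β_eq hv hx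
  have i1 : (z : LaurentSeries ℂ)⁻¹ = toLaurent X * (toLaurent x)⁻¹ := by
    rw [← hz, farPoint, mul_inv, inv_inv, mul_comm]
  have i2 : (z' : LaurentSeries ℂ)⁻¹ = toLaurent v * (toLaurent X)⁻¹ := by
    rw [← hz', nearPoint, mul_inv, inv_inv, mul_comm]
  rw [Mobile.isDoublePoint_iff, i1, i2, ← hz, ← hz', and_iff_right hne]
  rw [map_one] at k1
  rw [← map_eq_zero_iff _ toLaurent_injective, ← k1, mul_eq_zero, or_iff_right ht, sub_eq_zero]
  rw [← map_eq_zero_iff _ toLaurent_injective, ← k2, mul_eq_zero, or_iff_right ht, sub_eq_zero]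
  exact and_congr_right fun _ => eq_comm

theorem sum_lead_eq (hr : IsReduced c lam lamT r0 a b) (n : ℕ) (v : ℂ) :
    ∑ j ∈ Finset.Ico 1 n, constantCoeff (a j) * v ^ j = (couplingPoly n lam).eval (r0 * v) := by
  rw [eval_couplingPoly]
  refine Finset.sum_congr rfl fun j hj => ?_
  rw [Finset.mem_Ico] at hj
  rw [hr.α_lead j hj.1, mul_pow, mul_assoc]

theorem sum_lead_eq' (hr : IsReduced c lam lamT r0 a b) (n : ℕ) (x : ℂ) :
    ∑ j ∈ Finset.Ico 1 n, constantCoeff (b j) * x ^ j = (couplingPoly n lamT).eval x := by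
  rw [eval_couplingPoly]
  refine Finset.sum_congr rfl fun j hj => ?_
  rw [Finset.mem_Ico] at hj
  rw [hr.β_lead j hj.1]

/-- The Jacobian determinant of the leading equations is -r0 times the derivative of `returnPoly` at
x0, nonzero because the root is simple. -/
theorem IsReduced.exists_unique_lift (hr : IsReduced c lam lamT r0 a b)
    (hs : (returnPoly p q lam lamT).Separable) {x0 : ℂ} (hx0 : x0 ≠ 0)
    (hx : (returnPoly p q lam lamT).eval x0 = 0) :
    ∃ x v : PowerSeries ℂ, (constantCoeff x = x0 ∧
      r0 * constantCoeff v = (couplingPoly p lamT).eval x0 ∧ constantCoeff v ≠ 0 ∧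
      edgeDiff q 1 a x v = 0 ∧ edgeDiff p c.R b v x = 0) ∧
      ∀ x' v' : PowerSeries ℂ, (constantCoeff x' = x0 ∧
        r0 * constantCoeff v' = (couplingPoly p lamT).eval x0 ∧
        edgeDiff q 1 a x' v' = 0 ∧ edgeDiff p c.R b v' x' = 0) → x' = x ∧ v' = v := by
  have hr0 := hr.r0_ne
  obtain ⟨v0, hv0⟩ : ∃ v0, r0 * v0 = (couplingPoly p lamT).eval x0 :=
    ⟨r0⁻¹ * (couplingPoly p lamT).eval x0, mul_inv_cancel_left₀ hr0 _⟩
  have hdx := eval_derivative_ne_zero_of_separable hs hx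
  rw [eval_returnPoly, ← hv0, sub_eq_zero] at hx
  rw [eval_derivative_returnPoly, ← hv0] at hdx
  have hv0' : v0 ≠ 0 := by
    rintro rfl
    rw [mul_zero, eval_couplingPoly_zero] at hx
    exact hx0 hx.symm
  obtain ⟨x, v, ⟨h1, h2, h3, h4⟩, h5⟩ := Mobile.exists_unique_lift (p := p) (q := q) (R := c.R)
    (a := a) (b := b) hx0 hv0' (by rw [sum_lead_eq hr, hx])
    (by rw [sum_lead_eq' hr, hr.R_lead, hv0]) (by
      rw [hr.R_lead]
      have e1 : ∑ j ∈ Finset.Ico 1 q, constantCoeff (a j) * (j * v0 ^ (j - 1)) =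
          r0 * (couplingPoly q lam).derivative.eval (r0 * v0) := by
        rw [eval_derivative_couplingPoly, Finset.mul_sum]
        refine Finset.sum_congr rfl fun j hj => ?_
        rw [Finset.mem_Ico] at hj
        obtain ⟨k, rfl⟩ : ∃ k, j = k + 1 := ⟨j - 1, by omega⟩
        rw [hr.α_lead _ hj.1, mul_pow, Nat.add_sub_cancel]; ring
      have e2 : ∑ j ∈ Finset.Ico 1 p, constantCoeff (b j) * (j * x0 ^ (j - 1)) =
          (couplingPoly p lamT).derivative.eval x0 := by
        rw [eval_derivative_couplingPoly]
        refine Finset.sum_congr rfl fun j hj => ?_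
        rw [Finset.mem_Ico] at hj
        rw [hr.β_lead _ hj.1]
      rw [e1, e2]
      intro h0
      apply hdx
      apply mul_left_cancel₀ hr0
      linear_combination -h0)
  refine ⟨x, v, ⟨h1, by rw [h2, hv0], by rw [h2]; exact hv0', h3, h4⟩, fun x' v' h => ?_⟩
  refine h5 x' v' ⟨h.1, ?_, h.2.2⟩
  exact mul_left_cancel₀ hr0 (by rw [h.2.1, hv0])

end Reduced

/-- Data of a generic spectral curve. -/
structure IsGeneric (p q : ℕ) (lam : Finset.Icc 2 q → ℂ) (lamT : Finset.Icc 2 p → ℂ)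
    (c : Curve (PowerSeries ℂ)) : Prop where
  hp : 2 ≤ p
  hq : 2 ≤ q
  hpq : 1 < (p - 1) * (q - 1)
  spectral : c.IsSpectral p q (coupling lam) (coupling lamT)
  lam_ne : extend lam q ≠ 0
  lamT_ne : extend lamT p ≠ 0
  separable : (returnPoly p q (extend lam) (extend lamT)).Separable

namespace IsGeneric

variable (G : IsGeneric p q lam lamT c)
include G

theorem isLeading :
    (c.map toLaurent).IsLeading (extend lam) (extend lamT) (PowerSeries.coeff 0 c.R) :=
  G.spectral.isLeading G.hp G.hq

theorem double_point_orders {z z' : (LaurentSeries ℂ)ˣ}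
    (hd : (c.map toLaurent).IsDoublePoint p q z z')
    (hlt : (z : LaurentSeries ℂ).order < (z' : LaurentSeries ℂ).order) :
    (z : LaurentSeries ℂ).order = -1 ∧ (z' : LaurentSeries ℂ).order = 1 :=
  G.isLeading.double_point_orders G.hp G.hq G.hpq G.lam_ne G.lamT_ne hd hlt

theorem root_of_double_point {z z' : (LaurentSeries ℂ)ˣ}
    (hd : (c.map toLaurent).IsDoublePoint p q z z') (hz : (z : LaurentSeries ℂ).order = -1)
    (hz' : (z' : LaurentSeries ℂ).order = 1) :
    (returnPoly p q (extend lam) (extend lamT)).eval ((z : LaurentSeries ℂ).coeff (-1)) = 0 ∧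
      (z : LaurentSeries ℂ).coeff (-1) ≠ 0 := by
  obtain ⟨h1, h2⟩ := G.isLeading.double_point_leading hd hz hz'
  constructor
  · rw [eval_returnPoly, ← h2, ← h1, sub_self]
  · have := (exists_ordGE_coeff_ne_zero z.ne_zero).2
    rwa [hz] at this

/-- The leading coefficient at the far point determines the one at the near point, and both together
determine the lift. -/
theorem eq_of_double_point {z z' y y' : (LaurentSeries ℂ)ˣ}
    (hd : (c.map toLaurent).IsDoublePoint p q z z') (hz : (z : LaurentSeries ℂ).order = -1)
    (hz' : (z' : LaurentSeries ℂ).order = 1)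
    (hd' : (c.map toLaurent).IsDoublePoint p q y y') (hy : (y : LaurentSeries ℂ).order = -1)
    (hy' : (y' : LaurentSeries ℂ).order = 1)
    (h : (z : LaurentSeries ℂ).coeff (-1) = (y : LaurentSeries ℂ).coeff (-1)) :
    z = y ∧ z' = y' := by
  obtain ⟨a, b, hr⟩ := G.isLeading.exists_isReduced
  obtain ⟨hroot, hne⟩ := G.root_of_double_point hd hz hz'
  obtain ⟨x, v, -, huniq⟩ := hr.exists_unique_lift G.separable hne hroot
  have key : ∀ {s s' : (LaurentSeries ℂ)ˣ}, (c.map toLaurent).IsDoublePoint p q s s' →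
      (s : LaurentSeries ℂ).order = -1 → (s' : LaurentSeries ℂ).order = 1 →
      (z : LaurentSeries ℂ).coeff (-1) = (s : LaurentSeries ℂ).coeff (-1) →
      farPoint x = s ∧ nearPoint v = s' := by
    intro s s' hds hs hs' hzs
    obtain ⟨x', hx', hx0'⟩ := exists_farPoint hs
    obtain ⟨v', hv', hv0'⟩ := exists_nearPoint hs'
    obtain ⟨k1, k2⟩ := (hr.isDoublePoint_iff G.hp G.hq hx0' hv0' hx' hv').1 hds
    obtain ⟨l1, l2⟩ := G.isLeading.double_point_leading hds hs hs'
    have e1 : constantCoeff x' = (z : LaurentSeries ℂ).coeff (-1) := by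
      rw [hzs, ← hx', farPoint_spec.2]
    have e2 : ((s' : LaurentSeries ℂ).coeff 1)⁻¹ = constantCoeff v' := by
      rw [← hv', (nearPoint_spec hv0').2, inv_inv]
    rw [e2, ← hzs] at l2
    obtain ⟨rfl, rfl⟩ := huniq x' v' ⟨e1, l2, k1, k2⟩
    exact ⟨hx', hv'⟩
  obtain ⟨k1, k2⟩ := key hd hz hz' rfl
  obtain ⟨k3, k4⟩ := key hd' hy hy' h
  exact ⟨Units.ext (k1.symm.trans k3), Units.ext (k2.symm.trans k4)⟩

theorem exists_isDoublePointList : ∃ w wb : Fin ((p - 1) * (q - 1) - 1) → (LaurentSeries ℂ)ˣ,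
    (c.map toLaurent).IsDoublePointList p q w wb := by
  obtain ⟨a, b, hr⟩ := G.isLeading.exists_isReduced
  obtain ⟨x0, hinj, hroot, hall⟩ := exists_nonzero_roots G.hp G.hq G.hpq G.lam_ne G.lamT_ne
    G.separable
  have hl := fun i => hr.exists_unique_lift G.separable (hroot i).1 (hroot i).2
  choose x v hxv _ using hl
  have hx0 : ∀ i, constantCoeff (x i) ≠ 0 := fun i => by rw [(hxv i).1]; exact (hroot i).1
  have hv0 : ∀ i, constantCoeff (v i) ≠ 0 := fun i => (hxv i).2.2.1
  have hfar : ∀ i, farPoint (x i) ≠ 0 := fun i h => by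
    have := farPoint_spec (x := x i) |>.2
    rw [h] at this
    exact hx0 i (by simpa using this.symm)
  have hnear : ∀ i, nearPoint (v i) ≠ 0 := fun i h => by
    have := nearPoint_spec (hv0 i) |>.2
    rw [h] at this
    exact inv_ne_zero (hv0 i) (by simpa using this.symm)
  -- The point near 0 has the larger order in t, so it is the one called w.
  set w := fun i => Units.mk0 _ (hnear i) with hw
  set wb := fun i => Units.mk0 _ (hfar i) with hwb
  have hd : ∀ i, (c.map toLaurent).IsDoublePoint p q (wb i) (w i) := fun i =>
    (hr.isDoublePoint_iff G.hp G.hq (hx0 i) (hv0 i) rfl rfl).2 (hxv i).2.2.2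
  have ow : ∀ i, (w i : LaurentSeries ℂ).order = 1 := fun i => nearPoint_order (hv0 i)
  have owb : ∀ i, (wb i : LaurentSeries ℂ).order = -1 := fun i => farPoint_order (hx0 i)
  have cwb : ∀ i, (wb i : LaurentSeries ℂ).coeff (-1) = x0 i := fun i =>
    farPoint_spec.2.trans (hxv i).1
  have symm : ∀ {z z' : (LaurentSeries ℂ)ˣ}, (c.map toLaurent).IsDoublePoint p q z z' →
      (c.map toLaurent).IsDoublePoint p q z' z := fun h => ⟨h.1.symm, h.2.1.symm, h.2.2.symm⟩
  have hcomp : ∀ {z z' : (LaurentSeries ℂ)ˣ}, (c.map toLaurent).IsDoublePoint p q z z' →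
      (z : LaurentSeries ℂ).order < (z' : LaurentSeries ℂ).order →
      ∃ i, z = wb i ∧ z' = w i := by
    intro z z' h hlt
    obtain ⟨h1, h2⟩ := G.double_point_orders h hlt
    obtain ⟨k1, k2⟩ := G.root_of_double_point h h1 h2
    obtain ⟨i, hi⟩ := hall _ k2 k1
    exact ⟨i, G.eq_of_double_point h h1 h2 (hd i) (owb i) (ow i) (by rw [hi, cwb])⟩
  refine ⟨w, wb, fun i => symm (hd i), fun i => by rw [ow, owb]; omega, ?_, ?_⟩
  · rw [Sum.elim_injective]
    refine ⟨fun i j hij => hinj ?_, fun i j hij => hinj ?_, fun i j hij => ?_⟩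
    -- The leading coefficient of w_i determines that of wb_i, which is the root x0 i.
    · obtain ⟨h1, h2⟩ := G.isLeading.double_point_leading (hd i) (owb i) (ow i)
      obtain ⟨h3, h4⟩ := G.isLeading.double_point_leading (hd j) (owb j) (ow j)
      rw [← cwb, ← cwb, h1, h3, hij]
    · rw [← cwb, ← cwb, hij]
    · have := ow i
      rw [hij, owb] at this
      omega
  · intro z z' h
    rcases lt_or_gt_of_ne (G.isLeading.order_ne_order G.hp G.hq h) with hlt | hlt
    · obtain ⟨i, h1, h2⟩ := hcomp h hlt
      exact ⟨i, Or.inr ⟨h1, h2⟩⟩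
    · obtain ⟨i, h1, h2⟩ := hcomp (symm h) hlt
      exact ⟨i, Or.inl ⟨h2, h1⟩⟩

end IsGeneric

end DoublePointList

end Mobile

end

noncomputable section

namespace Mobile

/-! ### Leading behaviour of the determinants -/

section Separated

variable {N : ℕ}

/-- With bounds that depend on the column only, all products in the expansion of the determinant
have the same lower bound, and their leading coefficients form a determinant again. -/
theorem det_of_ordGE {M : Matrix (Fin N) (Fin N) (LaurentSeries ℂ)} {e : Fin N → ℤ}
    (hM : ∀ a b, OrdGE (e b) (M a b)) : OrdGE (∑ b, e b) M.det ∧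
      M.det.coeff (∑ b, e b) = (Matrix.of fun a b => (M a b).coeff (e b)).det := by
  rw [Matrix.det_apply', Matrix.det_apply', HahnSeries.coeff_sum]
  have h1 : ∀ σ : Equiv.Perm (Fin N), OrdGE (∑ b, e b) (∏ i, M (σ i) i) ∧
      (∏ i, M (σ i) i).coeff (∑ b, e b) = ∏ i, (M (σ i) i).coeff (e i) := fun σ =>
    ⟨OrdGE.prod fun i _ => hM _ _, coeff_prod_of_ordGE fun i _ => hM _ _⟩
  constructor
  · refine OrdGE.sum fun σ _ k hk => ?_
    rw [← zsmul_eq_mul, HahnSeries.coeff_smul, (h1 σ).1 k hk, smul_zero]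
  · refine Finset.sum_congr rfl fun σ _ => ?_
    rw [← zsmul_eq_mul, HahnSeries.coeff_smul, (h1 σ).2, zsmul_eq_mul]
    rfl

theorem det_zpow_ne_zero {x : Fin N → ℂ} (hx : ∀ a, x a ≠ 0) (hinj : Function.Injective x)
    (n : ℤ) : (Matrix.of fun a b : Fin N => x a ^ (n + ((b : ℕ) : ℤ))).det ≠ 0 := by
  have h1 : (Matrix.of fun a b : Fin N => x a ^ (n + ((b : ℕ) : ℤ))) =
      Matrix.of fun a b => x a ^ n * Matrix.vandermonde x a b := by
    ext a b
    simp only [Matrix.of_apply, Matrix.vandermonde_apply, zpow_add₀ (hx a), zpow_natCast]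
  rw [h1, Matrix.det_mul_column]
  exact mul_ne_zero (Finset.prod_ne_zero_iff.2 fun a _ => zpow_ne_zero _ (hx a))
    (Matrix.det_vandermonde_ne_zero_iff.2 hinj)

/-- The parameters `w a` vanish to first order, the parameters `wb a` have simple poles, with
pairwise distinct leading coefficients. -/
structure IsSeparated (w wb : Fin N → (LaurentSeries ℂ)ˣ) : Prop where
  w_ord : ∀ a, OrdGE 1 (w a : LaurentSeries ℂ)
  w_ne : ∀ a, (w a : LaurentSeries ℂ).coeff 1 ≠ 0
  w_inj : Function.Injective fun a => (w a : LaurentSeries ℂ).coeff 1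
  wb_ord : ∀ a, OrdGE (-1) (wb a : LaurentSeries ℂ)
  wb_ne : ∀ a, (wb a : LaurentSeries ℂ).coeff (-1) ≠ 0
  wb_inj : Function.Injective fun a => (wb a : LaurentSeries ℂ).coeff (-1)

variable {w wb : Fin N → (LaurentSeries ℂ)ˣ}

namespace IsSeparated

variable (S : IsSeparated w wb)
include S

theorem xi_pos {k : ℤ} (hk : 0 < k) (a : Fin N) : OrdGE (-k) (xi w wb k a) ∧
    (xi w wb k a).coeff (-k) = (wb a : LaurentSeries ℂ).coeff (-1) ^ k := by
  obtain ⟨h1, h2⟩ := (S.w_ord a).zpow (S.w_ne a) k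
  obtain ⟨h3, h4⟩ := (S.wb_ord a).zpow (S.wb_ne a) k
  rw [mul_one] at h1
  rw [mul_neg_one] at h3 h4
  refine ⟨h3.sub (h1.mono (by omega)), ?_⟩
  rw [xi, HahnSeries.coeff_sub, h4, h1 _ (by omega), sub_zero]

theorem xi_neg {k : ℤ} (hk : k < 0) (a : Fin N) : OrdGE k (xi w wb k a) ∧
    (xi w wb k a).coeff k = -(w a : LaurentSeries ℂ).coeff 1 ^ k := by
  obtain ⟨h1, h2⟩ := (S.w_ord a).zpow (S.w_ne a) k
  obtain ⟨h3, h4⟩ := (S.wb_ord a).zpow (S.wb_ne a) k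
  rw [mul_one] at h1 h2
  rw [mul_neg_one] at h3
  refine ⟨(h3.mono (by omega)).sub h1, ?_⟩
  rw [xi, HahnSeries.coeff_sub, h2, h3 _ (by omega), zero_sub]

/-- All exponents are positive, so the powers of wb_a dominate and the leading matrix is a
row-rescaled Vandermonde matrix. -/
theorem h_pos {n : ℤ} (hn : 0 ≤ n) :
    OrdGE (∑ b : Fin N, -(n + 1 + ((b : ℕ) : ℤ))) (h w wb n) ∧
      (h w wb n).coeff (∑ b : Fin N, -(n + 1 + ((b : ℕ) : ℤ))) ≠ 0 := by
  obtain ⟨h1, h2⟩ := det_of_ordGE (M := Matrix.of fun a b : Fin N =>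
    xi w wb (n + 1 + ((b : ℕ) : ℤ)) a) (e := fun b => -(n + 1 + ((b : ℕ) : ℤ)))
    fun a b => (S.xi_pos (by omega) a).1
  refine ⟨h1, ?_⟩
  rw [h, h2]
  have h3 : (Matrix.of fun a b : Fin N => ((Matrix.of fun a b : Fin N =>
      xi w wb (n + 1 + ((b : ℕ) : ℤ)) a) a b).coeff (-(n + 1 + ((b : ℕ) : ℤ)))) =
      Matrix.of fun a b : Fin N => (wb a : LaurentSeries ℂ).coeff (-1) ^
        (n + 1 + ((b : ℕ) : ℤ)) := by
    ext a b
    exact (S.xi_pos (by omega) a).2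
  rw [h3]
  exact det_zpow_ne_zero S.wb_ne S.wb_inj _

/-- All exponents n + 1, ..., n + N are negative, so here the powers of w_a dominate. -/
theorem h_neg {n : ℤ} (hn : n + 2 + N ≤ 0) :
    OrdGE (∑ b : Fin N, (n + 1 + ((b : ℕ) : ℤ))) (h w wb n) ∧
      (h w wb n).coeff (∑ b : Fin N, (n + 1 + ((b : ℕ) : ℤ))) ≠ 0 := by
  obtain ⟨h1, h2⟩ := det_of_ordGE (M := Matrix.of fun a b : Fin N =>
    xi w wb (n + 1 + ((b : ℕ) : ℤ)) a) (e := fun b => (n + 1 + ((b : ℕ) : ℤ)))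
    fun a b => (S.xi_neg (by have := b.2; omega) a).1
  refine ⟨h1, ?_⟩
  rw [h, h2]
  have h3 : (Matrix.of fun a b : Fin N => ((Matrix.of fun a b : Fin N =>
      xi w wb (n + 1 + ((b : ℕ) : ℤ)) a) a b).coeff (n + 1 + ((b : ℕ) : ℤ))) =
      -Matrix.of fun a b : Fin N => (w a : LaurentSeries ℂ).coeff 1 ^
        (n + 1 + ((b : ℕ) : ℤ)) := by
    ext a b
    exact (S.xi_neg (by have := b.2; omega) a).2
  rw [h3, Matrix.det_neg]
  exact mul_ne_zero (pow_ne_zero _ (by norm_num)) (det_zpow_ne_zero S.w_ne S.w_inj _)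

theorem h_ne_zero {n : ℤ} (hn : 0 ≤ n) : h w wb n ≠ 0 := fun h0 =>
  (S.h_pos hn).2 (by rw [h0]; simp)

theorem h_ne_zero' {n : ℤ} (hn : n + 2 + N ≤ 0) : h w wb n ≠ 0 := fun h0 =>
  (S.h_neg hn).2 (by rw [h0]; simp)

-- The value is a quotient of two determinants; a gain of e in each of the N columns of the
-- numerator gains N e in total.
omit S in
theorem ordGE_eval_psiPoly {n e : ℤ} {f : Fin N → ℤ} (hh : OrdGE (∑ b, f b) (h w wb n))
    (hne : (h w wb n).coeff (∑ b, f b) ≠ 0) {r : LaurentSeries ℂ}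
    (hr : ∀ a b : Fin N, OrdGE (f b + e) (r * xi w wb (n + 1 + ((b : ℕ) : ℤ)) a -
      xi w wb (n + 2 + ((b : ℕ) : ℤ)) a)) : OrdGE (N * e) ((psiPoly w wb n).eval r) := by
  have h0 : h w wb n ≠ 0 := fun h0 => hne (by rw [h0]; simp)
  have h1 := h_mul_eval_psiPoly h0 r
  have h2 := (det_of_ordGE (M := Matrix.of fun a b : Fin N =>
    r * xi w wb (n + 1 + ((b : ℕ) : ℤ)) a - xi w wb (n + 2 + ((b : ℕ) : ℤ)) a) hr).1
  rw [← h1, Finset.sum_add_distrib] at h2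
  have h3 := (hh.inv hne).1.mul h2
  rw [inv_mul_cancel_left₀ h0] at h3
  simpa using h3

theorem ordGE_eval_psiPoly_w {n : ℤ} (hn : 0 ≤ n) (a : Fin N) :
    OrdGE (-(N : ℤ)) ((psiPoly w wb n).eval (w a : LaurentSeries ℂ)) := by
  obtain ⟨h1, h2⟩ := S.h_pos hn
  have := ordGE_eval_psiPoly (e := -1) h1 h2 (r := (w a : LaurentSeries ℂ)) fun i b =>
    (((S.w_ord a).mul (S.xi_pos (by omega) i).1).mono (by omega)).sub
      ((S.xi_pos (by omega) i).1.mono (by omega))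
  rwa [mul_neg_one] at this

theorem ordGE_eval_psiPoly_wb {n : ℤ} (hn : n + 2 + N ≤ 0) (a : Fin N) :
    OrdGE (-(N : ℤ)) ((psiPoly w wb n).eval (wb a : LaurentSeries ℂ)) := by
  obtain ⟨h1, h2⟩ := S.h_neg hn
  have := ordGE_eval_psiPoly (e := -1) h1 h2 (r := (wb a : LaurentSeries ℂ)) fun i b =>
    (((S.wb_ord a).mul (S.xi_neg (by have := b.2; omega) i).1).mono (by omega)).sub
      ((S.xi_neg (by have := b.2; omega) i).1.mono (by omega))
  rwa [mul_neg_one] at this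

omit S in
theorem eval_psiPoly_mul_zpow {n : ℤ} (hn : h w wb n ≠ 0) (a : Fin N) :
    (psiPoly w wb n).eval (w a : LaurentSeries ℂ) * (w a : LaurentSeries ℂ) ^ (n + 1) =
      (psiPoly w wb n).eval (wb a : LaurentSeries ℂ) * (wb a : LaurentSeries ℂ) ^ (n + 1) := by
  have h1 := psi_mem_nodalRing hn a
  rw [psi_eq hn] at h1
  simpa [evalAt, LaurentPolynomial.eval₂_toLaurent, Polynomial.eval₂_id] using h1

/-- The nodal condition transports the value from w_a to wb_a with the factor (w_a / wb_a)^(n+1), of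
order 2(n + 1). -/
theorem ordGE_eval_psiPoly_wb' {n : ℤ} (hn : 0 ≤ n) (a : Fin N) :
    OrdGE (2 * (n + 1) - N) ((psiPoly w wb n).eval (wb a : LaurentSeries ℂ)) := by
  have h1 := eval_psiPoly_mul_zpow (S.h_ne_zero hn) a
  have h2 : (psiPoly w wb n).eval (wb a : LaurentSeries ℂ) =
      (psiPoly w wb n).eval (w a : LaurentSeries ℂ) *
        ((w a : LaurentSeries ℂ) ^ (n + 1) * (wb a : LaurentSeries ℂ) ^ (-(n + 1))) := by
    rw [← mul_assoc, h1, mul_assoc, ← zpow_add₀ (wb a).ne_zero, add_neg_cancel, zpow_zero, mul_one]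
  rw [h2]
  exact ((S.ordGE_eval_psiPoly_w hn a).mul (((S.w_ord a).zpow (S.w_ne a) _).1.mul
    ((S.wb_ord a).zpow (S.wb_ne a) _).1)).mono (by linarith)

theorem ordGE_eval_psiPoly_w' {n : ℤ} (hn : n + 2 + N ≤ 0) (a : Fin N) :
    OrdGE (-2 * (n + 1) - N) ((psiPoly w wb n).eval (w a : LaurentSeries ℂ)) := by
  have h1 := eval_psiPoly_mul_zpow (S.h_ne_zero' hn) a
  have h2 : (psiPoly w wb n).eval (w a : LaurentSeries ℂ) =
      (psiPoly w wb n).eval (wb a : LaurentSeries ℂ) *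
        ((wb a : LaurentSeries ℂ) ^ (n + 1) * (w a : LaurentSeries ℂ) ^ (-(n + 1))) := by
    rw [← mul_assoc, ← h1, mul_assoc, ← zpow_add₀ (w a).ne_zero, add_neg_cancel, zpow_zero, mul_one]
  rw [h2]
  exact ((S.ordGE_eval_psiPoly_wb hn a).mul (((S.wb_ord a).zpow (S.wb_ne a) _).1.mul
    ((S.w_ord a).zpow (S.w_ne a) _).1)).mono (by linarith)

end IsSeparated

-- The double points of a generic curve satisfy the hypotheses above

section Generic

variable {p q : ℕ} {lam : Finset.Icc 2 q → ℂ} {lamT : Finset.Icc 2 p → ℂ}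
  {c : Curve (PowerSeries ℂ)} {w wb : Fin ((p - 1) * (q - 1) - 1) → (LaurentSeries ℂ)ˣ}

theorem IsGeneric.isSeparated (G : IsGeneric p q lam lamT c)
    (hw : (c.map toLaurent).IsDoublePointList p q w wb) : IsSeparated w wb := by
  have hd : ∀ a, (c.map toLaurent).IsDoublePoint p q (wb a) (w a) := fun a =>
    ⟨(hw.isDoublePoint a).1.symm, (hw.isDoublePoint a).2.1.symm, (hw.isDoublePoint a).2.2.symm⟩
  have ho := fun a => G.double_point_orders (hd a) (hw.order_lt a)
  have hwo := fun a => exists_ordGE_coeff_ne_zero (w a).ne_zero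
  have hwbo := fun a => exists_ordGE_coeff_ne_zero (wb a).ne_zero
  simp only [fun a => (ho a).2] at hwo
  simp only [fun a => (ho a).1] at hwbo
  have hl := fun a => G.isLeading.double_point_leading (hd a) (ho a).1 (ho a).2
  have hinj : Function.Injective fun a => (wb a : LaurentSeries ℂ).coeff (-1) := by
    intro a b hab
    have := (G.eq_of_double_point (hd a) (ho a).1 (ho a).2 (hd b) (ho b).1 (ho b).2 hab).1
    exact Sum.inr_injective (hw.distinct (a₁ := Sum.inr a) (a₂ := Sum.inr b) this)
  refine ⟨fun a => (hwo a).1, fun a => (hwo a).2, fun a b hab => hinj ?_, fun a => (hwbo a).1,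
    fun a => (hwbo a).2, hinj⟩
  simp only at hab ⊢
  rw [(hl a).1, (hl b).1, hab]

theorem IsGeneric.isNodalPair (G : IsGeneric p q lam lamT c)
    (hw : (c.map toLaurent).IsDoublePointList p q w wb) :
    IsNodalPair w wb (p - 1) (q - 1) ((c.map toLaurent).X q) ((c.map toLaurent).Y p) := by
  have hp := G.hp
  have hq := G.hq
  have hpq := G.hpq
  refine ⟨hw.distinct, by omega, fun a => (hw.isDoublePoint a).2.1,
    fun a => (hw.isDoublePoint a).2.2, Curve.degLE_X _, ?_, Curve.coeff_X_one _ _, ?_,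
    Curve.lowGE_Y _, ?_⟩
  · exact Curve.lowGE_X _ (by omega)
  · exact Curve.degLE_Y _ (by omega)
  · rw [Curve.coeff_Y_natCast, if_pos (by omega)]
    have := G.isLeading.β_lead (p - 1) (by omega)
    rw [Nat.sub_add_cancel (by omega)] at this
    intro h0
    rw [h0] at this
    exact G.lamT_ne (by simpa using this.symm)

end Generic

end Separated

end Mobile

end

noncomputable section

namespace Mobile

/-! ### Integrality of the scalar products -/

section Integrality

open LaurentPolynomial

section PartialFractions

variable {K : Type} [Field K]

theorem expand_basis_mul_prod_pole {N : ℕ} (r : Fin N → K) (i : Fin N) :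
    expandHom (Polynomial.toLaurent (Lagrange.basis Finset.univ r i)) * ∏ i, pole (r i) =
      HahnSeries.C (∏ j ∈ Finset.univ.erase i, (r i - r j)⁻¹) * pole (r i) := by
  rw [← Finset.mul_prod_erase Finset.univ _ (Finset.mem_univ i), Lagrange.basis, map_prod, map_prod,
    mul_left_comm, ← Finset.prod_mul_distrib, mul_comm, map_prod]
  congr 1
  refine Finset.prod_congr rfl fun j _ => ?_
  rw [Lagrange.basisDivisor, map_mul, map_mul, Polynomial.toLaurent_C, map_sub,
    Polynomial.toLaurent_X, Polynomial.toLaurent_C, mul_right_comm, mul_assoc, pole_mul_expand,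
    mul_one, expandHom_apply, expandAtInfinity_C]

theorem eq_prod_add_interpolation {N : ℕ} {r : Fin N → K} (hr : Function.Injective r)
    {E : Polynomial K} (hE : E.Monic) (hN : E.natDegree = N) :
    E = ∏ i, (Polynomial.X - Polynomial.C (r i)) +
      ∑ i, Polynomial.C (E.eval (r i)) * Lagrange.basis Finset.univ r i := by
  have hmon : (∏ i, (Polynomial.X - Polynomial.C (r i))).Monic :=
    Polynomial.monic_prod_of_monic _ _ fun i _ => Polynomial.monic_X_sub_C _
  have hdeg : (E - ∏ i, (Polynomial.X - Polynomial.C (r i))).degree <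
      (Finset.univ : Finset (Fin N)).card := by
    rw [Finset.card_univ, Fintype.card_fin]
    have h1 : E.degree = N := by rw [Polynomial.degree_eq_natDegree hE.ne_zero, hN]
    rw [← h1]
    refine Polynomial.degree_sub_lt_left ?_ hE.ne_zero ?_
    · rw [h1, Polynomial.degree_prod]; simp
    · rw [hE.leadingCoeff, hmon.leadingCoeff]
  have hint := Lagrange.eq_interpolate_of_eval_eq (s := Finset.univ) (v := r)
    (fun i => E.eval (r i)) hr.injOn hdeg fun i _ => by
      rw [Polynomial.eval_sub, Polynomial.eval_prod, Finset.prod_eq_zero (Finset.mem_univ i),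
        sub_zero]
      simp
  rw [Lagrange.interpolate_apply] at hint
  rw [← hint, add_sub_cancel]

theorem expand_prod_mul_prod_pole {N : ℕ} (r : Fin N → K) :
    expandHom (Polynomial.toLaurent (∏ i, (Polynomial.X - Polynomial.C (r i)))) *
      ∏ i, pole (r i) = 1 := by
  rw [map_prod, map_prod, ← Finset.prod_mul_distrib]
  refine Finset.prod_eq_one fun i _ => ?_
  rw [map_sub, Polynomial.toLaurent_X, Polynomial.toLaurent_C, mul_comm, pole_mul_expand]

/-- Partial fraction expansion of a monic polynomial divided by a product of distinct linear
factors of the same degree. -/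
theorem expand_mul_prod_pole {N : ℕ} {r : Fin N → K} (hr : Function.Injective r)
    {E : Polynomial K} (hE : E.Monic) (hN : E.natDegree = N) :
    expandHom (Polynomial.toLaurent E) * ∏ i, pole (r i) =
      1 + ∑ i, HahnSeries.C (E.eval (r i) * ∏ j ∈ Finset.univ.erase i, (r i - r j)⁻¹) *
        pole (r i) := by
  conv_lhs => rw [eq_prod_add_interpolation hr hE hN]
  rw [map_add, map_add, add_mul, expand_prod_mul_prod_pole, map_sum, map_sum, Finset.sum_mul]
  refine congrArg _ (Finset.sum_congr rfl fun i _ => ?_)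
  rw [map_mul, map_mul, Polynomial.toLaurent_C, expandHom_apply, expandAtInfinity_C, mul_assoc,
    expand_basis_mul_prod_pole, map_mul, mul_assoc]

end PartialFractions

/-- The coefficient of `u^k` in `f` vanishes to order at least `c + θ k`. -/
def Graded (θ c : ℤ) (f : LaurentSeries (LaurentSeries ℂ)) : Prop :=
  ∀ k, OrdGE (c + θ * k) (f.coeff k)

namespace Graded

variable {θ c c' : ℤ} {f g : LaurentSeries (LaurentSeries ℂ)}

theorem mul (hf : Graded θ c f) (hg : Graded θ c' g) : Graded θ (c + c') (f * g) := by
  intro k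
  rw [HahnSeries.coeff_mul]
  refine OrdGE.sum ?_
  rintro ⟨a, b⟩ hab
  rw [Finset.mem_antidiagonal] at hab
  obtain ⟨-, -, h3⟩ := hab
  simp only at h3
  refine ((hf a).mul (hg b)).mono ?_
  rw [← h3]; linarith

theorem add (hf : Graded θ c f) (hg : Graded θ c g) : Graded θ c (f + g) := fun k => by
  rw [HahnSeries.coeff_add]; exact (hf k).add (hg k)

theorem sum {ι : Type*} {s : Finset ι} {f : ι → LaurentSeries (LaurentSeries ℂ)}
    (hf : ∀ i ∈ s, Graded θ c (f i)) : Graded θ c (∑ i ∈ s, f i) := fun k => by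
  rw [HahnSeries.coeff_sum]; exact OrdGE.sum fun i hi => hf i hi k

theorem single {n m : ℤ} {a : LaurentSeries ℂ} (ha : OrdGE m a) (h : c + θ * n ≤ m) :
    Graded θ c (HahnSeries.single n a) := fun k => by
  rw [HahnSeries.coeff_single]
  split_ifs with hk
  · subst hk; exact ha.mono h
  · exact ordGE_zero _

theorem one : Graded θ 0 1 := single (n := 0) ordGE_one (by simp)

/-- The coefficient of u^(i+1) is ε r^i, so the slope of the grading is the order of r. -/
theorem C_mul_pole {e : ℤ} {ε r : LaurentSeries ℂ} (hε : OrdGE e ε) (hr : OrdGE θ r)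
    (h : c + θ ≤ e) : Graded θ c (HahnSeries.C ε * pole r) := fun k => by
  rw [HahnSeries.C_mul_eq_smul, HahnSeries.coeff_smul, smul_eq_mul]
  rcases lt_or_ge k 1 with hk | hk
  · rw [ordGE_pole r k hk, mul_zero]; exact ordGE_zero _
  · obtain ⟨i, rfl⟩ : ∃ i : ℕ, k = i + 1 := ⟨(k - 1).toNat, by omega⟩
    rw [coeff_pole_succ]
    exact (hε.mul (hr.pow i)).mono (by linarith)

end Graded

theorem mul_rearrange {S : Type*} [CommRing S] (a b c d e f g h : S) :
    a * b * (c * (d * e)) * f * (g * h) = b * (e * f) * c * (a * g) * (d * h) := by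
  ring

/-- Distinct leading coefficients prevent cancellation in r_a - r_b. -/
theorem ordGE_prod_erase_inv {N : ℕ} {d : ℤ} {r : Fin N → LaurentSeries ℂ}
    (hr : ∀ a, OrdGE d (r a)) (hinj : Function.Injective fun a => (r a).coeff d) (a : Fin N) :
    OrdGE (-(((N : ℤ) - 1) * d)) (∏ b ∈ Finset.univ.erase a, (r a - r b)⁻¹) := by
  have h1 : ∀ b ∈ Finset.univ.erase a, OrdGE (-d) (r a - r b)⁻¹ := fun b hb =>
    (((hr a).sub (hr b)).inv (by
      rw [HahnSeries.coeff_sub, sub_ne_zero]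
      exact fun h => Finset.ne_of_mem_erase hb (hinj h).symm)).1
  have h2 := OrdGE.prod h1
  rw [Finset.sum_const, Finset.card_erase_of_mem (Finset.mem_univ a), Finset.card_univ,
    Fintype.card_fin, nsmul_eq_mul, Nat.cast_sub (by have := a.2; omega)] at h2
  exact h2.mono (by push_cast; linarith)

variable {N : ℕ} {w wb : Fin N → (LaurentSeries ℂ)ˣ}

namespace IsSeparated

variable (S : IsSeparated w wb)
include S

/-- The weight of the pole at wb_a has order at least 2n + 1: the value of the polynomial gives 2(n
+ 1) - N and the differences of the wb_b give N - 1. -/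
theorem psi_graded (n : ℕ) : ∃ A, Graded (-1) (2 * n + 2) A ∧
    expandHom (Polynomial.toLaurent (psiPoly w wb n)) * ∏ a, pole (wb a : LaurentSeries ℂ) =
      1 + A := by
  have hinj : Function.Injective fun a => (wb a : LaurentSeries ℂ) := fun a b hab =>
    S.wb_inj (congrArg (fun f => HahnSeries.coeff f (-1)) hab)
  refine ⟨_, ?_, expand_mul_prod_pole hinj psiPoly_monic psiPoly_natDegree⟩
  refine Graded.sum fun a _ => Graded.C_mul_pole
    ((S.ordGE_eval_psiPoly_wb' (by omega) a).mul (ordGE_prod_erase_inv S.wb_ord S.wb_inj a))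
    (S.wb_ord a) ?_
  linarith

/-- Both the weights of the poles and the w_a have positive order, so either slope is admissible. -/
theorem phi_graded (m : ℕ) : ∃ B, Graded 0 0 B ∧ Graded (-1) 0 B ∧
    expandHom (Polynomial.toLaurent (psiPoly w wb (-2 - (m : ℤ) - N))) *
      ∏ a, pole (w a : LaurentSeries ℂ) = 1 + B := by
  have hinj : Function.Injective fun a => (w a : LaurentSeries ℂ) := fun a b hab =>
    S.w_inj (congrArg (fun f => HahnSeries.coeff f 1) hab)
  have h0 : ∀ a, OrdGE 1 ((psiPoly w wb (-2 - (m : ℤ) - N)).eval (w a : LaurentSeries ℂ) *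
      ∏ b ∈ Finset.univ.erase a, ((w a : LaurentSeries ℂ) - w b)⁻¹) := fun a =>
    ((S.ordGE_eval_psiPoly_w' (by omega) a).mul (ordGE_prod_erase_inv S.w_ord S.w_inj a)).mono
      (by linarith)
  refine ⟨_, ?_, ?_, expand_mul_prod_pole hinj psiPoly_monic psiPoly_natDegree⟩
  · exact Graded.sum fun a _ => Graded.C_mul_pole (h0 a) ((S.w_ord a).mono (by omega)) (by omega)
  · exact Graded.sum fun a _ => Graded.C_mul_pole (h0 a) ((S.w_ord a).mono (by omega)) (by omega)

/-- The poles of 1 / (Δ Δ̄) are shared out: those at wb_a go with ψ_n and give 1 + A, those at w_a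
go with φ_m and give 1 + B. The part without A is integral in every coefficient. In the part with A
each power of u may cost one order of t, because the wb_a have poles, but A starts with order 2n +
2. -/
theorem ordGE_residue {Z : LaurentPolynomial (LaurentSeries ℂ)} (h0 : Graded 0 0 (expandHom Z))
    (h1 : Graded (-1) (-1) (expandHom Z)) (n m : ℕ) :
    OrdGE 0 (residue w wb (phi w wb m * (Z * psi w wb n))) := by
  obtain ⟨A, hA, eA⟩ := S.psi_graded n
  obtain ⟨B, hB0, hB1, eB⟩ := S.phi_graded m
  have key : residue w wb (phi w wb m * (Z * psi w wb n)) =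
      (HahnSeries.single ((m : ℤ) + 1 - n) (1 : LaurentSeries ℂ) * expandHom Z * (1 + B) +
        HahnSeries.single ((m : ℤ) + 1 - n) (1 : LaurentSeries ℂ) * expandHom Z * (1 + B) * A).coeff
          1 := by
    change (expandAtInfinity _ / expandAtInfinity _).coeff 1 = _
    rw [div_eq_mul_inv, inv_expand_delta, ← expandHom_apply, phi, psi_eq (S.h_ne_zero (n := n) (by omega)),
      psi_eq (S.h_ne_zero' (n := -2 - (m : ℤ) - N) (by omega)), Finset.prod_mul_distrib,
      ← mul_one_add (_ * _ * (1 + B)) A, ← eA, ← eB]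
    simp only [map_mul]
    have e : (HahnSeries.single ((m : ℤ) + 1 - n) (1 : LaurentSeries ℂ) :
        LaurentSeries (LaurentSeries ℂ)) = expandHom (T (-2 - (m : ℤ) - N + 1)) *
          (expandHom (T ((n : ℤ) + 1)) * expandHom (T ((N : ℤ) - 1))) := by
      rw [← map_mul, ← map_mul, ← T_add, ← T_add, expandHom_apply, expandAtInfinity_T]
      congr 2
      ring
    rw [e]
    exact congrArg (fun f => HahnSeries.coeff f 1) (mul_rearrange _ _ _ _ _ _ _ _)
  rw [key, HahnSeries.coeff_add]
  have k1 := (((Graded.single (θ := 0) (c := 0) (n := (m : ℤ) + 1 - n)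
    (ordGE_one (R := ℂ)) (by simp)).mul h0).mul (Graded.one.add hB0)) 1
  -- For the coefficient of u the bounds add up to (m + 1 - n) - 1 + (2n + 2) - 1 = m + n + 1.
  have k2 := ((((Graded.single (θ := -1) (c := (m : ℤ) + 1 - n) (n := (m : ℤ) + 1 - n)
    (ordGE_one (R := ℂ)) (by linarith)).mul h1).mul (Graded.one.add hB1)).mul hA) 1
  exact (k1.mono (by norm_num)).add (k2.mono (by linarith))

end IsSeparated

variable {p q : ℕ} {lam lamT : ℕ → ℂ} {r0 : ℂ} {c : Curve (LaurentSeries ℂ)}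

theorem Curve.IsLeading.graded_X (hc : c.IsLeading lam lamT r0) :
    Graded 0 0 (expandHom (c.X q)) ∧ Graded (-1) (-1) (expandHom (c.X q)) := by
  simp only [Curve.X, map_add, map_sum, expandHom_apply, expandAtInfinity_T,
    expandAtInfinity_C_mul_T]
  have hα : ∀ j, OrdGE 0 (c.α j) := fun j => by
    rcases Nat.eq_zero_or_pos j with rfl | hj
    · exact hc.α_zero
    · exact (hc.α_ord j hj).mono (by omega)
  exact ⟨(Graded.single ordGE_one (by norm_num)).add
      (Graded.sum fun j _ => Graded.single (hα j) (by norm_num)),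
    (Graded.single ordGE_one (by norm_num)).add
      (Graded.sum fun j _ => Graded.single (hα j) (by omega))⟩

theorem Curve.IsLeading.graded_Y (hc : c.IsLeading lam lamT r0) :
    Graded 0 0 (expandHom (c.Y p)) ∧ Graded (-1) (-1) (expandHom (c.Y p)) := by
  simp only [Curve.Y, map_add, map_sum, expandHom_apply, expandAtInfinity_C_mul_T]
  have hβ : ∀ j : ℕ, OrdGE 0 (c.β j) ∧ OrdGE ((j : ℤ) - 1) (c.β j) := fun j => by
    rcases Nat.eq_zero_or_pos j with rfl | hj
    · exact ⟨hc.β_zero, hc.β_zero.mono (by omega)⟩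
    · exact ⟨(hc.β_ord j hj).mono (by omega), hc.β_ord j hj⟩
  exact ⟨(Graded.single hc.R_ord (by norm_num)).add
      (Graded.sum fun j _ => Graded.single (hβ j).1 (by norm_num)),
    (Graded.single hc.R_ord (by norm_num)).add
      (Graded.sum fun j _ => Graded.single (hβ j).2 (by omega))⟩

end Integrality

end Mobile

end

noncomputable section

namespace Mobile

/-! ### Uniqueness of the solution of the mobile system -/

section MobileSystem

section Matrices

variable {S S' : Type} [CommRing S] [CommRing S']

theorem rowBdd_infPow_zero (A : ℕ → ℕ → S) : RowBdd 0 (infPow A 0) := fun n m h =>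
  if_neg (by omega)

theorem infPow_one (A : ℕ → ℕ → S) : infPow A 1 = A := by
  funext n m
  change infMul (infPow A 0) A n m = _
  rw [infMul_eq_sum (rowBdd_infPow_zero A) A (Nat.lt_succ_self _),
    Finset.sum_eq_single n]
  · simp [infPow]
  · intro l _ hl
    simp [infPow, hl.symm]
  · intro h
    exact absurd (Finset.mem_range.2 (by omega)) h

/-- `infPow` multiplies on the right, whereas the decomposition of a sequence of neighbours removes
its first element. -/
theorem infPow_succ' {d : ℕ} {A : ℕ → ℕ → S} (hA : RowBdd d A) (k : ℕ) {n M : ℕ}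
    (hM : n + d < M) (m : ℕ) :
    infPow A (k + 1) n m = ∑ l ∈ Finset.range M, A n l * infPow A k l m := by
  induction k generalizing m with
  | zero =>
    rw [infPow_one]
    by_cases hm : m < M
    · rw [Finset.sum_eq_single m]
      · simp [infPow]
      · intro l _ hl; simp [infPow, hl]
      · intro h; exact absurd (Finset.mem_range.2 hm) h
    · rw [hA n m (by omega), Finset.sum_eq_zero]
      intro l hl
      rw [Finset.mem_range] at hl
      simp [infPow, show l ≠ m by omega]
  | succ k ih =>
    have h1 := infMul_eq_sum (hA.infPow (k + 1)) A (n := n) (M := M + n + (k + 1) * d + d)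
      (by omega) m
    change infMul (infPow A (k + 1)) A n m = _
    rw [h1]
    simp only [ih, Finset.sum_mul]
    rw [Finset.sum_comm]
    refine Finset.sum_congr rfl fun l hl => ?_
    by_cases hl2 : n + d < l
    · simp [hA n l hl2]
    · change _ = A n l * infMul (infPow A k) A l m
      rw [infMul_eq_sum (hA.infPow k) A (n := l) (M := M + n + (k + 1) * d + d)
        (by rw [Nat.succ_mul]; omega) m, Finset.mul_sum]
      exact Finset.sum_congr rfl fun _ _ => mul_assoc _ _ _

theorem infPow_map (f : S →+* S') {d : ℕ} {A : ℕ → ℕ → S} (hA : RowBdd d A) (k n m : ℕ) :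
    infPow (fun n m => f (A n m)) k n m = f (infPow A k n m) := by
  have hA' : RowBdd d (fun n m => f (A n m)) := fun n m h => by simp only [hA n m h, map_zero]
  induction k generalizing m with
  | zero => simp only [infPow]; split_ifs <;> simp
  | succ k ih =>
    change infMul (infPow (fun n m => f (A n m)) k) _ n m = f (infMul (infPow A k) A n m)
    rw [infMul_eq_sum (hA'.infPow k) _ (Nat.lt_succ_self _),
      infMul_eq_sum (hA.infPow k) _ (Nat.lt_succ_self _), map_sum]
    exact Finset.sum_congr rfl fun l _ => by rw [ih, map_mul]

theorem dvd_infPow_sub {d : ℕ} {A A' : ℕ → ℕ → S} (hA : RowBdd d A) (hA' : RowBdd d A') {r : S}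
    (h : ∀ n m, r ∣ A n m - A' n m) (k n m : ℕ) : r ∣ infPow A k n m - infPow A' k n m := by
  induction k generalizing m with
  | zero => simp [infPow]
  | succ k ih =>
    change r ∣ infMul (infPow A k) A n m - infMul (infPow A' k) A' n m
    rw [infMul_eq_sum (hA.infPow k) _ (Nat.lt_succ_self _),
      infMul_eq_sum (hA'.infPow k) _ (Nat.lt_succ_self _), ← Finset.sum_sub_distrib]
    refine Finset.dvd_sum fun l _ => ?_
    have e : infPow A k n l * A l m - infPow A' k n l * A' l m =
        (infPow A k n l - infPow A' k n l) * A l m +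
          infPow A' k n l * (A l m - A' l m) := by ring
    rw [e]
    exact dvd_add (Dvd.dvd.mul_right (ih l) _) (Dvd.dvd.mul_left (h l m) _)

end Matrices

/-- The equations of the mobile system that determine its solution. -/
structure IsMobileSolution {S : Type} [CommRing S] (p q : ℕ) (g gt : ℕ → S) (Q P : ℕ → ℕ → S) :
    Prop where
  Q_band : ∀ n m, n + 1 < m ∨ m + q < n + 1 → Q n m = 0
  P_band : ∀ n m, m + 1 < n ∨ n + p < m + 1 → P n m = 0
  Q_super : ∀ n, Q n (n + 1) = 1
  upper : ∀ n m, n ≤ m → P n m = ∑ k ∈ Finset.range p, gt (k + 1) * infPow Q k n m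
  lower : ∀ n m, m ≤ n → Q n m = ∑ k ∈ Finset.range q, g (k + 1) * infPow P k n m
  superdiag : ∀ n, P (n + 1) n * (1 - ∑ k ∈ Finset.range q, g (k + 1) * infPow P k n (n + 1)) = 1

namespace IsMobileSolution

variable {S : Type} [CommRing S] {p q : ℕ} {g gt : ℕ → S} {Q P : ℕ → ℕ → S}

theorem rowBdd_Q (h : IsMobileSolution p q g gt Q P) : RowBdd 1 Q := fun n m hm =>
  h.Q_band n m (Or.inl (by omega))

theorem rowBdd_P (h : IsMobileSolution p q g gt Q P) : RowBdd p P := fun n m hm =>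
  h.P_band n m (Or.inr (by omega))

end IsMobileSolution

theorem IsMobileSystem.isMobileSolution {K S : Type} [Field K] [CommRing S] {f : S →+* K}
    (hf : Function.Injective f) {p q : ℕ} {g gt : ℕ → S} {Q P : ℕ → ℕ → S}
    (h : IsMobileSystem p q (fun k => f (g k)) (fun k => f (gt k)) (fun n m => f (Q n m))
      (fun n m => f (P n m))) : IsMobileSolution p q g gt Q P := by
  have hQb : ∀ n m, n + 1 < m ∨ m + q < n + 1 → Q n m = 0 := fun n m hm =>
    (map_eq_zero_iff f hf).1 (h.Q_band n m hm)
  have hPb : ∀ n m, m + 1 < n ∨ n + p < m + 1 → P n m = 0 := fun n m hm =>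
    (map_eq_zero_iff f hf).1 (h.P_band n m hm)
  have hQr : RowBdd 1 Q := fun n m hm => hQb n m (Or.inl (by omega))
  have hPr : RowBdd p P := fun n m hm => hPb n m (Or.inr (by omega))
  refine ⟨hQb, hPb, fun n => hf ((h.Q_super n).trans (map_one f).symm), fun n m hm => hf ?_,
    fun n m hm => hf ?_, fun n => hf ?_⟩
  · have := sub_eq_zero.1 (h.upper n m hm)
    simp only [infPow_map f hQr] at this
    simpa only [map_sum, map_mul] using this
  · have := sub_eq_zero.1 (h.lower n m hm)
    simp only [infPow_map f hPr] at this
    simpa only [map_sum, map_mul] using this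
  · have h1 := h.superdiag n
    have h2 := h.R_ne_zero n
    simp only [infPow_map f hPr] at h1
    rw [h.Q_super] at h1
    rw [map_mul, map_sub, map_one, map_sum]
    simp only [map_mul]
    rw [h1, mul_one_div, div_self h2]

section Uniqueness

open PowerSeries

variable {p q : ℕ} {lam : Finset.Icc 2 q → ℂ} {lamT : Finset.Icc 2 p → ℂ}
  {Q P Q' P' : ℕ → ℕ → PowerSeries ℂ}

/-- The coupling of index 2 is the only one not divisible by X, so to the next order the difference
enters through the linear term alone. -/
theorem dvd_sum_coupling_infPow_sub {r d e : ℕ} (hr : 2 ≤ r) (lam : Finset.Icc 2 r → ℂ)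
    {A A' : ℕ → ℕ → PowerSeries ℂ} (hA : RowBdd e A) (hA' : RowBdd e A')
    (h : ∀ n m, (X : PowerSeries ℂ) ^ d ∣ A n m - A' n m) (n m : ℕ) :
    (X : PowerSeries ℂ) ^ (d + 1) ∣ (∑ k ∈ Finset.range r, coupling lam (k + 1) * infPow A k n m) -
      (∑ k ∈ Finset.range r, coupling lam (k + 1) * infPow A' k n m) -
        C (extend lam 2) * (A n m - A' n m) := by
  rw [← Finset.sum_sub_distrib, ← Finset.sum_erase_add _ _ (Finset.mem_range.2 hr), infPow_one,
    infPow_one]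
  have e2 : coupling lam (1 + 1) = C (extend lam 2) := by simp [coupling]
  rw [e2, ← mul_sub, add_sub_cancel_right]
  refine Finset.dvd_sum fun k hk => ?_
  rw [Finset.mem_erase] at hk
  rw [← mul_sub, pow_succ', coupling]
  rcases Nat.eq_zero_or_pos k with rfl | hk0
  · simp [extend]
  · refine mul_dvd_mul (Dvd.dvd.mul_left ?_ _) (dvd_infPow_sub hA hA' h k n m)
    exact dvd_pow_self _ (by omega)

/-- Induction on the power of X. In each order the equations for the differences are linear. The
diagonal entries of P and Q are coupled with determinant 1 - lam_2 lamT_2; then P above the diagonal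
follows from the known part of Q, next the subdiagonal of P, and finally Q below the diagonal. -/
theorem IsMobileSolution.unique (hp : 2 ≤ p) (hq : 2 ≤ q)
    (hne : extend lam 2 * extend lamT 2 ≠ 1)
    (h : IsMobileSolution p q (coupling lam) (coupling lamT) Q P)
    (h' : IsMobileSolution p q (coupling lam) (coupling lamT) Q' P') : Q = Q' ∧ P = P' := by
  suffices key : ∀ d : ℕ, (∀ n m, (X : PowerSeries ℂ) ^ d ∣ Q n m - Q' n m) ∧
      ∀ n m, (X : PowerSeries ℂ) ^ d ∣ P n m - P' n m by
    constructor <;> funext n m <;> rw [← sub_eq_zero] <;>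
      refine powerSeries_eq_zero_of_forall_dvd 0 fun d _ => ?_
    · exact (key d).1 n m
    · exact (key d).2 n m
  intro d
  induction d with
  | zero => simp
  | succ d ih =>
    obtain ⟨ihQ, ihP⟩ := ih
    have hU : ∀ n m, n ≤ m → (X : PowerSeries ℂ) ^ (d + 1) ∣ P n m - P' n m -
        C (extend lamT 2) * (Q n m - Q' n m) := fun n m hm => by
      rw [h.upper n m hm, h'.upper n m hm]
      exact dvd_sum_coupling_infPow_sub hp lamT h.rowBdd_Q h'.rowBdd_Q ihQ n m
    have hL : ∀ n m, m ≤ n → (X : PowerSeries ℂ) ^ (d + 1) ∣ Q n m - Q' n m -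
        C (extend lam 2) * (P n m - P' n m) := fun n m hm => by
      rw [h.lower n m hm, h'.lower n m hm]
      exact dvd_sum_coupling_infPow_sub hq lam h.rowBdd_P h'.rowBdd_P ihP n m
    have hPQ : ∀ n m, n ≤ m → (X : PowerSeries ℂ) ^ (d + 1) ∣ Q n m - Q' n m →
        (X : PowerSeries ℂ) ^ (d + 1) ∣ P n m - P' n m := fun n m hm hQ => by
      have := dvd_add (hU n m hm) (Dvd.dvd.mul_left hQ (C (extend lamT 2)))
      rwa [sub_add_cancel] at this
    have hQP : ∀ n m, m ≤ n → (X : PowerSeries ℂ) ^ (d + 1) ∣ P n m - P' n m →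
        (X : PowerSeries ℂ) ^ (d + 1) ∣ Q n m - Q' n m := fun n m hm hQ => by
      have := dvd_add (hL n m hm) (Dvd.dvd.mul_left hQ (C (extend lam 2)))
      rwa [sub_add_cancel] at this
    have hQs : ∀ n m, n < m → (X : PowerSeries ℂ) ^ (d + 1) ∣ Q n m - Q' n m := by
      intro n m hm
      rcases Nat.lt_or_ge (n + 1) m with hm2 | hm2
      · rw [h.Q_band n m (Or.inl hm2), h'.Q_band n m (Or.inl hm2)]; simp
      · obtain rfl : m = n + 1 := by omega
        rw [h.Q_super, h'.Q_super]; simp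
    have hdiag : ∀ n, (X : PowerSeries ℂ) ^ (d + 1) ∣ P n n - P' n n := by
      intro n
      have h1 := dvd_add (hU n n le_rfl) (Dvd.dvd.mul_left (hL n n le_rfl) (C (extend lamT 2)))
      have h2 : P n n - P' n n - C (extend lamT 2) * (Q n n - Q' n n) +
          C (extend lamT 2) * (Q n n - Q' n n - C (extend lam 2) * (P n n - P' n n)) =
          C (1 - extend lam 2 * extend lamT 2) * (P n n - P' n n) := by
        rw [map_sub, map_mul, map_one]; ring
      rw [h2] at h1
      have h3 := Dvd.dvd.mul_left h1 (C (1 - extend lam 2 * extend lamT 2)⁻¹)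
      rwa [← mul_assoc, ← map_mul, inv_mul_cancel₀ (sub_ne_zero.2 hne.symm), map_one,
        one_mul] at h3
    have hPu : ∀ n m, n ≤ m → (X : PowerSeries ℂ) ^ (d + 1) ∣ P n m - P' n m := by
      intro n m hm
      rcases Nat.eq_or_lt_of_le hm with rfl | hlt
      · exact hdiag n
      · exact hPQ n m hm (hQs n m hlt)
    have hPall : ∀ n m, (X : PowerSeries ℂ) ^ (d + 1) ∣ P n m - P' n m := by
      intro n m
      rcases Nat.lt_or_ge m n with hm | hm
      · rcases Nat.lt_or_ge (m + 1) n with hm2 | hm2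
        · rw [h.P_band n m (Or.inl hm2), h'.P_band n m (Or.inl hm2)]; simp
        · obtain rfl : n = m + 1 := by omega
          have h1 := h.superdiag m
          have h2 := h'.superdiag m
          have h3 := dvd_sum_coupling_infPow_sub hq lam h.rowBdd_P h'.rowBdd_P ihP m (m + 1)
          have h4 := dvd_add h3 (Dvd.dvd.mul_left (hPu m (m + 1) (by omega)) (C (extend lam 2)))
          rw [sub_add_cancel] at h4
          set s := ∑ k ∈ Finset.range q, coupling lam (k + 1) * infPow P k m (m + 1)
          set s' := ∑ k ∈ Finset.range q, coupling lam (k + 1) * infPow P' k m (m + 1)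
          -- The two entries are the inverses of 1 - s and 1 - s', so their difference is a multiple
          -- of s - s'.
          have h5 : P (m + 1) m - P' (m + 1) m = P (m + 1) m * P' (m + 1) m * (s - s') := by
            linear_combination P' (m + 1) m * h1 - P (m + 1) m * h2
          rw [h5]
          exact Dvd.dvd.mul_left h4 _
      · exact hPu n m hm
    refine ⟨fun n m => ?_, hPall⟩
    rcases Nat.lt_or_ge n m with hm | hm
    · exact hQs n m hm
    · exact hQP n m hm (hPall n m)

end Uniqueness

end MobileSystem

end Mobile

end

noncomputable section

namespace Mobile

/-! ### Decomposition of mobiles -/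

section Decomposition

/-- One step around a white vertex: a labeled vertex or a flagged edge, with the subtree it
carries. -/
inductive WhiteStep : ℕ → ℕ → Type
  | corner {n : ℕ} (c : CornerMobile (n + 1)) : WhiteStep (n + 1) n
  | black {m m' : ℕ} (h : m ≤ m') (b : BlackSeq m m') : WhiteStep m m'

/-- One step around a black vertex: a bud or a flagged edge, with the subtree it carries. -/
inductive BlackStep : ℕ → ℕ → Type
  | bud (n : ℕ) : BlackStep n (n + 1)
  | white {m m' : ℕ} (h : m' ≤ m) (w : WhiteSeq m m') : BlackStep m m'

def WhiteSeq.split : {i j : ℕ} → WhiteSeq i j → PLift (i = j) ⊕ Σ l, WhiteStep i l × WhiteSeq l j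
  | _, _, .nil _ => .inl ⟨rfl⟩
  | _, _, .labeled c s => .inr ⟨_, .corner c, s⟩
  | _, _, .flag h b s => .inr ⟨_, .black h b, s⟩

def WhiteSeq.join : {i j : ℕ} → (PLift (i = j) ⊕ Σ l, WhiteStep i l × WhiteSeq l j) → WhiteSeq i j
  | i, _, .inl ⟨h⟩ => h ▸ .nil i
  | _, _, .inr ⟨_, .corner c, s⟩ => .labeled c s
  | _, _, .inr ⟨_, .black h b, s⟩ => .flag h b s

def whiteSeqEquiv (i j : ℕ) :
    WhiteSeq i j ≃ PLift (i = j) ⊕ Σ l, WhiteStep i l × WhiteSeq l j where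
  toFun := WhiteSeq.split
  invFun := WhiteSeq.join
  left_inv w := by cases w <;> rfl
  right_inv x := by
    rcases x with h | ⟨l, x, s⟩
    · obtain ⟨rfl⟩ := h
      rfl
    · cases x <;> rfl

def BlackSeq.split : {i j : ℕ} → BlackSeq i j → PLift (i = j) ⊕ Σ l, BlackStep i l × BlackSeq l j
  | _, _, .nil _ => .inl ⟨rfl⟩
  | _, _, .bud s => .inr ⟨_, .bud _, s⟩
  | _, _, .flag h w s => .inr ⟨_, .white h w, s⟩

def BlackSeq.join : {i j : ℕ} → (PLift (i = j) ⊕ Σ l, BlackStep i l × BlackSeq l j) → BlackSeq i j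
  | i, _, .inl ⟨h⟩ => h ▸ .nil i
  | _, _, .inr ⟨_, .bud _, s⟩ => .bud s
  | _, _, .inr ⟨_, .white h w, s⟩ => .flag h w s

def blackSeqEquiv (i j : ℕ) :
    BlackSeq i j ≃ PLift (i = j) ⊕ Σ l, BlackStep i l × BlackSeq l j where
  toFun := BlackSeq.split
  invFun := BlackSeq.join
  left_inv w := by cases w <;> rfl
  right_inv x := by
    rcases x with h | ⟨l, x, s⟩
    · obtain ⟨rfl⟩ := h
      rfl
    · cases x <;> rfl

def cornerMobileEquiv (n : ℕ) :
    CornerMobile (n + 1) ≃ Unit ⊕ WhiteSeq n (n + 1) × CornerMobile (n + 1) where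
  toFun
    | .vertex _ => .inl ()
    | .cons w c => .inr (w, c)
  invFun
    | .inl _ => .vertex _
    | .inr (w, c) => .cons w c
  left_inv c := by cases c <;> rfl
  right_inv x := by rcases x with _ | ⟨w, c⟩ <;> rfl

def cornerStepEquiv (n : ℕ) : WhiteStep (n + 1) n ≃ CornerMobile (n + 1) where
  toFun
    | .corner c => c
    | .black h _ => absurd h (by omega)
  invFun c := .corner c
  left_inv x := by
    cases x with
    | corner c => rfl
    | black h b => exact absurd h (by omega)
  right_inv c := rfl

def flagStepEquiv {m m' : ℕ} (h : m ≤ m') : WhiteStep m m' ≃ BlackSeq m m' where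
  toFun
    | .corner _ => absurd h (by omega)
    | .black _ b => b
  invFun b := .black h b
  left_inv x := by
    cases x with
    | corner c => exact absurd h (by omega)
    | black h b => rfl
  right_inv c := rfl

def budStepEquiv (n : ℕ) : BlackStep n (n + 1) ≃ Unit where
  toFun _ := ()
  invFun _ := .bud n
  left_inv x := by
    cases x with
    | bud => rfl
    | white h b => exact absurd h (by omega)
  right_inv c := rfl

def flagStepEquiv' {m m' : ℕ} (h : m' ≤ m) : BlackStep m m' ≃ WhiteSeq m m' where
  toFun
    | .bud _ => absurd h (by omega)
    | .white _ w => w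
  invFun w := .white h w
  left_inv x := by
    cases x with
    | bud => exact absurd h (by omega)
    | white h b => rfl
  right_inv c := rfl

theorem isEmpty_whiteStep {i l : ℕ} (h : l + 1 < i) : IsEmpty (WhiteStep i l) :=
  ⟨fun x => by cases x <;> omega⟩

theorem isEmpty_blackStep {i l : ℕ} (h : i + 1 < l) : IsEmpty (BlackStep i l) :=
  ⟨fun x => by cases x <;> omega⟩

/-- Each neighbour lowers the label by at most one. As white vertices of degree above q have weight
zero, this yields the band of Q. -/
theorem WhiteSeq.le_length : ∀ {i j : ℕ} (w : WhiteSeq i j), i ≤ j + w.length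
  | _, _, .nil _ => by simp [WhiteSeq.length]
  | _, _, .labeled _ s => by
    have := s.le_length
    simp only [WhiteSeq.length]; omega
  | _, _, .flag h _ s => by
    have := s.le_length
    simp only [WhiteSeq.length]; omega

theorem BlackSeq.le_length : ∀ {i j : ℕ} (b : BlackSeq i j), j ≤ i + b.length
  | _, _, .nil _ => by simp [BlackSeq.length]
  | _, _, .bud s => by
    have := s.le_length
    simp only [BlackSeq.length]; omega
  | _, _, .flag h _ s => by
    have := s.le_length
    simp only [BlackSeq.length]; omega

variable {A : Type} [CommSemiring A] (g gt : ℕ → A)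

def WhiteStep.weight {i j : ℕ} : WhiteStep i j → A
  | .corner c => c.weight g gt
  | .black _ b => b.weight g gt

def BlackStep.weight {i j : ℕ} : BlackStep i j → A
  | .bud _ => 1
  | .white _ w => w.weight g gt

/-- The inner weight restricted to the sequences of length `k`. -/
def WhiteSeq.innerWeightOf (k : ℕ) {i j : ℕ} (w : WhiteSeq i j) : A :=
  if w.length = k then w.innerWeight g gt else 0

/-- The inner weight restricted to the sequences of length `k`. -/
def BlackSeq.innerWeightOf (k : ℕ) {i j : ℕ} (b : BlackSeq i j) : A :=
  if b.length = k then b.innerWeight g gt else 0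

theorem innerWeightOf_zero_inl {i j : ℕ} (h : PLift (i = j)) :
    ((whiteSeqEquiv i j).symm (.inl h)).innerWeightOf g gt 0 = 1 := by
  obtain ⟨rfl⟩ := h
  simp [whiteSeqEquiv, WhiteSeq.join, WhiteSeq.innerWeightOf, WhiteSeq.length, WhiteSeq.innerWeight]

theorem innerWeightOf_zero_inr {i j : ℕ} (x : Σ l, WhiteStep i l × WhiteSeq l j) :
    ((whiteSeqEquiv i j).symm (.inr x)).innerWeightOf g gt 0 = 0 := by
  obtain ⟨l, x, s⟩ := x
  cases x <;> simp [whiteSeqEquiv, WhiteSeq.join, WhiteSeq.innerWeightOf, WhiteSeq.length]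

theorem innerWeightOf_succ_inl {i j : ℕ} (k : ℕ) (h : PLift (i = j)) :
    ((whiteSeqEquiv i j).symm (.inl h)).innerWeightOf g gt (k + 1) = 0 := by
  obtain ⟨rfl⟩ := h
  simp [whiteSeqEquiv, WhiteSeq.join, WhiteSeq.innerWeightOf, WhiteSeq.length]

theorem innerWeightOf_succ_inr {i j : ℕ} (k : ℕ) (x : Σ l, WhiteStep i l × WhiteSeq l j) :
    ((whiteSeqEquiv i j).symm (.inr x)).innerWeightOf g gt (k + 1) =
      x.2.1.weight g gt * x.2.2.innerWeightOf g gt k := by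
  obtain ⟨l, x, s⟩ := x
  cases x <;> simp [whiteSeqEquiv, WhiteSeq.join, WhiteSeq.innerWeightOf, WhiteSeq.length, WhiteSeq.innerWeight,
    WhiteStep.weight, BlackSeq.weight]

theorem innerWeightOf_zero_inl' {i j : ℕ} (h : PLift (i = j)) :
    ((blackSeqEquiv i j).symm (.inl h)).innerWeightOf g gt 0 = 1 := by
  obtain ⟨rfl⟩ := h
  simp [blackSeqEquiv, BlackSeq.join, BlackSeq.innerWeightOf, BlackSeq.length, BlackSeq.innerWeight]

theorem innerWeightOf_zero_inr' {i j : ℕ} (x : Σ l, BlackStep i l × BlackSeq l j) :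
    ((blackSeqEquiv i j).symm (.inr x)).innerWeightOf g gt 0 = 0 := by
  obtain ⟨l, x, s⟩ := x
  cases x <;> simp [blackSeqEquiv, BlackSeq.join, BlackSeq.innerWeightOf, BlackSeq.length]

theorem innerWeightOf_succ_inl' {i j : ℕ} (k : ℕ) (h : PLift (i = j)) :
    ((blackSeqEquiv i j).symm (.inl h)).innerWeightOf g gt (k + 1) = 0 := by
  obtain ⟨rfl⟩ := h
  simp [blackSeqEquiv, BlackSeq.join, BlackSeq.innerWeightOf, BlackSeq.length]

theorem innerWeightOf_succ_inr' {i j : ℕ} (k : ℕ) (x : Σ l, BlackStep i l × BlackSeq l j) :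
    ((blackSeqEquiv i j).symm (.inr x)).innerWeightOf g gt (k + 1) =
      x.2.1.weight g gt * x.2.2.innerWeightOf g gt k := by
  obtain ⟨l, x, s⟩ := x
  cases x <;> simp [blackSeqEquiv, BlackSeq.join, BlackSeq.innerWeightOf, BlackSeq.length, BlackSeq.innerWeight,
    BlackStep.weight, WhiteSeq.weight]

variable {g gt} {p q : ℕ}

theorem WhiteSeq.weight_eq_sum (hg : ∀ k, q < k → g k = 0) {i j : ℕ} (w : WhiteSeq i j) :
    w.weight g gt = ∑ k ∈ Finset.range q, g (k + 1) * w.innerWeightOf g gt k := by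
  by_cases h : w.length < q
  · rw [Finset.sum_eq_single w.length]
    · simp [WhiteSeq.weight, WhiteSeq.innerWeightOf]
    · intro k _ hk
      rw [WhiteSeq.innerWeightOf, if_neg hk.symm, mul_zero]
    · intro hh; exact absurd (Finset.mem_range.2 h) hh
  · rw [WhiteSeq.weight, hg _ (by omega), zero_mul, Finset.sum_eq_zero]
    intro k hk
    rw [Finset.mem_range] at hk
    rw [WhiteSeq.innerWeightOf, if_neg (by omega), mul_zero]

theorem BlackSeq.weight_eq_sum (hgt : ∀ k, p < k → gt k = 0) {i j : ℕ} (w : BlackSeq i j) :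
    w.weight g gt = ∑ k ∈ Finset.range p, gt (k + 1) * w.innerWeightOf g gt k := by
  by_cases h : w.length < p
  · rw [Finset.sum_eq_single w.length]
    · simp [BlackSeq.weight, BlackSeq.innerWeightOf]
    · intro k _ hk
      rw [BlackSeq.innerWeightOf, if_neg hk.symm, mul_zero]
    · intro hh; exact absurd (Finset.mem_range.2 h) hh
  · rw [BlackSeq.weight, hgt _ (by omega), zero_mul, Finset.sum_eq_zero]
    intro k hk
    rw [Finset.mem_range] at hk
    rw [BlackSeq.innerWeightOf, if_neg (by omega), mul_zero]

theorem WhiteStep.weight_eq_zero (hgt : ∀ k, p < k → gt k = 0) {i j : ℕ} (h : i + p < j + 1)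
    (x : WhiteStep i j) : x.weight g gt = 0 := by
  cases x with
  | corner c =>
    by_cases hp : p = 0
    · omega
    · omega
  | black h' b =>
    have := b.le_length
    rw [WhiteStep.weight, BlackSeq.weight, hgt _ (by omega), zero_mul]

theorem BlackStep.weight_eq_zero (hg : ∀ k, q < k → g k = 0) {i j : ℕ} (h : j + q < i + 1)
    (x : BlackStep i j) : x.weight g gt = 0 := by
  cases x with
  | bud => omega
  | white h' w =>
    have := w.le_length
    rw [BlackStep.weight, WhiteSeq.weight, hg _ (by omega), zero_mul]

end Decomposition

/-! ### Generating functions -/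

section GeneratingFunctions

open PowerSeries

variable {ι κ : Type} {f : ι → PowerSeries ℂ} {f' : κ → PowerSeries ℂ} {F F' : PowerSeries ℂ}

theorem hasSum_mul_prod {a : ι → ℂ} {b : κ → ℂ} {s t : ℂ} (ha : HasSum a s) (hb : HasSum b t) :
    HasSum (fun x : ι × κ => a x.1 * b x.2) (s * t) :=
  HasSum.mul ha hb (summable_mul_of_summable_norm ha.summable.norm hb.summable.norm)

namespace IsGeneratingFunction

theorem unique (h : IsGeneratingFunction f F) (h' : IsGeneratingFunction f F') : F = F' := by
  ext d
  exact (h d).unique (h' d)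

theorem congr {f₁ : ι → PowerSeries ℂ} (h : IsGeneratingFunction f F) (h1 : ∀ x, f₁ x = f x) :
    IsGeneratingFunction f₁ F := by
  rwa [funext h1]

theorem mul (h : IsGeneratingFunction f F) (h' : IsGeneratingFunction f' F') :
    IsGeneratingFunction (fun x : ι × κ => f x.1 * f' x.2) (F * F') := by
  intro d
  have h1 : ∀ n ∈ Finset.HasAntidiagonal.antidiagonal d, HasSum
      (fun x : ι × κ => coeff n.1 (f x.1) * coeff n.2 (f' x.2)) (coeff n.1 F * coeff n.2 F') :=
    fun n _ => hasSum_mul_prod (a := fun x => coeff n.1 (f x)) (b := fun x => coeff n.2 (f' x))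
      (h n.1) (h' n.2)
  simp only [coeff_mul]
  exact hasSum_sum h1

theorem const_mul (a : PowerSeries ℂ) (h : IsGeneratingFunction f F) :
    IsGeneratingFunction (fun x => a * f x) (a * F) := by
  intro d
  simp only [coeff_mul]
  exact hasSum_sum fun n _ => (h n.2).mul_left _

theorem finset_sum {τ : Type} {s : Finset τ} {f : τ → ι → PowerSeries ℂ}
    {F : τ → PowerSeries ℂ} (h : ∀ k ∈ s, IsGeneratingFunction (f k) (F k)) :
    IsGeneratingFunction (fun x => ∑ k ∈ s, f k x) (∑ k ∈ s, F k) := by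
  intro d
  simp only [map_sum]
  exact hasSum_sum fun k hk => h k hk d

theorem sum_elim (h : IsGeneratingFunction f F) (h' : IsGeneratingFunction f' F') :
    IsGeneratingFunction (Sum.elim f f') (F + F') := by
  intro d
  rw [map_add]
  exact HasSum.sum (f := fun x => coeff d (Sum.elim f f' x)) (h d) (h' d)

theorem of_equiv (e : κ ≃ ι) (h : IsGeneratingFunction (fun x => f (e x)) F) :
    IsGeneratingFunction f F := fun d => (e.hasSum_iff (f := fun x => coeff d (f x))).1 (h d)

theorem zero : IsGeneratingFunction (fun _ : ι => 0) 0 := fun d => by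
  simp

theorem unit (a : PowerSeries ℂ) : IsGeneratingFunction (fun _ : Unit => a) a := fun d =>
  hasSum_unique (fun _ : Unit => coeff d a)

theorem plift (P : Prop) [Decidable P] :
    IsGeneratingFunction (fun _ : PLift P => 1) (if P then 1 else 0) := by
  intro d
  split_ifs with h
  · have : Unique (PLift P) := ⟨⟨⟨h⟩⟩, fun _ => rfl⟩
    exact hasSum_unique (fun _ : PLift P => coeff d 1)
  · have : IsEmpty (PLift P) := ⟨fun x => h x.down⟩
    simp

theorem sigma {τ : ℕ → Type} {f : (Σ l, τ l) → PowerSeries ℂ} {G : ℕ → PowerSeries ℂ} {M : ℕ}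
    (h : ∀ l < M, IsGeneratingFunction (fun x => f ⟨l, x⟩) (G l))
    (h0 : ∀ l, M ≤ l → ∀ x, f ⟨l, x⟩ = 0) :
    IsGeneratingFunction f (∑ l ∈ Finset.range M, G l) := by
  classical
  intro d
  rw [map_sum]
  have h1 : ∀ l ∈ Finset.range M, HasSum (fun x : Σ l, τ l => if x.1 = l then coeff d (f x) else 0)
      (coeff d (G l)) := by
    intro l hl
    have h2 := h l (Finset.mem_range.1 hl) d
    refine (Function.Injective.hasSum_iff (sigma_mk_injective (i := l)) ?_).1 ?_
    · rintro ⟨l', x⟩ hx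
      rw [if_neg]
      rintro rfl
      exact hx ⟨x, rfl⟩
    · simpa [Function.comp_def] using h2
  convert hasSum_sum h1 using 1
  funext x
  rw [Finset.sum_ite_eq]
  split_ifs with hx
  · rfl
  · rw [Finset.mem_range, not_lt] at hx
    rw [show f x = 0 from h0 x.1 hx x.2, map_zero]

end IsGeneratingFunction

end GeneratingFunctions

section Equations

variable {p q : ℕ} {g gt : ℕ → PowerSeries ℂ} {Q P : ℕ → ℕ → PowerSeries ℂ}

/-- A sequence of k neighbours is a walk of k steps on labels, and P i l counts the steps from i to
l with the subtrees they carry; concatenation is the matrix product. -/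
theorem isGeneratingFunction_whiteSeq (hp : RowBdd p P) (hgt : ∀ k, p < k → gt k = 0)
    (hP : ∀ i l, IsGeneratingFunction (fun x : WhiteStep i l => x.weight g gt) (P i l)) (k i j : ℕ) :
    IsGeneratingFunction (fun w : WhiteSeq i j => w.innerWeightOf g gt k) (infPow P k i j) := by
  induction k generalizing i with
  | zero =>
    refine IsGeneratingFunction.of_equiv (whiteSeqEquiv i j).symm ?_
    have := (IsGeneratingFunction.plift (i = j)).sum_elim
      (IsGeneratingFunction.zero (ι := Σ l, WhiteStep i l × WhiteSeq l j))
    rw [add_zero] at this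
    refine this.congr fun x => ?_
    rcases x with x | x
    · exact innerWeightOf_zero_inl g gt x
    · exact innerWeightOf_zero_inr g gt x
  | succ k ih =>
    refine IsGeneratingFunction.of_equiv (whiteSeqEquiv i j).symm ?_
    rw [infPow_succ' hp k (Nat.lt_succ_self _)]
    have hm : ∀ l, IsGeneratingFunction (fun x : WhiteStep i l × WhiteSeq l j =>
        x.1.weight g gt * x.2.innerWeightOf g gt k) (P i l * infPow P k l j) := fun l =>
      IsGeneratingFunction.mul (f := fun x : WhiteStep i l => x.weight g gt)
        (f' := fun s : WhiteSeq l j => s.innerWeightOf g gt k) (hP i l) (ih l)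
    have h1 := IsGeneratingFunction.sigma (M := i + p + 1)
      (f := fun x : Σ l, WhiteStep i l × WhiteSeq l j =>
        x.2.1.weight g gt * x.2.2.innerWeightOf g gt k)
      (G := fun l => P i l * infPow P k l j) (fun l _ => hm l) (fun l hl x => by
        simp only
        rw [WhiteStep.weight_eq_zero hgt (by omega), zero_mul])
    have := (IsGeneratingFunction.zero (ι := PLift (i = j))).sum_elim h1
    rw [zero_add] at this
    refine this.congr fun x => ?_
    rcases x with x | x
    · exact innerWeightOf_succ_inl g gt k x
    · exact innerWeightOf_succ_inr g gt k x

theorem isGeneratingFunction_blackSeq (hq : RowBdd 1 Q)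
    (hQ : ∀ i l, IsGeneratingFunction (fun x : BlackStep i l => x.weight g gt) (Q i l)) (k i j : ℕ) :
    IsGeneratingFunction (fun w : BlackSeq i j => w.innerWeightOf g gt k) (infPow Q k i j) := by
  induction k generalizing i with
  | zero =>
    refine IsGeneratingFunction.of_equiv (blackSeqEquiv i j).symm ?_
    have := (IsGeneratingFunction.plift (i = j)).sum_elim
      (IsGeneratingFunction.zero (ι := Σ l, BlackStep i l × BlackSeq l j))
    rw [add_zero] at this
    refine this.congr fun x => ?_
    rcases x with x | x
    · exact innerWeightOf_zero_inl' g gt x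
    · exact innerWeightOf_zero_inr' g gt x
  | succ k ih =>
    refine IsGeneratingFunction.of_equiv (blackSeqEquiv i j).symm ?_
    rw [infPow_succ' hq k (Nat.lt_succ_self _)]
    have hm : ∀ l, IsGeneratingFunction (fun x : BlackStep i l × BlackSeq l j =>
        x.1.weight g gt * x.2.innerWeightOf g gt k) (Q i l * infPow Q k l j) := fun l =>
      IsGeneratingFunction.mul (f := fun x : BlackStep i l => x.weight g gt)
        (f' := fun s : BlackSeq l j => s.innerWeightOf g gt k) (hQ i l) (ih l)
    have h1 := IsGeneratingFunction.sigma (M := i + 1 + 1)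
      (f := fun x : Σ l, BlackStep i l × BlackSeq l j =>
        x.2.1.weight g gt * x.2.2.innerWeightOf g gt k)
      (G := fun l => Q i l * infPow Q k l j) (fun l _ => hm l) (fun l hl x =>
        ((isEmpty_blackStep (by omega)).false x.1).elim)
    have := (IsGeneratingFunction.zero (ι := PLift (i = j))).sum_elim h1
    rw [zero_add] at this
    refine this.congr fun x => ?_
    rcases x with x | x
    · exact innerWeightOf_succ_inl' g gt k x
    · exact innerWeightOf_succ_inr' g gt k x

/-- The generating functions of mobiles solve the mobile system. -/
theorem isMobileSolution_of_isGeneratingFunction (hg : ∀ k, q < k → g k = 0)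
    (hgt : ∀ k, p < k → gt k = 0)
    (hP : ∀ i l, IsGeneratingFunction (fun x : WhiteStep i l => x.weight g gt) (P i l))
    (hQ : ∀ i l, IsGeneratingFunction (fun x : BlackStep i l => x.weight g gt) (Q i l)) :
    IsMobileSolution p q g gt Q P := by
  have hPb : ∀ n m, m + 1 < n ∨ n + p < m + 1 → P n m = 0 := by
    intro n m h
    refine (hP n m).unique ?_
    rcases h with h | h
    · have := isEmpty_whiteStep h
      intro d
      simp
    · simp only [WhiteStep.weight_eq_zero hgt h]
      exact IsGeneratingFunction.zero
  have hQb : ∀ n m, n + 1 < m ∨ m + q < n + 1 → Q n m = 0 := by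
    intro n m h
    refine (hQ n m).unique ?_
    rcases h with h | h
    · have := isEmpty_blackStep h
      intro d
      simp
    · simp only [BlackStep.weight_eq_zero hg h]
      exact IsGeneratingFunction.zero
  have hPr : RowBdd p P := fun n m h => hPb n m (Or.inr (by omega))
  have hQr : RowBdd 1 Q := fun n m h => hQb n m (Or.inl (by omega))
  have hW : ∀ i j, IsGeneratingFunction (fun w : WhiteSeq i j => w.weight g gt)
      (∑ k ∈ Finset.range q, g (k + 1) * infPow P k i j) := by
    intro i j
    simp only [WhiteSeq.weight_eq_sum hg]
    exact IsGeneratingFunction.finset_sum fun k _ =>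
      (isGeneratingFunction_whiteSeq hPr hgt hP k i j).const_mul _
  have hB : ∀ i j, IsGeneratingFunction (fun w : BlackSeq i j => w.weight g gt)
      (∑ k ∈ Finset.range p, gt (k + 1) * infPow Q k i j) := by
    intro i j
    simp only [BlackSeq.weight_eq_sum hgt]
    exact IsGeneratingFunction.finset_sum fun k _ =>
      (isGeneratingFunction_blackSeq hQr hQ k i j).const_mul _
  refine ⟨hQb, hPb, fun n => ?_, fun n m h => ?_, fun n m h => ?_, fun n => ?_⟩
  · exact (hQ n (n + 1)).unique (IsGeneratingFunction.of_equiv (budStepEquiv n).symm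
      (IsGeneratingFunction.unit 1))
  · exact (hP n m).unique (IsGeneratingFunction.of_equiv (flagStepEquiv h).symm (hB n m))
  · exact (hQ n m).unique (IsGeneratingFunction.of_equiv (flagStepEquiv' h).symm (hW n m))
  · have h1 : IsGeneratingFunction (fun c : CornerMobile (n + 1) => c.weight g gt) (P (n + 1) n) :=
      IsGeneratingFunction.of_equiv (cornerStepEquiv n) ((hP (n + 1) n).congr fun x => by
        cases x with
        | corner c => rfl
        | black h b => exact absurd h (by omega))
    -- A mobile rooted at a labeled corner is an isolated vertex, or a first white neighbour with
    -- its subtree followed by a mobile of the same kind: R = 1 + W R.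
    have h2 := (IsGeneratingFunction.unit 1).sum_elim ((hW n (n + 1)).mul h1)
    have h3 := h1.unique (IsGeneratingFunction.of_equiv (cornerMobileEquiv n).symm (by
      refine h2.congr fun x => ?_
      rcases x with _ | ⟨w, c⟩
      · simp [cornerMobileEquiv, CornerMobile.weight]
      · simp [cornerMobileEquiv, CornerMobile.weight, WhiteSeq.weight]))
    linear_combination h3

end Equations

end Mobile

end

noncomputable section

namespace Mobile

/-! ### Convergence of the generating functions -/

section Size

mutual
/-- The number of steps of a mobile. -/
def CornerMobile.size : {i : ℕ} → CornerMobile i → ℕ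
  | _, .vertex _ => 0
  | _, .cons w c => w.size + c.size + 1

def WhiteSeq.size : {i j : ℕ} → WhiteSeq i j → ℕ
  | _, _, .nil _ => 0
  | _, _, .labeled c s => c.size + s.size + 1
  | _, _, .flag _ b s => b.size + s.size + 1

def BlackSeq.size : {i j : ℕ} → BlackSeq i j → ℕ
  | _, _, .nil _ => 0
  | _, _, .bud s => s.size + 1
  | _, _, .flag _ w s => w.size + s.size + 1
end

def WhiteStep.size {i j : ℕ} : WhiteStep i j → ℕ
  | .corner c => c.size
  | .black _ b => b.size

def BlackStep.size {i j : ℕ} : BlackStep i j → ℕ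
  | .bud _ => 0
  | .white _ w => w.size

theorem WhiteSeq.size_join {i j l : ℕ} (x : WhiteStep i l) (s : WhiteSeq l j) :
    ((whiteSeqEquiv i j).symm (.inr ⟨l, x, s⟩)).size = x.size + s.size + 1 := by
  cases x <;> simp [whiteSeqEquiv, WhiteSeq.join, WhiteSeq.size, WhiteStep.size]

theorem BlackSeq.size_join {i j l : ℕ} (x : BlackStep i l) (s : BlackSeq l j) :
    ((blackSeqEquiv i j).symm (.inr ⟨l, x, s⟩)).size = x.size + s.size + 1 := by
  cases x <;> simp [blackSeqEquiv, BlackSeq.join, BlackSeq.size, BlackStep.size]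

end Size

section Walks

variable {S : Type} [CommSemiring S]

/-- Weighted number of walks with `k` steps of sizes between `-M` and `M` and total displacement
`s`. -/
def walk (M : ℕ) (y : ℤ → S) : ℕ → ℤ → S
  | 0, s => if s = 0 then 1 else 0
  | k + 1, s => ∑ r ∈ Finset.Icc (-(M : ℤ)) M, y r * walk M y k (s - r)

theorem walk_one {M : ℕ} {y : ℤ → S} {s : ℤ} (hs : s ∈ Finset.Icc (-(M : ℤ)) M) :
    walk M y 1 s = y s := by
  simp only [walk]
  rw [Finset.sum_eq_single s]
  · simp
  · intro r _ hr
    rw [if_neg (by omega), mul_zero]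
  · intro h; exact absurd hs h

theorem map_walk {S' : Type} [CommSemiring S'] (f : S →+* S') (M : ℕ) (y : ℤ → S) (k : ℕ) (s : ℤ) :
    f (walk M y k s) = walk M (fun r => f (y r)) k s := by
  induction k generalizing s with
  | zero => simp only [walk]; split_ifs <;> simp
  | succ k ih => simp only [walk, map_sum, map_mul, ih]

end Walks

section Truncation

open ENNReal

theorem tsum_sum_type {ι κ : Type} (f : ι ⊕ κ → ℝ≥0∞) :
    ∑' x, f x = ∑' x, f (.inl x) + ∑' x, f (.inr x) :=
  (HasSum.sum (f := f) ENNReal.summable.hasSum ENNReal.summable.hasSum).tsum_eq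

theorem tsum_mul_prod {ι κ : Type} (f : ι → ℝ≥0∞) (f' : κ → ℝ≥0∞) :
    ∑' x : ι × κ, f x.1 * f' x.2 = (∑' x, f x) * ∑' y, f' y := by
  rw [ENNReal.tsum_prod (f := fun a b => f a * f' b)]
  simp only [ENNReal.tsum_mul_left, ENNReal.tsum_mul_right]

theorem tsum_plift (P : Prop) [Decidable P] :
    ∑' _ : PLift P, (1 : ℝ≥0∞) = if P then 1 else 0 := by
  split_ifs with h
  · have : Unique (PLift P) := ⟨⟨⟨h⟩⟩, fun _ => rfl⟩
    simp
  · have : IsEmpty (PLift P) := ⟨fun x => h x.down⟩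
    simp

/-- A finite set of objects has bounded size, so bounds uniform in the truncation pass to the full
sum. -/
theorem tsum_le_of_truncated {ι : Type} {f : ι → ℝ≥0∞} {size : ι → ℕ} {B : ℝ≥0∞}
    (h : ∀ n, ∑' x, (if size x < n then f x else 0) ≤ B) : ∑' x, f x ≤ B := by
  rw [ENNReal.tsum_eq_iSup_sum]
  refine iSup_le fun s => ?_
  refine le_trans ?_ (h (s.sup size + 1))
  refine le_trans (le_of_eq (Finset.sum_congr rfl fun x hx => ?_)) (ENNReal.sum_le_tsum s)
  rw [if_pos (Nat.lt_succ_of_le (Finset.le_sup hx))]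

/-- Dropping the condition that labels are nonnegative only adds walks and makes the bound depend on
the displacement alone. -/
theorem tsum_mul_walk_le {M : ℕ} {y : ℤ → ℝ≥0∞} {T : ℕ → ℝ≥0∞} {i j : ℕ} (k : ℕ)
    (hT : ∀ l : ℕ, T l ≤ y ((l : ℤ) - i))
    (h0 : ∀ l : ℕ, (l : ℤ) - i ∉ Finset.Icc (-(M : ℤ)) M → T l = 0) :
    ∑' l : ℕ, T l * walk M y k ((j : ℤ) - l) ≤ walk M y (k + 1) ((j : ℤ) - i) := by
  set F : ℤ → ℝ≥0∞ := fun r => if r ∈ Finset.Icc (-(M : ℤ)) M then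
    y r * walk M y k ((j : ℤ) - i - r) else 0 with hF
  have h1 : ∀ l : ℕ, T l * walk M y k ((j : ℤ) - l) ≤ F ((l : ℤ) - i) := by
    intro l
    by_cases hl : (l : ℤ) - i ∈ Finset.Icc (-(M : ℤ)) M
    · simp only [hF]
      rw [if_pos hl, show (j : ℤ) - i - (l - i) = j - l by ring]
      exact mul_le_mul_left (hT l) _
    · rw [h0 l hl, zero_mul]; exact zero_le
  refine (ENNReal.tsum_le_tsum h1).trans ((ENNReal.tsum_comp_le_tsum_of_injective
    (f := fun l : ℕ => (l : ℤ) - i) (fun a b h => by simpa using h) F).trans (le_of_eq ?_))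
  rw [tsum_eq_sum (s := Finset.Icc (-(M : ℤ)) M) (fun r hr => if_neg hr)]
  exact Finset.sum_congr rfl fun r hr => if_pos hr

variable {p q M : ℕ} {g gt : ℕ → ℝ≥0∞} {x y : ℤ → ℝ≥0∞}

/-- A supersolution of the translation invariant mobile equations. -/
structure IsSupersolution (p q M : ℕ) (g gt : ℕ → ℝ≥0∞) (x y : ℤ → ℝ≥0∞) : Prop where
  hM : p + q + 1 ≤ M
  g_zero : ∀ k, q < k → g k = 0
  gt_zero : ∀ k, p < k → gt k = 0
  x_one : 1 ≤ x 1
  x_le : ∀ j : ℕ, j < q → ∑ k ∈ Finset.range q, g (k + 1) * walk M y k (-(j : ℤ)) ≤ x (-(j : ℤ))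
  y_le : ∀ j : ℕ, j < p → ∑ k ∈ Finset.range p, gt (k + 1) * walk M x k j ≤ y j
  R_le : 1 + (∑ k ∈ Finset.range q, g (k + 1) * walk M y k 1) * y (-1) ≤ y (-1)

namespace IsSupersolution

variable (H : IsSupersolution p q M g gt x y)
include H

theorem whiteSeq_le {n : ℕ} (hn : ∀ i l, ∑' s : WhiteStep i l,
    (if s.size < n then s.weight g gt else 0) ≤ y ((l : ℤ) - i)) (k i j : ℕ) :
    ∑' w : WhiteSeq i j, (if w.size < n + 1 then w.innerWeightOf g gt k else 0) ≤
      walk M y k ((j : ℤ) - i) := by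
  induction k generalizing i with
  | zero =>
    rw [← (whiteSeqEquiv i j).symm.tsum_eq, tsum_sum_type]
    simp only [innerWeightOf_zero_inl, innerWeightOf_zero_inr, ite_self, tsum_zero, add_zero, walk]
    refine le_trans (ENNReal.tsum_le_tsum (g := fun _ => 1) fun h => ?_) ?_
    · split_ifs <;> simp
    · rw [tsum_plift]
      split_ifs <;> first | omega | simp
  | succ k ih =>
    rw [← (whiteSeqEquiv i j).symm.tsum_eq, tsum_sum_type]
    simp only [innerWeightOf_succ_inl, innerWeightOf_succ_inr, ite_self, tsum_zero, zero_add]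
    rw [ENNReal.tsum_sigma']
    refine le_trans (ENNReal.tsum_le_tsum fun l => ?_) (tsum_mul_walk_le k (hn i) fun l hl => ?_)
    · refine le_trans ?_ (mul_le_mul_right (ih l) _)
      rw [← tsum_mul_prod]
      refine ENNReal.tsum_le_tsum fun s => ?_
      obtain ⟨s1, s2⟩ := s
      simp only [WhiteSeq.size_join]
      split_ifs <;> first | omega | simp
    · rw [Finset.mem_Icc] at hl
      have hM := H.hM
      refine ENNReal.tsum_eq_zero.2 fun s => ?_
      rcases Nat.lt_or_ge (l + 1) i with h | h
      · exact ((isEmpty_whiteStep h).false s).elim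
      · rw [WhiteStep.weight_eq_zero H.gt_zero (by omega), ite_self]

theorem blackSeq_le {n : ℕ} (hn : ∀ i l, ∑' s : BlackStep i l,
    (if s.size < n then s.weight g gt else 0) ≤ x ((l : ℤ) - i)) (k i j : ℕ) :
    ∑' w : BlackSeq i j, (if w.size < n + 1 then w.innerWeightOf g gt k else 0) ≤
      walk M x k ((j : ℤ) - i) := by
  induction k generalizing i with
  | zero =>
    rw [← (blackSeqEquiv i j).symm.tsum_eq, tsum_sum_type]
    simp only [innerWeightOf_zero_inl', innerWeightOf_zero_inr', ite_self, tsum_zero, add_zero,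
      walk]
    refine le_trans (ENNReal.tsum_le_tsum (g := fun _ => 1) fun h => ?_) ?_
    · split_ifs <;> simp
    · rw [tsum_plift]
      split_ifs <;> first | omega | simp
  | succ k ih =>
    rw [← (blackSeqEquiv i j).symm.tsum_eq, tsum_sum_type]
    simp only [innerWeightOf_succ_inl', innerWeightOf_succ_inr', ite_self, tsum_zero, zero_add]
    rw [ENNReal.tsum_sigma']
    refine le_trans (ENNReal.tsum_le_tsum fun l => ?_) (tsum_mul_walk_le k (hn i) fun l hl => ?_)
    · refine le_trans ?_ (mul_le_mul_right (ih l) _)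
      rw [← tsum_mul_prod]
      refine ENNReal.tsum_le_tsum fun s => ?_
      obtain ⟨s1, s2⟩ := s
      simp only [BlackSeq.size_join]
      split_ifs <;> first | omega | simp
    · rw [Finset.mem_Icc] at hl
      have hM := H.hM
      refine ENNReal.tsum_eq_zero.2 fun s => ?_
      rcases Nat.lt_or_ge (i + 1) l with h | h
      · exact ((isEmpty_blackStep h).false s).elim
      · rw [BlackStep.weight_eq_zero H.g_zero (by omega), ite_self]

theorem whiteSeq_weight_le {n : ℕ} (hn : ∀ i l, ∑' s : WhiteStep i l,
    (if s.size < n then s.weight g gt else 0) ≤ y ((l : ℤ) - i)) (i j : ℕ) :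
    ∑' w : WhiteSeq i j, (if w.size < n + 1 then w.weight g gt else 0) ≤
      ∑ k ∈ Finset.range q, g (k + 1) * walk M y k ((j : ℤ) - i) := by
  have h1 : ∀ w : WhiteSeq i j, (if w.size < n + 1 then w.weight g gt else 0) =
      ∑ k ∈ Finset.range q, g (k + 1) *
        (if w.size < n + 1 then w.innerWeightOf g gt k else 0) := by
    intro w
    split_ifs
    · exact w.weight_eq_sum H.g_zero
    · simp
  simp only [h1]
  rw [Summable.tsum_finsetSum fun _ _ => ENNReal.summable]
  refine Finset.sum_le_sum fun k _ => ?_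
  rw [ENNReal.tsum_mul_left]
  exact mul_le_mul_right (H.whiteSeq_le hn k i j) _

theorem blackSeq_weight_le {n : ℕ} (hn : ∀ i l, ∑' s : BlackStep i l,
    (if s.size < n then s.weight g gt else 0) ≤ x ((l : ℤ) - i)) (i j : ℕ) :
    ∑' w : BlackSeq i j, (if w.size < n + 1 then w.weight g gt else 0) ≤
      ∑ k ∈ Finset.range p, gt (k + 1) * walk M x k ((j : ℤ) - i) := by
  have h1 : ∀ w : BlackSeq i j, (if w.size < n + 1 then w.weight g gt else 0) =
      ∑ k ∈ Finset.range p, gt (k + 1) *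
        (if w.size < n + 1 then w.innerWeightOf g gt k else 0) := by
    intro w
    split_ifs
    · exact w.weight_eq_sum H.gt_zero
    · simp
  simp only [h1]
  rw [Summable.tsum_finsetSum fun _ _ => ENNReal.summable]
  refine Finset.sum_le_sum fun k _ => ?_
  rw [ENNReal.tsum_mul_left]
  exact mul_le_mul_right (H.blackSeq_le hn k i j) _

/-- Induction on the size: the subtrees at the root are smaller, and the supersolution inequalities
propagate their bounds. -/
theorem truncated_step_le (n : ℕ) :
    (∀ i l, ∑' s : WhiteStep i l, (if s.size < n then s.weight g gt else 0) ≤ y ((l : ℤ) - i)) ∧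
    ∀ i l, ∑' s : BlackStep i l, (if s.size < n then s.weight g gt else 0) ≤ x ((l : ℤ) - i) := by
  induction n with
  | zero => constructor <;> intro i l <;> simp
  | succ n ih =>
    obtain ⟨ih1, ih2⟩ := ih
    constructor
    · intro i l
      rcases lt_trichotomy (l + 1) i with h | h | h
      · have := isEmpty_whiteStep h
        simp
      · subst h
        rw [← (cornerStepEquiv l).symm.tsum_eq, ← (cornerMobileEquiv l).symm.tsum_eq, tsum_sum_type,
          show (l : ℤ) - ((l + 1 : ℕ) : ℤ) = -1 by push_cast; ring]
        -- The two summands are the isolated vertex and the split at the first white neighbour, as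
        -- in R = 1 + W R.
        refine le_trans (add_le_add (b := 1) (d := (∑' w : WhiteSeq l (l + 1),
          (if w.size < n + 1 then w.weight g gt else 0)) *
            ∑' s : WhiteStep (l + 1) l, (if s.size < n then s.weight g gt else 0)) ?_ ?_) ?_
        · simp [cornerMobileEquiv, cornerStepEquiv, WhiteStep.weight, WhiteStep.size,
            CornerMobile.weight, CornerMobile.size]
        · rw [← (cornerStepEquiv l).symm.tsum_eq (fun s : WhiteStep (l + 1) l =>
            (if s.size < n then s.weight g gt else 0)), ← tsum_mul_prod]
          refine ENNReal.tsum_le_tsum fun s => ?_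
          obtain ⟨w, c⟩ := s
          change (if w.size + c.size + 1 < n + 1 then
            g (w.length + 1) * w.innerWeight g gt * c.weight g gt else 0) ≤
            (if w.size < n + 1 then g (w.length + 1) * w.innerWeight g gt else 0) *
              (if c.size < n then c.weight g gt else 0)
          split_ifs <;> first | omega | simp
        · refine le_trans (add_le_add_right (mul_le_mul' (H.whiteSeq_weight_le ih1 l (l + 1))
            (ih1 (l + 1) l)) 1) ?_
          have e1 : ((l + 1 : ℕ) : ℤ) - l = 1 := by push_cast; ring
          have e2 : (l : ℤ) - ((l + 1 : ℕ) : ℤ) = -1 := by push_cast; ring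
          rw [e1, e2]
          exact H.R_le
      · have h' : i ≤ l := by omega
        rcases Nat.lt_or_ge (l - i) p with hp | hp
        · rw [← (flagStepEquiv h').symm.tsum_eq]
          have := H.blackSeq_weight_le ih2 i l
          rw [show (l : ℤ) - i = ((l - i : ℕ) : ℤ) by omega] at this ⊢
          exact this.trans (H.y_le _ hp)
        · refine le_trans (le_of_eq (ENNReal.tsum_eq_zero.2 fun s => ?_)) zero_le
          rw [WhiteStep.weight_eq_zero H.gt_zero (by omega), ite_self]
    · intro i l
      rcases lt_trichotomy (i + 1) l with h | h | h
      · have := isEmpty_blackStep h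
        simp
      · subst h
        rw [← (budStepEquiv i).symm.tsum_eq]
        have e1 : ((i + 1 : ℕ) : ℤ) - i = 1 := by push_cast; ring
        rw [e1]
        refine le_trans (le_of_eq ?_) H.x_one
        simp [budStepEquiv, BlackStep.size, BlackStep.weight]
      · have h' : l ≤ i := by omega
        rcases Nat.lt_or_ge (i - l) q with hp | hp
        · rw [← (flagStepEquiv' h').symm.tsum_eq]
          have := H.whiteSeq_weight_le ih1 i l
          rw [show (l : ℤ) - i = -((i - l : ℕ) : ℤ) by omega] at this ⊢
          exact this.trans (H.x_le _ hp)
        · refine le_trans (le_of_eq (ENNReal.tsum_eq_zero.2 fun s => ?_)) zero_le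
          rw [BlackStep.weight_eq_zero H.g_zero (by omega), ite_self]

theorem whiteStep_le (i l : ℕ) : ∑' s : WhiteStep i l, s.weight g gt ≤ y ((l : ℤ) - i) :=
  tsum_le_of_truncated fun n => (H.truncated_step_le n).1 i l

theorem blackStep_le (i l : ℕ) : ∑' s : BlackStep i l, s.weight g gt ≤ x ((l : ℤ) - i) :=
  tsum_le_of_truncated fun n => (H.truncated_step_le n).2 i l

end IsSupersolution

end Truncation

end Mobile

end

noncomputable section

namespace Mobile

/-! ### Absolute convergence for small couplings -/

section Domination

open ENNReal NNReal

/-- `f` is a monomial, whose absolute value at `ε` is at most `x`. -/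
def MonomialBound (ε : ℝ≥0) (x : ℝ≥0∞) (f : PowerSeries ℂ) : Prop :=
  ∃ (a : ℂ) (e : ℕ), f = PowerSeries.C a * PowerSeries.X ^ e ∧ ((‖a‖₊ * ε ^ e : ℝ≥0) : ℝ≥0∞) ≤ x

namespace MonomialBound

variable {ε : ℝ≥0} {x x' : ℝ≥0∞} {f f' : PowerSeries ℂ}

theorem one : MonomialBound ε 1 1 := ⟨1, 0, by simp, by simp⟩

theorem mul (h : MonomialBound ε x f) (h' : MonomialBound ε x' f') :
    MonomialBound ε (x * x') (f * f') := by
  obtain ⟨a, e, rfl, h⟩ := h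
  obtain ⟨a', e', rfl, h'⟩ := h'
  refine ⟨a * a', e + e', by rw [map_mul, pow_add]; ring, ?_⟩
  refine le_trans (le_of_eq ?_) (mul_le_mul' h h')
  rw [← ENNReal.coe_mul, nnnorm_mul, pow_add]
  congr 1
  ring

theorem coeff_le (h : MonomialBound ε x f) (d : ℕ) :
    ((‖PowerSeries.coeff d f‖₊ * ε ^ d : ℝ≥0) : ℝ≥0∞) ≤ x := by
  obtain ⟨a, e, rfl, h⟩ := h
  rw [PowerSeries.coeff_C_mul, PowerSeries.coeff_X_pow]
  split_ifs with hd
  · subst hd; simpa using h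
  · simp

/-- Each weight is a single monomial, so its coefficient of degree d, times ε^d, is below the bound;
summability follows for each d separately. -/
theorem exists_isGeneratingFunction {ι : Type} {weight : ι → PowerSeries ℂ} {bound : ι → ℝ≥0∞}
    (hε : 0 < ε) (h : ∀ i, MonomialBound ε (bound i) (weight i)) (hs : ∑' i, bound i ≠ ⊤) :
    ∃ F, IsGeneratingFunction weight F := by
  refine ⟨PowerSeries.mk fun d => ∑' i, PowerSeries.coeff d (weight i), fun d => ?_⟩
  rw [PowerSeries.coeff_mk]
  refine Summable.hasSum ?_
  have h1 : ∑' i, ((‖PowerSeries.coeff d (weight i)‖₊ * ε ^ d : ℝ≥0) : ℝ≥0∞) ≠ ⊤ :=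
    ne_top_of_le_ne_top hs (ENNReal.tsum_le_tsum fun i => (h i).coeff_le d)
  rw [ENNReal.tsum_coe_ne_top_iff_summable] at h1
  have h2 : Summable fun i => ‖PowerSeries.coeff d (weight i)‖₊ :=
    (summable_mul_right_iff (pow_pos hε d).ne').1 h1
  exact Summable.of_nnnorm h2

end MonomialBound

variable {ε : ℝ≥0} {G Gt : ℕ → ℝ≥0∞} {g gt : ℕ → PowerSeries ℂ}
  (hg : ∀ k, MonomialBound ε (G k) (g k)) (hgt : ∀ k, MonomialBound ε (Gt k) (gt k))
include hg hgt
set_option linter.unusedSectionVars false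

mutual
theorem CornerMobile.monomialBound : ∀ {i : ℕ} (c : CornerMobile i),
    MonomialBound ε (c.weight G Gt) (c.weight g gt)
  | _, .vertex _ => by simpa only [CornerMobile.weight] using .one
  | _, .cons w c => by
    simpa only [CornerMobile.weight] using
      ((hg _).mul w.monomialBound).mul c.monomialBound

theorem WhiteSeq.monomialBound : ∀ {i j : ℕ} (w : WhiteSeq i j),
    MonomialBound ε (w.innerWeight G Gt) (w.innerWeight g gt)
  | _, _, .nil _ => by simpa only [WhiteSeq.innerWeight] using .one
  | _, _, .labeled c s => by
    simpa only [WhiteSeq.innerWeight] using c.monomialBound.mul s.monomialBound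
  | _, _, .flag _ b s => by
    simpa only [WhiteSeq.innerWeight] using
      ((hgt _).mul b.monomialBound).mul s.monomialBound

theorem BlackSeq.monomialBound : ∀ {i j : ℕ} (b : BlackSeq i j),
    MonomialBound ε (b.innerWeight G Gt) (b.innerWeight g gt)
  | _, _, .nil _ => by simpa only [BlackSeq.innerWeight] using .one
  | _, _, .bud s => by simpa only [BlackSeq.innerWeight] using s.monomialBound
  | _, _, .flag _ w s => by
    simpa only [BlackSeq.innerWeight] using
      ((hg _).mul w.monomialBound).mul s.monomialBound
end

theorem WhiteStep.monomialBound {i l : ℕ} (s : WhiteStep i l) :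
    MonomialBound ε (s.weight G Gt) (s.weight g gt) := by
  cases s with
  | corner c => exact c.monomialBound hg hgt
  | black _ b => exact (hgt _).mul (b.monomialBound hg hgt)

theorem BlackStep.monomialBound {i l : ℕ} (s : BlackStep i l) :
    MonomialBound ε (s.weight G Gt) (s.weight g gt) := by
  cases s with
  | bud => exact .one
  | white _ w => exact (hg _).mul (w.monomialBound hg hgt)

end Domination

section Existence

open ENNReal NNReal Filter Topology

/-- At ε = 0 only k = 1 survives, and a strict inequality persists by continuity. -/
theorem eventually_sum_lt {a : ℕ → ℝ≥0} (ha : a 1 = 0) {n : ℕ} (hn : 2 ≤ n) {W : ℕ → ℝ≥0}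
    {c : ℝ≥0} (h : a 2 * W 1 < c) :
    ∀ᶠ ε in 𝓝 (0 : ℝ≥0), ∑ k ∈ Finset.range n, a (k + 1) * ε ^ (k + 1 - 2) * W k < c := by
  have hc : Continuous fun ε : ℝ≥0 => ∑ k ∈ Finset.range n, a (k + 1) * ε ^ (k + 1 - 2) * W k := by
    fun_prop
  refine hc.continuousAt.eventually_lt continuousAt_const (lt_of_eq_of_lt ?_ h)
  rw [Finset.sum_eq_single 1]
  · simp
  · intro k _ hk
    rcases Nat.eq_zero_or_pos k with rfl | hk'
    -- For k = 0 the truncated exponent is 0, so the power does not vanish and a 1 = 0 is needed.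
    · simp [ha]
    · rw [zero_pow (by omega)]; simp
  · intro h; exact absurd (Finset.mem_range.2 (by omega)) h

/-- At ε = 0 only a_2 and b_2 remain and the system is nearly linear, with strict supersolutions
because a_2 b_2 < 1. Finitely many strict inequalities then survive for some ε > 0. -/
theorem exists_isSupersolution {p q : ℕ} (hp : 2 ≤ p) (hq : 2 ≤ q) {a b : ℕ → ℝ≥0}
    (ha : a 1 = 0) (hb : b 1 = 0) (ha' : ∀ k, q < k → a k = 0) (hb' : ∀ k, p < k → b k = 0)
    (hab : a 2 * b 2 < 1) :
    ∃ (ε : ℝ≥0) (x y : ℤ → ℝ≥0), 0 < ε ∧ IsSupersolution p q (p + q + 1)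
      (fun k => ((a k * ε ^ (k - 2) : ℝ≥0) : ℝ≥0∞)) (fun k => ((b k * ε ^ (k - 2) : ℝ≥0) : ℝ≥0∞))
      (fun r => (x r : ℝ≥0∞)) (fun r => (y r : ℝ≥0∞)) := by
  obtain ⟨δ, hδ, hδ'⟩ : ∃ δ : ℝ≥0, 0 < δ ∧ (a 2 + δ) * (b 2 + δ) < 1 := by
    have hc : Continuous fun δ : ℝ≥0 => (a 2 + δ) * (b 2 + δ) := by fun_prop
    have h1 : ∀ᶠ δ in 𝓝 (0 : ℝ≥0), (a 2 + δ) * (b 2 + δ) < 1 :=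
      hc.continuousAt.eventually_lt continuousAt_const (by simpa using hab)
    obtain ⟨δ, h⟩ := ((h1.filter_mono nhdsWithin_le_nhds).and
      (self_mem_nhdsWithin : Set.Ioi (0 : ℝ≥0) ∈ 𝓝[>] 0)).exists
    exact ⟨δ, h.2, h.1⟩
  -- What is required at ε = 0 is a_2 < A, b_2 < B, b_2 A < 1 and a_2 B < d < 1; R then solves 1 + d
  -- R = R.
  set A := a 2 + δ with hA
  set B := b 2 + δ with hB
  have hA' : a 2 < A := lt_add_of_pos_right _ hδ
  have hB' : b 2 < B := lt_add_of_pos_right _ hδ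
  have hAB : a 2 * B < 1 := lt_of_le_of_lt (mul_le_mul_left hA'.le _) hδ'
  have hBA : b 2 * A < 1 := by
    rw [mul_comm]; exact lt_of_le_of_lt (mul_le_mul_right hB'.le _) hδ'
  obtain ⟨d, hd, hd'⟩ := exists_between hAB
  obtain ⟨R, hR, hR'⟩ : ∃ R : ℝ≥0, 0 < R ∧ 1 + d * R = R := by
    have h1 : 0 < 1 - (d : ℝ) := sub_pos.2 (by exact_mod_cast hd')
    lift (1 - (d : ℝ))⁻¹ to ℝ≥0 using (inv_pos.2 h1).le with r hr
    have h2 : (r : ℝ) * (1 - d) = 1 := by rw [hr]; exact inv_mul_cancel₀ h1.ne'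
    refine ⟨r, ?_, ?_⟩
    · rw [← NNReal.coe_pos, hr]; exact inv_pos.2 h1
    · rw [← NNReal.coe_inj]
      push_cast
      linear_combination -h2
  set M := p + q + 1 with hM
  -- Displacements of absolute value at least 2 receive no contribution at ε = 0, so any positive
  -- value would do where a bound is required.
  set x : ℤ → ℝ≥0 := fun r => if r = 0 then A else if r = -1 then A * R else
    if r ≤ 1 then 1 else 0 with hx
  set y : ℤ → ℝ≥0 := fun r => if r = -1 then R else if r = 1 then B else
    if 0 ≤ r then 1 else 0 with hy
  have hWx : ∀ r : ℤ, r ∈ Finset.Icc (-(M : ℤ)) M → walk M x 1 r = x r := fun r hr => walk_one hr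
  have hWy : ∀ r : ℤ, r ∈ Finset.Icc (-(M : ℤ)) M → walk M y 1 r = y r := fun r hr => walk_one hr
  have h1 : ∀ j ∈ Finset.range q, ∀ᶠ ε in 𝓝 (0 : ℝ≥0), ∑ k ∈ Finset.range q,
      a (k + 1) * ε ^ (k + 1 - 2) * walk M y k (-(j : ℤ)) < x (-(j : ℤ)) := by
    intro j hj
    rw [Finset.mem_range] at hj
    refine eventually_sum_lt ha hq ?_
    rw [hWy _ (Finset.mem_Icc.2 (by omega))]
    rcases j with _ | _ | j
    · simpa [hx, hy] using hA'
    · simpa [hx, hy] using mul_lt_mul_of_pos_right hA' hR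
    · have e1 : x (-((j + 1 + 1 : ℕ) : ℤ)) = 1 := by
        simp only [hx]
        rw [if_neg (by omega), if_neg (by omega), if_pos (by omega)]
      have e2 : y (-((j + 1 + 1 : ℕ) : ℤ)) = 0 := by
        simp only [hy]
        rw [if_neg (by omega), if_neg (by omega), if_neg (by omega)]
      rw [e1, e2]; simp
  have h2 : ∀ j ∈ Finset.range p, ∀ᶠ ε in 𝓝 (0 : ℝ≥0), ∑ k ∈ Finset.range p,
      b (k + 1) * ε ^ (k + 1 - 2) * walk M x k (j : ℤ) < y (j : ℤ) := by
    intro j hj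
    rw [Finset.mem_range] at hj
    refine eventually_sum_lt hb hp ?_
    rw [hWx _ (Finset.mem_Icc.2 (by omega))]
    rcases j with _ | _ | j
    · simpa [hx, hy] using hBA
    · simpa [hx, hy] using hB'
    · have e1 : x ((j + 1 + 1 : ℕ) : ℤ) = 0 := by
        simp only [hx]
        rw [if_neg (by omega), if_neg (by omega), if_neg (by omega)]
      have e2 : y ((j + 1 + 1 : ℕ) : ℤ) = 1 := by
        simp only [hy]
        rw [if_neg (by omega), if_neg (by omega), if_pos (by omega)]
      rw [e1, e2]; simp
  have h3 : ∀ᶠ ε in 𝓝 (0 : ℝ≥0), ∑ k ∈ Finset.range q,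
      a (k + 1) * ε ^ (k + 1 - 2) * walk M y k 1 < d := by
    refine eventually_sum_lt ha hq ?_
    rw [hWy _ (Finset.mem_Icc.2 (by omega))]
    simpa [hy] using hd
  obtain ⟨ε, ⟨⟨⟨h1, h2⟩, h3⟩, hε⟩⟩ := (((((Finset.eventually_all _).2 h1).and
    ((Finset.eventually_all _).2 h2)).and h3).filter_mono nhdsWithin_le_nhds |>.and
      (self_mem_nhdsWithin : Set.Ioi (0 : ℝ≥0) ∈ 𝓝[>] 0)).exists
  have hwy : ∀ k s, walk M (fun r => (y r : ℝ≥0∞)) k s = ((walk M y k s : ℝ≥0) : ℝ≥0∞) :=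
    fun k s => (map_walk ENNReal.ofNNRealHom M y k s).symm
  have hwx : ∀ k s, walk M (fun r => (x r : ℝ≥0∞)) k s = ((walk M x k s : ℝ≥0) : ℝ≥0∞) :=
    fun k s => (map_walk ENNReal.ofNNRealHom M x k s).symm
  refine ⟨ε, x, y, hε, le_rfl, fun k hk => by simp [ha' k hk], fun k hk => by simp [hb' k hk],
    by simp [hx], fun j hj => ?_, fun j hj => ?_, ?_⟩
  · simp only [hwy]
    exact_mod_cast (h1 j (Finset.mem_range.2 hj)).le
  · simp only [hwx]
    exact_mod_cast (h2 j (Finset.mem_range.2 hj)).le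
  · simp only [hwy]
    have e : y (-1) = R := by simp [hy]
    rw [e]
    have h4 := add_le_add_right (mul_le_mul_left h3.le R) 1
    rw [hR'] at h4
    exact_mod_cast h4

theorem monomialBound_coupling {r : ℕ} (lam : Finset.Icc 2 r → ℂ) (ε : ℝ≥0) (k : ℕ) :
    MonomialBound ε ((‖extend lam k‖₊ * ε ^ (k - 2) : ℝ≥0) : ℝ≥0∞) (coupling lam k) :=
  ⟨_, _, rfl, le_rfl⟩

theorem exists_isGeneratingFunction {p q : ℕ} (hp : 2 ≤ p) (hq : 2 ≤ q)
    (lam : Finset.Icc 2 q → ℂ) (lamT : Finset.Icc 2 p → ℂ)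
    (hlam : ‖extend lam 2 * extend lamT 2‖ < 1) :
    ∃ Q P : ℕ → ℕ → PowerSeries ℂ,
      (∀ i l, IsGeneratingFunction
        (fun s : WhiteStep i l => s.weight (coupling lam) (coupling lamT)) (P i l)) ∧
      ∀ i l, IsGeneratingFunction
        (fun s : BlackStep i l => s.weight (coupling lam) (coupling lamT)) (Q i l) := by
  obtain ⟨ε, x, y, hε, H⟩ := exists_isSupersolution hp hq
    (a := fun k => ‖extend lam k‖₊) (b := fun k => ‖extend lamT k‖₊)
    (by simp [extend]) (by simp [extend])
    (fun k hk => by simp [extend_of_gt lam k hk]) (fun k hk => by simp [extend_of_gt lamT k hk])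
    (by rw [← nnnorm_mul]; exact_mod_cast hlam)
  have h1 := fun i l => MonomialBound.exists_isGeneratingFunction hε
    (fun s : WhiteStep i l => s.monomialBound (monomialBound_coupling lam ε)
      (monomialBound_coupling lamT ε))
    (ne_top_of_le_ne_top ENNReal.coe_ne_top (H.whiteStep_le i l))
  have h2 := fun i l => MonomialBound.exists_isGeneratingFunction hε
    (fun s : BlackStep i l => s.monomialBound (monomialBound_coupling lam ε)
      (monomialBound_coupling lamT ε))
    (ne_top_of_le_ne_top ENNReal.coe_ne_top (H.blackStep_le i l))
  choose P hP using h1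
  choose Q hQ using h2
  exact ⟨Q, P, hP, hQ⟩

end Existence

end Mobile

end

noncomputable section

namespace Mobile

-- Identification with the generating functions and the main theorem

variable {p q : ℕ} {lam : Finset.Icc 2 q → ℂ} {lamT : Finset.Icc 2 p → ℂ}

/-- The only solution of the mobile system in power series consists of the generating functions. -/
theorem IsMobileSolution.isGeneratingFunction (hp : 2 ≤ p) (hq : 2 ≤ q)
    {Q P : ℕ → ℕ → PowerSeries ℂ} (h : IsMobileSolution p q (coupling lam) (coupling lamT) Q P)
    (hlam : ‖extend lam 2 * extend lamT 2‖ < 1) :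
    (∀ i l, IsGeneratingFunction
      (fun s : WhiteStep i l => s.weight (coupling lam) (coupling lamT)) (P i l)) ∧
    ∀ i l, IsGeneratingFunction
      (fun s : BlackStep i l => s.weight (coupling lam) (coupling lamT)) (Q i l) := by
  obtain ⟨Q', P', hP, hQ⟩ := exists_isGeneratingFunction hp hq lam lamT hlam
  have hne : extend lam 2 * extend lamT 2 ≠ 1 := fun h => by rw [h] at hlam; simp at hlam
  obtain ⟨rfl, rfl⟩ := h.unique hp hq hne (isMobileSolution_of_isGeneratingFunction
    (coupling_of_gt lam) (coupling_of_gt lamT) hP hQ)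
  exact ⟨hP, hQ⟩

end Mobile

end

theorem theorem4p1 (p q : ℕ) (hpq : 1 < (p - 1) * (q - 1)) :
    -- a nonzero polynomial in the `lam_k`, `lamT_k`, whose zero set is the excluded locus
    ∃ D : MvPolynomial (Finset.Icc 2 q ⊕ Finset.Icc 2 p) ℂ, D ≠ 0 ∧
    ∀ (lam : Finset.Icc 2 q → ℂ) (lamT : Finset.Icc 2 p → ℂ),
      MvPolynomial.eval (Sum.elim lam lamT) D ≠ 0 →
    -- the spectral curve, with coefficients in the power series in `√g`
    ∃ c : Mobile.Curve (PowerSeries ℂ),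
      c.IsSpectral p q (Mobile.coupling lam) (Mobile.coupling lamT) ∧
      (∀ c' : Mobile.Curve (PowerSeries ℂ),
        c'.IsSpectral p q (Mobile.coupling lam) (Mobile.coupling lamT) → c' = c) ∧
    -- its `N` double points
    (∃ w wb : Fin ((p - 1) * (q - 1) - 1) → (LaurentSeries ℂ)ˣ,
      (c.map Mobile.toLaurent).IsDoublePointList p q w wb) ∧
    ∀ w wb : Fin ((p - 1) * (q - 1) - 1) → (LaurentSeries ℂ)ˣ,
      (c.map Mobile.toLaurent).IsDoublePointList p q w wb →
    -- the Baker-Akhiezer functions `ψ_n`, `φ_n`, `n ≥ 0`, are well defined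
    (∀ n : ℕ, Mobile.h w wb n ≠ 0 ∧
      Mobile.h w wb (-2 - (n : ℤ) - (((p - 1) * (q - 1) - 1 : ℕ) : ℤ)) ≠ 0) ∧
    ∃ Q P : ℕ → ℕ → PowerSeries ℂ,
      -- the scalar products are power series in `√g`
      (∀ n m : ℕ, Mobile.toLaurent (Q n m) =
        Mobile.scalarProduct w wb (Mobile.phi w wb m)
          ((c.map Mobile.toLaurent).X q * Mobile.psi w wb n)) ∧
      (∀ n m : ℕ, Mobile.toLaurent (P n m) =
        Mobile.scalarProduct w wb (Mobile.phi w wb m)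
          ((c.map Mobile.toLaurent).Y p * Mobile.psi w wb n)) ∧
      -- they solve the mobile system, and this is its only solution in power series
      Mobile.IsMobileSystem p q
        (fun k => Mobile.toLaurent (Mobile.coupling lam k))
        (fun k => Mobile.toLaurent (Mobile.coupling lamT k))
        (fun n m => Mobile.toLaurent (Q n m)) (fun n m => Mobile.toLaurent (P n m)) ∧
      (∀ Q' P' : ℕ → ℕ → PowerSeries ℂ,
        Mobile.IsMobileSystem p q
          (fun k => Mobile.toLaurent (Mobile.coupling lam k))
          (fun k => Mobile.toLaurent (Mobile.coupling lamT k))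
          (fun n m => Mobile.toLaurent (Q' n m)) (fun n m => Mobile.toLaurent (P' n m)) →
        Q' = Q ∧ P' = P) ∧
      -- the entries are the generating functions of mobiles and half-mobiles
      (‖Mobile.extend lam 2 * Mobile.extend lamT 2‖ < 1 →
        (∀ i : ℕ, Mobile.IsGeneratingFunction
          (fun m : Mobile.CornerMobile (i + 1) =>
            m.weight (Mobile.coupling lam) (Mobile.coupling lamT)) (P (i + 1) i)) ∧
        (∀ i j : ℕ, j ≤ i → Mobile.IsGeneratingFunction
          (fun m : Mobile.WhiteSeq i j =>
            m.weight (Mobile.coupling lam) (Mobile.coupling lamT)) (Q i j)) ∧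
        (∀ i j : ℕ, i ≤ j → Mobile.IsGeneratingFunction
          (fun m : Mobile.BlackSeq i j =>
            m.weight (Mobile.coupling lam) (Mobile.coupling lamT)) (P i j))) ∧
      -- the formula for `R_n`, `n ≥ 1`
      (∀ n : ℕ, 1 ≤ n → Mobile.toLaurent (P n (n - 1)) =
        Mobile.toLaurent c.R *
          (Mobile.h w wb ((n : ℤ) - 1) * Mobile.h w wb ((n : ℤ) + 1)) /
            (Mobile.h w wb (n : ℤ)) ^ 2) := by
  -- With truncated subtraction p ≤ 1 would give p - 1 = 0.
  have hp : 2 ≤ p := by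
    by_contra hp
    rw [show p - 1 = 0 by omega] at hpq
    omega
  have hq : 2 ≤ q := by
    by_contra hq
    rw [show q - 1 = 0 by omega] at hpq
    omega
  obtain ⟨D, hD, hgen⟩ := Mobile.exists_generic_polynomial hp hq hpq
  refine ⟨D, hD, fun lam lamT hne => ?_⟩
  obtain ⟨hlam, hlamT, hsep⟩ := hgen lam lamT hne
  have h12 := Mobile.mul_ne_one_of_separable hp hq hsep
  obtain ⟨c, hc, hcu⟩ := Mobile.exists_unique_spectral hp hq h12
  have G : Mobile.IsGeneric p q lam lamT c := ⟨hp, hq, hpq, hc, hlam, hlamT, hsep⟩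
  refine ⟨c, hc, hcu, G.exists_isDoublePointList, fun w wb hw => ?_⟩
  have S := G.isSeparated hw
  have H := G.isNodalPair hw
  have hpos : ∀ n : ℕ, Mobile.h w wb n ≠ 0 := fun n => S.h_ne_zero (by omega)
  have hneg : ∀ n : ℕ, Mobile.h w wb
      (-2 - (n : ℤ) - (((p - 1) * (q - 1) - 1 : ℕ) : ℤ)) ≠ 0 := fun n => S.h_ne_zero' (by omega)
  have hX := G.isLeading.graded_X (q := q)
  have hY := G.isLeading.graded_Y (p := p)
  -- The scalar products have no negative powers of t, so they come from power series.
  choose Q hQ using fun n m : ℕ =>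
    Mobile.exists_toLaurent_eq_of_ordGE (S.ordGE_residue hX.1 hX.2 n m)
  choose P hP using fun n m : ℕ =>
    Mobile.exists_toLaurent_eq_of_ordGE (S.ordGE_residue hY.1 hY.2 n m)
  have hR : (c.map Mobile.toLaurent).R ≠ 0 := fun h0 => by
    apply G.isLeading.r0_ne
    rw [← G.isLeading.R_lead, h0, HahnSeries.coeff_zero]
  have hsys : Mobile.IsMobileSystem p q
      (fun k => Mobile.toLaurent (Mobile.coupling lam k))
      (fun k => Mobile.toLaurent (Mobile.coupling lamT k))
      (fun n m => Mobile.toLaurent (Q n m)) (fun n m => Mobile.toLaurent (P n m)) := by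
    have : CharZero (LaurentSeries ℂ) := charZero_of_injective_ringHom
      (HahnSeries.C_injective (Γ := ℤ) (R := ℂ))
    simp only [hQ, hP]
    exact H.isMobileSystem hp hq (hc.map Mobile.toLaurent) hR hpos hneg
  -- Pulled back to power series, the system has only one solution, which gives both the uniqueness
  -- claim and the equality with the generating functions.
  have hsol := hsys.isMobileSolution Mobile.toLaurent_injective
  refine ⟨fun n => ⟨hpos n, hneg n⟩, Q, P, hQ, hP, hsys, fun Q' P' h' =>
    (h'.isMobileSolution Mobile.toLaurent_injective).unique hp hq h12 hsol, fun hlt => ?_,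
    fun n hn => (hP _ _).trans (H.scalarProduct_Y_subdiag hpos hneg n hn)⟩
  obtain ⟨gP, gQ⟩ := hsol.isGeneratingFunction hp hq hlt
  exact ⟨fun i => .of_equiv (Mobile.cornerStepEquiv i)
      ((gP (i + 1) i).congr fun x => by cases x <;> first | rfl | omega),
    fun i j hij => .of_equiv (Mobile.flagStepEquiv' hij)
      ((gQ i j).congr fun x => by cases x <;> first | rfl | omega),
    fun i j hij => .of_equiv (Mobile.flagStepEquiv hij)
      ((gP i j).congr fun x => by cases x <;> first | rfl | omega)⟩
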